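/- **Setting.** Let $\Omega\subset\mathbb R^2$ be an unbounded domain whose boundary $\partial\Omega$ is a smooth Jordan curve of length $L_{\partial\Omega}$. On a smooth Jordan curve let $\boldsymbol n$ be the outward unit normal (pointing out of the enclosed region), $s$ the arc length and $\kappa$ the signed curvature (the unit circle has $\kappa=+1$). *2-exD.* $U\in C^2(\Omega\cup\partial\Omega)$ is harmonic in $\Omega$ and equal to a constant $c$ on $\partial\Omega$, with $-\oint_{\partial\Omega}\boldsymbol n\cdot\nabla U\,ds=\Phi>0$ and $U(\boldsymbol r)\sim-\frac{\Phi}{2\pi}\log\frac{2\pi|\boldsymbol r|}{L_{\partial\Omega}}$ as $|\boldsymbol r|\to\infty$ (the quotient of the two sides tends to $1$). Put $S=\Omega\cup\partial\Omega$, $f=U$ and $I=(-\infty,c]$. *2-inD.* $\partial\Omega$ encloses the origin $\boldsymbol 0$, and $G\in C^2(\mathbb R^2\smallsetminus(\Omega\cup\{\boldsymbol 0\}))$ is harmonic in $\mathbb R^2\smallsetminus(\Omega\cup\partial\Omega\cup\{\boldsymbol 0\})$ and equal to a constant $c$ on $\partial\Omega$, with $-\lim_{\varepsilon\to0^+}\oint_{|\boldsymbol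 r|=\varepsilon}\boldsymbol n\cdot\nabla G\,ds=\Phi\neq0$ and $G(\boldsymbol r)=O(|\log|\boldsymbol r||)$ as $\boldsymbol r\to\boldsymbol 0$. Put $S=\mathbb R^2\smallsetminus(\Omega\cup\{\boldsymbol 0\})$ and $f=G$; put $I=[c,\infty)$ if $\Phi>0$ and $I=(-\infty,c]$ if $\Phi<0$. In both cases let $E=|\nabla f|$ (the gradient at points of $\partial\Omega$ being taken from within $S$) and $\Sigma_\varphi=\{\boldsymbol r\in S: f(\boldsymbol r)=\varphi\}$. **Proposition (A geometric conservation law).** In 2-exD and in 2-inD, $\nabla f$ has no zeros on $S$, $f(S)=I$, and for every $\varphi\in I$ the level set $\Sigma_\varphi$ is a smooth Jordan curve. The quantity $$\mathscr E(\varphi)=\oint_{\Sigma_\varphi}\frac{\kappa^2}{E}\,ds-\oint_{\Sigma_\varphi}\frac{|\boldsymbol n\times\nabla\log E|^2}{E}\,ds\qquad(\varphi\in I)$$ satisfies $\mathscr E'(\varphi)=0$ (a one-sided derivative at $\varphi=c$) and $\mathscr E(\varphi)=\frac{4\pi^2}{|\Phi|}$ for all $\varphi\in I$; in particular $\mathscr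 E(\varphi)\equiv\frac{4\pi^2}{\Phi}$ when $\Phi>0$. Equivalently, $d\mu=E\,ds/|\Phi|$ is a probability measure on $\Sigma_\varphi$, and $$\oint_{\Sigma_\varphi}\Big(\frac{\kappa}{E}-\oint_{\Sigma_\varphi}\frac{\kappa}{E}\,d\mu\Big)^2d\mu=\oint_{\Sigma_\varphi}\Big|\boldsymbol n\times\nabla\frac1E\Big|^2d\mu .$$ Here $\boldsymbol n\times\nabla g=n_x\,\partial_yg-n_y\,\partial_xg=\partial g/\partial s$ is the tangential derivative. -/

import Mathlib

open Set Filter Topology InnerProductSpace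
open scoped ContDiff

noncomputable section

namespace PlanarField

/-- `γ` is a counterclockwise regular smooth parametrization, with period one, of the smooth
Jordan curve `C` in the plane. A simple closed curve is counterclockwise when its signed area
`½ ∮ (x dy - y dx)` is positive. -/
structure IsJordanParam (γ : ℝ → ℂ) (C : Set ℂ) : Prop where
  smooth : ContDiff ℝ ∞ γ
  periodic : Function.Periodic γ 1
  injOn : InjOn γ (Ico 0 1)
  regular : ∀ t, deriv γ t ≠ 0
  range_eq : range γ = C
  counterclockwise : 0 < (1 / 2 : ℝ) * ∫ t in (0 : ℝ)..1,
    ((γ t).re * (deriv γ t).im - (γ t).im * (deriv γ t).re)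

/-- The arc length integral `∮ g ds` along `γ`, where `g` is given in terms of the parameter. -/
def arcIntegral (γ : ℝ → ℂ) (g : ℝ → ℝ) : ℝ :=
  ∫ t in (0 : ℝ)..1, g t * ‖deriv γ t‖

/-- The scalar cross product of two plane vectors. -/
def cross (v w : ℂ) : ℝ := v.re * w.im - v.im * w.re

/-- The outward unit normal of a counterclockwise curve: the unit tangent rotated by `-90°`. -/
def outwardNormal (γ : ℝ → ℂ) (t : ℝ) : ℂ :=
  -Complex.I * (deriv γ t / (‖deriv γ t‖ : ℂ))

/-- The signed curvature of a parametrized curve (counterclockwise unit circle: `+1`). -/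
def signedCurvature (γ : ℝ → ℂ) (t : ℝ) : ℝ :=
  cross (deriv γ t) (deriv (deriv γ) t) / ‖deriv γ t‖ ^ 3

/-- The level set `{r ∈ S | f r = φ}`. -/
def levelSet (S : Set ℂ) (f : ℂ → ℝ) (φ : ℝ) : Set ℂ := {z ∈ S | f z = φ}

/-- The field intensity `E = |∇f|` on `S`. The gradient within `S` is the ordinary gradient at
interior points of `S`, and the gradient from inside `S` at its boundary points. -/
def intensity (S : Set ℂ) (f : ℂ → ℝ) (z : ℂ) : ℝ := ‖gradientWithin f S z‖

/-- The flux `-∮ n · ∇f ds` of `-∇f` across the curve `γ`. -/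
def flux (S : Set ℂ) (f : ℂ → ℝ) (γ : ℝ → ℂ) : ℝ :=
  -arcIntegral γ fun t => inner ℝ (outwardNormal γ t) (gradientWithin f S (γ t))

/-- The tangential derivative `n × ∇g` along the curve `γ`. -/
def tangentialDeriv (S : Set ℂ) (g : ℂ → ℝ) (γ : ℝ → ℂ) (t : ℝ) : ℝ :=
  cross (outwardNormal γ t) (gradientWithin g S (γ t))

/-- `∮ κ² / E ds - ∮ |n × ∇ log E|² / E ds` along the curve `γ`. -/
def conserved (S : Set ℂ) (f : ℂ → ℝ) (γ : ℝ → ℂ) : ℝ :=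
  (arcIntegral γ fun t => signedCurvature γ t ^ 2 / intensity S f (γ t)) -
  arcIntegral γ fun t =>
    |tangentialDeriv S (fun z => Real.log (intensity S f z)) γ t| ^ 2 / intensity S f (γ t)

/-- The mean `∮ g dμ` with respect to the flux measure `dμ = E ds / Φ` on the curve `γ`. -/
def fluxMean (S : Set ℂ) (f : ℂ → ℝ) (Φ : ℝ) (γ : ℝ → ℂ) (g : ℝ → ℝ) : ℝ :=
  arcIntegral γ fun t => g t * (intensity S f (γ t) / Φ)

/-- The variance with respect to the flux measure `dμ = E ds / Φ` on the curve `γ`. -/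
def fluxVariance (S : Set ℂ) (f : ℂ → ℝ) (Φ : ℝ) (γ : ℝ → ℂ) (g : ℝ → ℝ) : ℝ :=
  fluxMean S f Φ γ fun t => (g t - fluxMean S f Φ γ g) ^ 2

/-- `Ω` is an unbounded plane domain whose boundary is a smooth Jordan curve, parametrized
counterclockwise by `γ₀`. -/
structure IsJordanExterior (Ω : Set ℂ) (γ₀ : ℝ → ℂ) : Prop where
  isOpen : IsOpen Ω
  isConnected : IsConnected Ω
  unbounded : ¬ Bornology.IsBounded Ω
  boundary : IsJordanParam γ₀ (frontier Ω)

/-- The exterior Dirichlet problem with total flux `Φ > 0` and boundary value `c`. -/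
structure ExteriorDirichlet (Ω : Set ℂ) (γ₀ : ℝ → ℂ) (U : ℂ → ℝ) (Φ c : ℝ) : Prop where
  domain : IsJordanExterior Ω γ₀
  harmonic : HarmonicOnNhd U Ω
  regular : ContDiffOn ℝ 2 U (closure Ω)
  dirichlet : ∀ z ∈ frontier Ω, U z = c
  flux_pos : 0 < Φ
  flux_eq : flux (closure Ω) U γ₀ = Φ
  at_infinity : Asymptotics.IsEquivalent (Bornology.cobounded ℂ) U fun z =>
    -(Φ / (2 * Real.pi)) * Real.log (2 * Real.pi * ‖z‖ / arcIntegral γ₀ fun _ => 1)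

/-- The interior Dirichlet problem (Green's function with pole at the origin) with flux `Φ ≠ 0`
and boundary value `c`, in the region enclosed by the boundary of `Ω`. -/
structure InteriorDirichlet (Ω : Set ℂ) (γ₀ : ℝ → ℂ) (G : ℂ → ℝ) (Φ c : ℝ) : Prop where
  domain : IsJordanExterior Ω γ₀
  origin_enclosed : (0 : ℂ) ∉ closure Ω
  harmonic : HarmonicOnNhd G ((closure Ω ∪ {0})ᶜ)
  regular : ContDiffOn ℝ 2 G ((Ω ∪ {0})ᶜ)
  dirichlet : ∀ z ∈ frontier Ω, G z = c
  flux_ne_zero : Φ ≠ 0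
  flux_tendsto : Tendsto
    (fun ε : ℝ => flux ((Ω ∪ {0})ᶜ) G fun t => circleMap 0 ε (2 * Real.pi * t)) (𝓝[>] 0) (𝓝 Φ)
  log_pole : G =O[𝓝[≠] 0] fun z => Real.log ‖z‖

/-- The conservation law for the level sets `Σ_φ` of `f` in `S`, for `φ` in the interval `I`, with
total flux `Φ`: the gradient has no zeros, `I` is the set of levels, every level set is a smooth
Jordan curve, and whichever counterclockwise parametrizations `Γ φ` of the level sets are used to
compute the line integrals, `φ ↦ 𝓔(φ)` has derivative zero (one-sided at the endpoint of `I`) and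
value `4π²/Φ`, `E ds/Φ` is a probability measure on `Σ_φ`, and for this measure the variance of
`κ/E` is the mean of `|n × ∇(1/E)|²`. -/
def ConservationLaw (S : Set ℂ) (f : ℂ → ℝ) (Φ : ℝ) (I : Set ℝ) : Prop :=
  (∀ z ∈ S, gradientWithin f S z ≠ 0) ∧
  f '' S = I ∧
  (∀ φ ∈ I, ∃ γ : ℝ → ℂ, IsJordanParam γ (levelSet S f φ)) ∧
  ∀ Γ : ℝ → ℝ → ℂ, (∀ φ ∈ I, IsJordanParam (Γ φ) (levelSet S f φ)) →
    ∀ φ ∈ I,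
      HasDerivWithinAt (fun ψ => conserved S f (Γ ψ)) 0 I φ ∧
      conserved S f (Γ φ) = 4 * Real.pi ^ 2 / Φ ∧
      fluxMean S f Φ (Γ φ) (fun _ => 1) = 1 ∧
      fluxVariance S f Φ (Γ φ) (fun t => signedCurvature (Γ φ) t / intensity S f (Γ φ t)) =
        fluxMean S f Φ (Γ φ)
          (fun t => |tangentialDeriv S (fun z => 1 / intensity S f z) (Γ φ) t| ^ 2)

end PlanarField

end

namespace PlanarField

open MeasureTheory Metric
open scoped Interval

/-! Write g = f_x − i f_y for the complex gradient, so that E = |g| and g is holomorphic in the open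
part of S. Along a level curve γ, gγ' = iη with η real, nowhere zero and |η| = E|γ'|. Put a =
g'γ'/g, the logarithmic derivative of g along γ. Then Re a = |γ'| ∂_s log E, and because gγ' keeps a
constant direction, Im a = −κ|γ'|. Since a² = iη·(g'²/g³)γ', the integrand of 𝓔 is, up to a sign
fixed along γ, the imaginary part of (g'²/g³) dz. Thus 𝓔 is a contour integral of a holomorphic
form: its constancy is Cauchy's theorem and its value is a residue.

The residue is read off from a conformal map. In the open part of S, f = c + k log|F| with |k| =
|Φ|/2π and F a bijection onto the punctured unit disc. Then g = kF'/F, and with (F/F')' = Q∘F one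
gets g'/g dz = −Q(F) dF/F and g'²/g³ dz = k⁻¹Q(F)² dF/F. Here Q is holomorphic on the whole disc
with Q(0) = q = ±1, so these forms differ from −(q/k) g dz and k⁻² g dz by exact ones. Finally F'/F
− ε/(z − p) = L' for a point p off S and ε = ±1, so ∮ g dz = kε∮ dz/(z − p), and the winding number
of a smooth Jordan curve is 0 or ±1, the value 0 being impossible as η has no zeros. This gives 𝓔 =
2π/|k| and (∮ κ ds)² = 4π². The variance identity is then the same equation, because the mean of κ/E
is ±2π/|Φ|. These computations are in `IsGreenField.exists_level_integrals` and
`IsGreenField.conservation`.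

Construction of F: the enclosed region, or the inversion of Ω together with the point at infinity,
is a bounded domain D with connected complement, on which holomorphic functions have primitives
(`isExactOn_of_isPreconnected_compl`). Hence f = k log|z| + Re L there, and F = z exp((L − c)/k)
satisfies |F| → 1 at the boundary with one simple zero. A continuity argument makes F bijective with
nonvanishing derivative (`IsDiscMap.exists_unique_preimage`). Level curves with φ ≠ c are preimages
of circles.

Topology: the winding number of a smooth Jordan curve jumps by one across it
(`IsJordanLoop.windInt_jump`). This yields the connectedness of the enclosed region, one-sided
collars of the boundary, and a nonzero signed area, hence a counterclockwise parametrization.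

The level φ = c is the boundary, where f is only C². There g ≠ 0 by the Hopf lemma
(`IsGreenField.wgrad_ne_zero`), g' extends continuously, and integrals of exact forms vanish as
limits over the curves of a collar. -/

/-- The logarithmic derivative integrates to a logarithm. -/
theorem exp_integral_logDeriv {u u' : ℝ → ℂ} {a b : ℝ} (hab : a ≤ b)
    (hu : ∀ t ∈ Icc a b, HasDerivAt u (u' t) t) (hu' : ContinuousOn u' (Icc a b))
    (hne : ∀ t ∈ Icc a b, u t ≠ 0) :
    Complex.exp (∫ t in a..b, u' t / u t) = u b / u a := by
  have huc : ContinuousOn u (Icc a b) := fun t ht => (hu t ht).continuousAt.continuousWithinAt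
  have hc : ContinuousOn (fun t => u' t / u t) (Icc a b) := hu'.div huc hne
  have hi : IntervalIntegrable (fun t => u' t / u t) volume a b :=
    ContinuousOn.intervalIntegrable (by rwa [uIcc_of_le hab])
  set P : ℝ → ℂ := fun x => ∫ t in a..x, u' t / u t
  have hPc : ContinuousOn P (Icc a b) := by
    have := intervalIntegral.continuousOn_primitive_interval' hi left_mem_uIcc
    rwa [uIcc_of_le hab] at this
  have hP : ∀ x ∈ Ico a b, HasDerivWithinAt P (u' x / u x) (Ici x) x := fun x hx => by
    have h1 : IntervalIntegrable (fun t => u' t / u t) volume a x :=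
      ContinuousOn.intervalIntegrable
        (by rw [uIcc_of_le hx.1]; exact hc.mono (Icc_subset_Icc_right hx.2.le))
    have h2 : ContinuousWithinAt (fun t => u' t / u t) (Ici x) x :=
      (hc x ⟨hx.1, hx.2.le⟩).mono_of_mem_nhdsWithin
        (mem_of_superset (Icc_mem_nhdsGE hx.2) (Icc_subset_Icc_left hx.1))
    refine intervalIntegral.integral_hasDerivWithinAt_right h1 ?_ (h2.mono Ioi_subset_Ici_self)
    exact ⟨Icc a b, mem_of_superset (Icc_mem_nhdsGT hx.2) (Icc_subset_Icc_left hx.1),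
      hc.aestronglyMeasurable measurableSet_Icc⟩
  -- The product u·exp(−P) is constant. Right derivatives are used because u' is only assumed
  -- continuous on the closed interval.
  have hconst := constant_of_has_deriv_right_zero (f := fun x => u x * Complex.exp (-P x))
    (huc.mul hPc.neg.cexp) (fun x hx => by
      have h := (hu x ⟨hx.1, hx.2.le⟩).hasDerivWithinAt.mul (hP x hx).neg.cexp
      refine h.congr_deriv ?_
      have := hne x ⟨hx.1, hx.2.le⟩
      rw [mul_neg, mul_neg, mul_comm (Complex.exp _) (u' x / u x), ← mul_assoc,
        mul_div_cancel₀ _ this, add_neg_cancel])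
  have h := hconst b ⟨hab, le_rfl⟩
  have hPa : P a = 0 := intervalIntegral.integral_same
  rw [hPa, neg_zero, Complex.exp_zero, mul_one, Complex.exp_neg] at h
  change Complex.exp (P b) = _
  rw [eq_div_iff (hne a ⟨le_rfl, hab⟩), ← h]
  field_simp [Complex.exp_ne_zero]

/-! ### Polygonal path integrals, Cauchy's theorem and primitives -/

/-- The integral of a complex function along an oriented segment. -/
noncomputable def segInt (f : ℂ → ℂ) (a b : ℂ) : ℂ :=
  ∫ t in (0 : ℝ)..1, f (AffineMap.lineMap a b t) * (b - a)

theorem lineMap_mem_segment {a b : ℂ} {t : ℝ} (ht : t ∈ Icc (0 : ℝ) 1) :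
    (AffineMap.lineMap a b t : ℂ) ∈ segment ℝ a b := by
  rw [segment_eq_image_lineMap]; exact mem_image_of_mem _ ht

theorem continuousOn_segInt_integrand {f : ℂ → ℂ} {a b : ℂ} (hf : ContinuousOn f (segment ℝ a b)) :
    ContinuousOn (fun t : ℝ => f (AffineMap.lineMap a b t) * (b - a)) (uIcc 0 1) := by
  rw [uIcc_of_le zero_le_one]
  refine ContinuousOn.mul (hf.comp ?_ fun t ht => lineMap_mem_segment ht) continuousOn_const
  exact (AffineMap.lineMap_continuous (p := a) (q := b)).continuousOn

theorem segInt_add {f g : ℂ → ℂ} {a b : ℂ} (hf : ContinuousOn f (segment ℝ a b))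
    (hg : ContinuousOn g (segment ℝ a b)) :
    segInt (fun w => f w + g w) a b = segInt f a b + segInt g a b := by
  unfold segInt
  rw [← intervalIntegral.integral_add (continuousOn_segInt_integrand hf).intervalIntegrable
    (continuousOn_segInt_integrand hg).intervalIntegrable]
  simp_rw [add_mul]

theorem segInt_const_mul (f : ℂ → ℂ) (c a b : ℂ) :
    segInt (fun w => c * f w) a b = c * segInt f a b := by
  unfold segInt
  rw [← intervalIntegral.integral_const_mul]
  simp_rw [mul_assoc]

theorem segInt_congr {f g : ℂ → ℂ} {a b : ℂ} (h : EqOn f g (segment ℝ a b)) :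
    segInt f a b = segInt g a b := by
  unfold segInt
  refine intervalIntegral.integral_congr fun t ht => ?_
  rw [uIcc_of_le zero_le_one] at ht
  simp only [h (lineMap_mem_segment ht)]

theorem segInt_symm (f : ℂ → ℂ) (a b : ℂ) : segInt f b a = -segInt f a b := by
  unfold segInt
  have h := intervalIntegral.integral_comp_sub_left (a := 0) (b := 1)
    (fun t : ℝ => f (AffineMap.lineMap a b t) * (b - a)) 1
  simp only [sub_self, sub_zero] at h
  rw [← h, ← intervalIntegral.integral_neg]
  refine intervalIntegral.integral_congr fun t _ => ?_
  simp only [AffineMap.lineMap_apply_one_sub]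
  ring

theorem norm_segInt_le {f : ℂ → ℂ} {a b : ℂ} {M : ℝ} (h : ∀ w ∈ segment ℝ a b, ‖f w‖ ≤ M) :
    ‖segInt f a b‖ ≤ M * ‖b - a‖ := by
  unfold segInt
  refine (intervalIntegral.norm_integral_le_of_norm_le_const (C := M * ‖b - a‖) ?_).trans (by simp)
  intro t ht
  rw [uIoc_of_le zero_le_one] at ht
  rw [norm_mul]
  gcongr
  exact h _ (lineMap_mem_segment ⟨ht.1.le, ht.2⟩)

theorem segInt_eq_sub_of_hasDerivAt {f P : ℂ → ℂ} {a b : ℂ}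
    (h : ∀ z ∈ segment ℝ a b, HasDerivAt P (f z) z) (hf : ContinuousOn f (segment ℝ a b)) :
    segInt f a b = P b - P a := by
  unfold segInt
  have := intervalIntegral.integral_eq_sub_of_hasDerivAt (a := 0) (b := 1)
    (f := fun t : ℝ => P (AffineMap.lineMap a b t))
    (f' := fun t : ℝ => f (AffineMap.lineMap a b t) * (b - a)) ?_
    (continuousOn_segInt_integrand hf).intervalIntegrable
  · rw [this]; simp
  · intro t ht
    rw [uIcc_of_le zero_le_one] at ht
    exact (h _ (lineMap_mem_segment ht)).comp_of_eq t
      (AffineMap.hasDerivAt_lineMap (a := a) (b := b) (x := t)) rfl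

theorem exp_segInt_inv {a b z : ℂ} (hz : z ∉ segment ℝ a b) :
    Complex.exp (segInt (fun w => (w - z)⁻¹) a b) = (b - z) / (a - z) := by
  have h := exp_integral_logDeriv (u := fun t : ℝ => AffineMap.lineMap a b t - z)
    (u' := fun _ => b - a) zero_le_one
    (fun t _ => (AffineMap.hasDerivAt_lineMap (a := a) (b := b) (x := t)).sub_const z)
    continuousOn_const
    (fun t ht h0 => hz (sub_eq_zero.1 h0 ▸ lineMap_mem_segment ht))
  simp only [AffineMap.lineMap_apply_one, AffineMap.lineMap_apply_zero] at h
  rw [← h]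
  unfold segInt
  congr 2
  ext t
  rw [div_eq_mul_inv, mul_comm]

/-- `PolyChain D a b J`: the functional `J` is the integral along some polygonal path in `D`
from `a` to `b`. -/
inductive PolyChain (D : Set ℂ) (a : ℂ) : ℂ → ((ℂ → ℂ) → ℂ) → Prop
  | refl : PolyChain D a a fun _ => 0
  | step {b c : ℂ} {J : (ℂ → ℂ) → ℂ} : PolyChain D a b J → segment ℝ b c ⊆ D →
      PolyChain D a c fun f => J f + segInt f b c

namespace PolyChain

variable {D : Set ℂ} {a b c : ℂ} {J J' : (ℂ → ℂ) → ℂ}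

theorem mono {D' : Set ℂ} (h : D ⊆ D') (hJ : PolyChain D a b J) : PolyChain D' a b J := by
  induction hJ with
  | refl => exact .refl
  | step _ hs ih => exact ih.step (hs.trans h)

theorem trans (hJ : PolyChain D a b J) (hJ' : PolyChain D b c J') :
    PolyChain D a c fun f => J f + J' f := by
  induction hJ' with
  | refl => simpa using hJ
  | step _ hs ih =>
    have := ih.step hs
    simpa only [add_assoc] using this

theorem symm (hJ : PolyChain D a b J) : PolyChain D b a fun f => -J f := by
  induction hJ with
  | refl => simpa using PolyChain.refl
  | @step b c J _ hs ih =>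
    have h := (PolyChain.refl.step (by rwa [segment_symm] : segment ℝ c b ⊆ D)).trans ih
    convert h using 2 with f
    rw [segInt_symm f b c]
    ring

/-- Confining the chain to a compact set makes Cauchy integrals along it holomorphic off that set
and gives bounds for continuous integrands. -/
theorem exists_isCompact (hJ : PolyChain D a b J) :
    ∃ K ⊆ D, IsCompact K ∧ PolyChain K a b J := by
  induction hJ with
  | refl => exact ⟨∅, empty_subset _, isCompact_empty, .refl⟩
  | @step b c J _ hs ih =>
    obtain ⟨K, hK, hKc, h⟩ := ih
    have hseg : IsCompact (segment ℝ b c) := by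
      rw [segment_eq_image_lineMap]
      exact isCompact_Icc.image AffineMap.lineMap_continuous
    exact ⟨K ∪ segment ℝ b c, union_subset hK hs, hKc.union hseg,
      (h.mono subset_union_left).step subset_union_right⟩

theorem map_add (hJ : PolyChain D a b J) {f g : ℂ → ℂ} (hf : ContinuousOn f D)
    (hg : ContinuousOn g D) : J (fun w => f w + g w) = J f + J g := by
  induction hJ with
  | refl => simp
  | step _ hs ih => beta_reduce; rw [ih, segInt_add (hf.mono hs) (hg.mono hs)]; ring

theorem map_const_mul (hJ : PolyChain D a b J) (f : ℂ → ℂ) (c : ℂ) :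
    J (fun w => c * f w) = c * J f := by
  induction hJ with
  | refl => simp
  | step _ hs ih => beta_reduce; rw [ih, segInt_const_mul]; ring

theorem map_congr (hJ : PolyChain D a b J) {f g : ℂ → ℂ} (h : EqOn f g D) : J f = J g := by
  induction hJ with
  | refl => simp
  | step _ hs ih => beta_reduce; rw [ih, segInt_congr (h.mono hs)]

theorem exists_norm_le (hJ : PolyChain D a b J) :
    ∃ A : ℝ, 0 ≤ A ∧ ∀ (f : ℂ → ℂ) (M : ℝ), (∀ w ∈ D, ‖f w‖ ≤ M) → ‖J f‖ ≤ M * A := by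
  induction hJ with
  | refl => exact ⟨0, le_rfl, by simp⟩
  | @step b c J _ hs ih =>
    obtain ⟨A, hA, h⟩ := ih
    refine ⟨A + ‖c - b‖, by positivity, fun f M hM => ?_⟩
    refine (norm_add_le _ _).trans ?_
    rw [mul_add]
    exact add_le_add (h f M hM) (norm_segInt_le fun w hw => hM w (hs hw))

/-- The endpoint ratios of the segments telescope. For a closed chain the exponential is 1, so the
integral lies in 2πiℤ without any choice of logarithm. -/
theorem exp_inv (hJ : PolyChain D a b J) {z : ℂ} (hz : z ∉ D) (ha : a ≠ z) :
    Complex.exp (J fun w => (w - z)⁻¹) = (b - z) / (a - z) := by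
  have ha' := sub_ne_zero.2 ha
  induction hJ with
  | refl => simp [ha']
  | @step b c J _ hs ih =>
    have hb : b - z ≠ 0 := fun h => hz (sub_eq_zero.1 h ▸ hs (left_mem_segment ℝ b c))
    rw [Complex.exp_add, ih, exp_segInt_inv fun h => hz (hs h)]
    field_simp

/-- Holomorphic dependence of a path integral on a parameter. -/
theorem differentiableOn_param (hJ : PolyChain D a b J) {U : Set ℂ} (hU : IsOpen U)
    {φ : ℂ → ℂ → ℂ} (hφ : ∀ z ∈ U, ContinuousOn (φ z) D)
    (hφ' : ∀ w ∈ D, DifferentiableOn ℂ (fun z => φ z w) U)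
    (hb : ∀ z ∈ U, ∃ r > 0, ∃ M : ℝ, ∀ z' ∈ ball z r, ∀ w ∈ D, ‖φ z' w‖ ≤ M) :
    DifferentiableOn ℂ (fun z => J (φ z)) U := by
  induction hJ with
  | refl => exact differentiableOn_const _
  | @step b c J _ hs ih =>
    refine ih.add fun z₀ hz₀ => DifferentiableAt.differentiableWithinAt ?_
    obtain ⟨r₁, hr₁, M, hM⟩ := hb z₀ hz₀
    obtain ⟨r₂, hr₂, hrU⟩ := Metric.isOpen_iff.1 hU z₀ hz₀
    set r := min r₁ r₂ with hr
    have hr0 : 0 < r := lt_min hr₁ hr₂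
    have hM' : ∀ z ∈ ball z₀ r, ∀ w ∈ D, ‖φ z w‖ ≤ M := fun z hz =>
      hM z (ball_subset_ball (min_le_left _ _) hz)
    have hU' : ball z₀ r ⊆ U := (ball_subset_ball (min_le_right _ _)).trans hrU
    set F : ℂ → ℝ → ℂ := fun z t => φ z (AffineMap.lineMap b c t) * (c - b) with hF
    have hmem : ∀ t ∈ Ι (0 : ℝ) 1, (AffineMap.lineMap b c t : ℂ) ∈ D := fun t ht => by
      rw [uIoc_of_le zero_le_one] at ht
      exact hs (lineMap_mem_segment ⟨ht.1.le, ht.2⟩)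
    have hFd : ∀ t ∈ Ι (0 : ℝ) 1, ∀ z ∈ ball z₀ r, DifferentiableAt ℂ (fun z => F z t) z :=
      fun t ht z hz => ((hφ' _ (hmem t ht)).differentiableAt (hU.mem_nhds (hU' hz))).mul_const _
    have hFi : ∀ z ∈ ball z₀ r, IntervalIntegrable (F z) volume 0 1 := fun z hz =>
      (continuousOn_segInt_integrand ((hφ z (hU' hz)).mono hs)).intervalIntegrable
    have hFm : ∀ z ∈ ball z₀ r, AEStronglyMeasurable (F z) (volume.restrict (Ι (0 : ℝ) 1)) :=
      fun z hz => (hFi z hz).def'.aestronglyMeasurable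
    have hz₀r : z₀ ∈ ball z₀ r := mem_ball_self hr0
    -- The z-derivative is measurable in t as a pointwise limit of difference quotients with steps
    -- r/(2(n+1)).
    have hF'm : AEStronglyMeasurable (fun t => deriv (fun z => F z t) z₀)
        (volume.restrict (Ι (0 : ℝ) 1)) := by
      set e : ℕ → ℂ := fun n => ((r / 2 * (1 / ((n : ℝ) + 1)) : ℝ) : ℂ) with he
      have hpos : ∀ n : ℕ, 0 < r / 2 * (1 / ((n : ℝ) + 1)) := fun n => by positivity
      have he0 : Tendsto e atTop (𝓝[≠] 0) := by
        refine tendsto_nhdsWithin_iff.2 ⟨?_, Eventually.of_forall fun n => ?_⟩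
        · have h1 := (tendsto_one_div_add_atTop_nhds_zero_nat (𝕜 := ℝ)).const_mul (r / 2)
          rw [mul_zero] at h1
          exact (Complex.continuous_ofReal.tendsto' 0 0 Complex.ofReal_zero).comp h1
        · exact Complex.ofReal_ne_zero.2 (hpos n).ne'
      refine aestronglyMeasurable_of_tendsto_ae atTop
        (f := fun n t => (e n)⁻¹ • (F (z₀ + e n) t - F z₀ t)) (fun n => ?_) ?_
      · refine AEStronglyMeasurable.const_smul ((hFm _ ?_).sub (hFm _ hz₀r)) ((e n)⁻¹)
        rw [mem_ball, dist_eq_norm, add_sub_cancel_left, he, Complex.norm_real, Real.norm_eq_abs,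
          abs_of_pos (hpos n)]
        have : 1 / ((n : ℝ) + 1) ≤ 1 := by
          rw [div_le_one (by positivity)]; linarith [n.cast_nonneg (α := ℝ)]
        nlinarith
      · refine (ae_restrict_iff' measurableSet_uIoc).2 (ae_of_all _ fun t ht => ?_)
        exact (hFd t ht z₀ hz₀r).hasDerivAt.tendsto_slope_zero.comp he0
    refine (intervalIntegral.hasDerivAt_integral_of_dominated_loc_of_deriv_le
      (F := F) (F' := fun z t => deriv (fun z => F z t) z) (s := ball z₀ (r / 2))
      (bound := fun _ => M * ‖c - b‖ / (r / 4)) (ball_mem_nhds _ (by positivity))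
      ?_ (hFi z₀ hz₀r) hF'm ?_ ?_ ?_).2.differentiableAt
    · filter_upwards [ball_mem_nhds z₀ hr0] with z hz using hFm z hz
    · refine ae_of_all _ fun t ht z hz => ?_
      -- Discs of radius r/4 about points of the half-radius ball stay in the ball where φ is
      -- bounded by M; Cauchy's estimate then dominates the derivative.
      have hsub : closedBall z (r / 4) ⊆ ball z₀ r := fun x hx => by
        rw [mem_ball] at hz ⊢
        rw [mem_closedBall] at hx
        linarith [dist_triangle x z z₀]
      refine Complex.norm_deriv_le_of_forall_mem_sphere_norm_le (by positivity) ?_ fun x hx => ?_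
      · refine DifferentiableOn.diffContOnCl fun x hx => ?_
        exact (hFd t ht x (hsub (closure_ball_subset_closedBall hx))).differentiableWithinAt
      · rw [hF, norm_mul]
        gcongr
        exact hM' x (hsub (sphere_subset_closedBall hx)) _ (hmem t ht)
    · exact intervalIntegrable_const
    · refine ae_of_all _ fun t ht z hz => ?_
      exact (hFd t ht z (ball_subset_ball (by linarith) hz)).hasDerivAt

/-- A Cauchy-type integral is holomorphic off the path. -/
theorem differentiableOn_cauchy (hJ : PolyChain D a b J) (hD : IsCompact D) {f : ℂ → ℂ}
    (hf : ContinuousOn f D) :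
    DifferentiableOn ℂ (fun z => J fun w => f w * (w - z)⁻¹) Dᶜ := by
  have hne : ∀ z ∈ Dᶜ, ∀ w ∈ D, w - z ≠ 0 := fun z hz w hw h => hz (sub_eq_zero.1 h ▸ hw)
  refine hJ.differentiableOn_param hD.isClosed.isOpen_compl (fun z hz => ?_) (fun w hw => ?_) ?_
  · exact hf.mul ((continuousOn_id.sub continuousOn_const).inv₀ (hne z hz))
  · exact ((differentiableOn_const _).sub differentiableOn_id).inv (fun z hz => hne z hz w hw)
      |>.const_mul _
  · intro z hz
    obtain ⟨r, hr, hrD⟩ := Metric.isOpen_iff.1 hD.isClosed.isOpen_compl z hz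
    obtain ⟨C, hC⟩ := hD.exists_bound_of_continuousOn hf
    refine ⟨r / 2, by positivity, |C| * (r / 2)⁻¹, fun z' hz' w hw => ?_⟩
    rw [norm_mul, norm_inv]
    have h1 : r ≤ dist w z := not_lt.1 fun h => hrD (mem_ball.2 h) hw
    have h2 : r / 2 ≤ ‖w - z'‖ := by
      rw [← dist_eq_norm]
      rw [mem_ball] at hz'
      linarith [dist_triangle w z' z]
    gcongr
    exact (hC w hw).trans (le_abs_self C)

theorem tendsto_cauchy_cobounded (hJ : PolyChain D a b J) (hD : IsCompact D) {f : ℂ → ℂ}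
    (hf : ContinuousOn f D) :
    Tendsto (fun z => J fun w => f w * (w - z)⁻¹) (Bornology.cobounded ℂ) (𝓝 0) := by
  obtain ⟨A, hA, hJA⟩ := hJ.exists_norm_le
  obtain ⟨C, hC⟩ := hD.exists_bound_of_continuousOn hf
  obtain ⟨R, hR⟩ := hD.isBounded.exists_norm_le
  have hlim : Tendsto (fun z : ℂ => |C| * (‖z‖ - R)⁻¹ * A) (Bornology.cobounded ℂ) (𝓝 0) := by
    have h1 : Tendsto (fun z : ℂ => ‖z‖ - R) (Bornology.cobounded ℂ) atTop :=
      tendsto_atTop_add_const_right _ _ tendsto_norm_cobounded_atTop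
    simpa using (h1.inv_tendsto_atTop.const_mul |C|).mul_const A
  refine squeeze_zero_norm' ?_ hlim
  have hev : ∀ᶠ z : ℂ in Bornology.cobounded ℂ, R < ‖z‖ :=
    tendsto_norm_cobounded_atTop.eventually_gt_atTop R
  filter_upwards [hev] with z hz
  refine hJA _ _ fun w hw => ?_
  rw [norm_mul, norm_inv]
  have h2 : ‖z‖ - R ≤ ‖w - z‖ := by
    have := norm_sub_norm_le z w
    rw [norm_sub_rev] at this
    linarith [hR w hw]
  have h3 : 0 < ‖z‖ - R := by linarith
  gcongr
  exact (hC w hw).trans (le_abs_self C)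

end PolyChain

/-- The group 2πiℤ is discrete. This is what makes winding integrals locally constant, and zero when
small. -/
theorem eq_zero_of_exp_eq_one_of_norm_lt_one {w : ℂ} (h : Complex.exp w = 1) (hw : ‖w‖ < 1) :
    w = 0 := by
  obtain ⟨n, rfl⟩ := Complex.exp_eq_one_iff.1 h
  rcases eq_or_ne n 0 with rfl | hn
  · simp
  · exfalso
    have h1 : (1 : ℝ) ≤ |(n : ℝ)| := by exact_mod_cast Int.one_le_abs hn
    have h2 : ‖(n : ℂ) * (2 * Real.pi * Complex.I)‖ = |(n : ℝ)| * (2 * Real.pi) := by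
      simp [abs_of_pos Real.pi_pos]
    rw [h2] at hw
    nlinarith [Real.pi_gt_three]

/-- The difference quotient is symmetric in its two arguments. -/
theorem differentiableOn_dslope_left {D : Set ℂ} (hD : IsOpen D) {f : ℂ → ℂ}
    (hf : DifferentiableOn ℂ f D) {w : ℂ} (hw : w ∈ D) :
    DifferentiableOn ℂ (fun z => dslope f z w) D := by
  have h := (Complex.differentiableOn_dslope (hD.mem_nhds hw)).2 hf
  refine h.congr fun z _ => ?_
  rcases eq_or_ne z w with rfl | hne
  · rfl
  · rw [dslope_of_ne _ hne, dslope_of_ne _ hne.symm, slope_comm]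

/-- Near the diagonal the mean value inequality bounds the quotient by the derivative; away from it
the denominator is at least R/2. -/
theorem exists_norm_dslope_le {D : Set ℂ} (hD : IsOpen D) {f : ℂ → ℂ}
    (hf : DifferentiableOn ℂ f D) {K : Set ℂ} (hK : IsCompact K) (hKD : K ⊆ D) {z₀ : ℂ}
    (hz₀ : z₀ ∈ D) :
    ∃ r > 0, ∃ M : ℝ, ∀ z ∈ ball z₀ r, ∀ w ∈ K, ‖dslope f z w‖ ≤ M := by
  obtain ⟨R, hR, hRD⟩ := Metric.nhds_basis_closedBall.mem_iff.1 (hD.mem_nhds hz₀)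
  have hB := isCompact_closedBall z₀ R
  obtain ⟨M₁, hM₁⟩ := hB.exists_bound_of_continuousOn
    ((hf.deriv hD).continuousOn.mono hRD)
  obtain ⟨M₂, hM₂⟩ := hB.exists_bound_of_continuousOn (hf.continuousOn.mono hRD)
  obtain ⟨M₃, hM₃⟩ := hK.exists_bound_of_continuousOn (hf.continuousOn.mono hKD)
  refine ⟨R / 2, by positivity, max M₁ ((R / 2)⁻¹ * (|M₃| + |M₂|)), fun z hz w hw => ?_⟩
  have hzR : z ∈ closedBall z₀ R := by
    rw [mem_ball] at hz; rw [mem_closedBall]; linarith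
  by_cases hwR : w ∈ closedBall z₀ R
  · refine le_max_of_le_left ?_
    rcases eq_or_ne w z with rfl | hne
    · rw [dslope_same]; exact hM₁ _ hzR
    · rw [dslope_of_ne _ hne, slope_def_field, norm_div,
        div_le_iff₀ (norm_pos_iff.2 (sub_ne_zero.2 hne))]
      exact Convex.norm_image_sub_le_of_norm_deriv_le
        (fun x hx => hf.differentiableAt (hD.mem_nhds (hRD hx))) hM₁ (convex_closedBall _ _) hzR hwR
  · refine le_max_of_le_right ?_
    have hd : R / 2 ≤ ‖w - z‖ := by
      rw [← dist_eq_norm]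
      rw [mem_closedBall, not_le] at hwR
      rw [mem_ball] at hz
      linarith [dist_triangle w z z₀]
    have hne : w ≠ z := by
      rintro rfl
      exact hwR hzR
    rw [dslope_of_ne _ hne, slope_def_field, div_eq_inv_mul, norm_mul, norm_inv]
    gcongr
    exact (norm_sub_le _ _).trans (add_le_add ((hM₃ w hw).trans (le_abs_self _))
      ((hM₂ z hzR).trans (le_abs_self _)))

/-- Cauchy's theorem for polygonal loops in a bounded domain with connected complement. -/
theorem PolyChain.eq_zero {D : Set ℂ} (hD : IsOpen D) (hDb : Bornology.IsBounded D)
    (hDc : IsPreconnected Dᶜ) {a : ℂ} (ha : a ∈ D) {J : (ℂ → ℂ) → ℂ} (hJ : PolyChain D a a J)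
    {f : ℂ → ℂ} (hf : DifferentiableOn ℂ f D) : J f = 0 := by
  obtain ⟨K₀, hK₀, hK₀c, hJK₀⟩ := hJ.exists_isCompact
  -- Adjoining the base point keeps it away from every z outside K, even for the trivial chain.
  obtain ⟨K, hKD, hK, hJK, haK⟩ : ∃ K ⊆ D, IsCompact K ∧ PolyChain K a a J ∧ a ∈ K :=
    ⟨insert a K₀, insert_subset ha hK₀, hK₀c.insert a, hJK₀.mono (subset_insert _ _),
      mem_insert _ _⟩
  set W : ℂ → ℂ := fun z => J fun w => (w - z)⁻¹ with hW
  have hWd : DifferentiableOn ℂ W Kᶜ := by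
    simpa using hJK.differentiableOn_cauchy hK (f := fun _ => 1) continuousOn_const
  have hWexp : ∀ z ∈ Kᶜ, Complex.exp (W z) = 1 := fun z hz => by
    have haz : a ≠ z := fun h => hz (h ▸ haK)
    rw [hW, hJK.exp_inv hz haz, div_self (sub_ne_zero.2 haz)]
  have hWlim : Tendsto W (Bornology.cobounded ℂ) (𝓝 0) := by
    simpa using hJK.tendsto_cauchy_cobounded hK (f := fun _ => 1) continuousOn_const
  have hKo : IsOpen Kᶜ := hK.isClosed.isOpen_compl
  -- The points with winding number zero. This set is open and contains a neighbourhood of infinity,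
  -- hence also the connected unbounded complement of D.
  set E : Set ℂ := {z | z ∈ Kᶜ ∧ W z = 0} with hE
  have hEo : IsOpen E := by
    refine isOpen_iff_mem_nhds.2 fun z hz => ?_
    have hc := (hWd.continuousOn.continuousAt (hKo.mem_nhds hz.1)).norm
    rw [ContinuousAt, hz.2, norm_zero] at hc
    filter_upwards [hKo.mem_nhds hz.1, hc.eventually_lt_const one_pos] with x hx hx'
    exact ⟨hx, eq_zero_of_exp_eq_one_of_norm_lt_one (hWexp x hx) hx'⟩
  have hE'o : IsOpen (Kᶜ ∩ W ⁻¹' {0}ᶜ) :=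
    hWd.continuousOn.isOpen_inter_preimage hKo isOpen_compl_singleton
  have hfar : ∀ᶠ z in Bornology.cobounded ℂ, z ∈ E := by
    filter_upwards [Bornology.isBounded_def.1 hK.isBounded, hWlim.norm.eventually_lt_const
      (by simp : ‖(0 : ℂ)‖ < 1)] with z hz hz'
    exact ⟨hz, eq_zero_of_exp_eq_one_of_norm_lt_one (hWexp z hz) hz'⟩
  have hDE : Dᶜ ⊆ E := by
    refine hDc.subset_left_of_subset_union hEo hE'o ?_ ?_ ?_
    · exact Set.disjoint_left.2 fun z hz hz' => hz'.2 hz.2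
    · intro z hz
      have hzK : z ∈ Kᶜ := fun h => hz (hKD h)
      by_cases h : W z = 0
      · exact Or.inl ⟨hzK, h⟩
      · exact Or.inr ⟨hzK, h⟩
    · obtain ⟨z, hz⟩ := (hfar.and (Bornology.isBounded_def.1 hDb)).exists
      exact ⟨z, hz.2, hz.1⟩
  -- The difference quotient of F based at a is f itself, so the value at a of the function h below
  -- is J f.
  set F : ℂ → ℂ := fun w => f w * (w - a) with hF
  have hFd : DifferentiableOn ℂ F D := hf.mul (differentiableOn_id.sub (differentiableOn_const _))
  have hFK : ContinuousOn F K := hFd.continuousOn.mono hKD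
  classical
  -- Dixon's argument: the two formulas agree on E, where ∫ dw/(w − z) = 0, so h is entire. It tends
  -- to 0 at infinity, hence vanishes.
  set h : ℂ → ℂ := fun z => if z ∈ D then J (dslope F z) else J fun w => F w * (w - z)⁻¹ with hh
  have hhE : ∀ z ∈ E, h z = J fun w => F w * (w - z)⁻¹ := by
    intro z hz
    by_cases hzD : z ∈ D
    · have hinv : ContinuousOn (fun w => (w - z)⁻¹) K :=
        (continuousOn_id.sub continuousOn_const).inv₀
          fun w hw h0 => hz.1 ((sub_eq_zero.1 h0 : w = z) ▸ hw)
      have h1 : J (dslope F z) = J fun w => F w * (w - z)⁻¹ + -F z * (w - z)⁻¹ := by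
        refine hJK.map_congr fun w hw => ?_
        have hne : w ≠ z := fun h => hz.1 (h ▸ hw)
        simp only [dslope_of_ne _ hne, slope_def_field, div_eq_mul_inv]
        ring
      have h2 : J (fun w => -F z * (w - z)⁻¹) = 0 := by
        rw [hJK.map_const_mul]
        simp [show J (fun w => (w - z)⁻¹) = 0 from hz.2]
      simp only [hh, if_pos hzD]
      rw [h1, hJK.map_add (f := fun w => F w * (w - z)⁻¹) (g := fun w => -F z * (w - z)⁻¹)
        (hFK.mul hinv) (continuousOn_const.mul hinv), h2, add_zero]
    · simp only [hh, if_neg hzD]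
  have hhd : Differentiable ℂ h := by
    intro z
    by_cases hz : z ∈ E
    · have h1 := (hJK.differentiableOn_cauchy hK hFK).differentiableAt (hKo.mem_nhds hz.1)
      refine h1.congr_of_eventuallyEq ?_
      filter_upwards [hEo.mem_nhds hz] with x hx using hhE x hx
    · have hzD : z ∈ D := by
        by_contra h
        exact hz (hDE h)
      have h1 : DifferentiableOn ℂ (fun z => J (dslope F z)) D := by
        refine hJK.differentiableOn_param hD (fun x hx => ?_) (fun w hw => ?_) fun x hx => ?_
        · exact ((continuousOn_dslope (hD.mem_nhds hx)).2 ⟨hFd.continuousOn,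
            hFd.differentiableAt (hD.mem_nhds hx)⟩).mono hKD
        · exact differentiableOn_dslope_left hD hFd (hKD hw)
        · exact exists_norm_dslope_le hD hFd hK hKD hx
      refine (h1.differentiableAt (hD.mem_nhds hzD)).congr_of_eventuallyEq ?_
      filter_upwards [hD.mem_nhds hzD] with x hx
      simp only [hh, if_pos hx]
  have hlim : Tendsto h (cocompact ℂ) (𝓝 0) := by
    rw [← Metric.cobounded_eq_cocompact]
    refine (hJK.tendsto_cauchy_cobounded hK hFK).congr' ?_
    filter_upwards [hfar] with z hz using (hhE z hz).symm
  have h0 := hhd.apply_eq_of_tendsto_cocompact a hlim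
  simp only [hh, if_pos ha] at h0
  rw [← h0]
  refine hJK.map_congr fun w hw => ?_
  rcases eq_or_ne w a with rfl | hne
  · rw [dslope_same]
    have h1 := ((hf.differentiableAt (hD.mem_nhds ha)).hasDerivAt.mul
      ((hasDerivAt_id w).sub_const w))
    have h2 : HasDerivAt F (f w) w := by
      refine h1.congr_deriv ?_
      simp
    exact h2.deriv.symm
  · rw [dslope_of_ne _ hne, slope_def_field, hF]
    simp only [sub_self, mul_zero, sub_zero]
    rw [mul_div_cancel_right₀ _ (sub_ne_zero.2 hne)]

theorem exists_polyChain {D : Set ℂ} (hD : IsOpen D) (hDc : IsPreconnected D) {a b : ℂ}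
    (ha : a ∈ D) (hb : b ∈ D) : ∃ J, PolyChain D a b J := by
  set A : Set ℂ := {z | z ∈ D ∧ ∃ J, PolyChain D a z J} with hA
  have key : ∀ z ∈ D, ∃ r > 0, ball z r ⊆ D ∧ ∀ w ∈ ball z r, segment ℝ z w ⊆ D ∧
      segment ℝ w z ⊆ D := fun z hz => by
    obtain ⟨r, hr, h⟩ := Metric.isOpen_iff.1 hD z hz
    refine ⟨r, hr, h, fun w hw => ⟨?_, ?_⟩⟩
    · exact ((convex_ball z r).segment_subset (mem_ball_self hr) hw).trans h
    · exact ((convex_ball z r).segment_subset hw (mem_ball_self hr)).trans h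
  have hAo : IsOpen A := by
    refine Metric.isOpen_iff.2 fun z hz => ?_
    obtain ⟨r, hr, h, h'⟩ := key z hz.1
    obtain ⟨J, hJ⟩ := hz.2
    exact ⟨r, hr, fun w hw => ⟨h hw, _, hJ.step (h' w hw).1⟩⟩
  have hBo : IsOpen (D \ A) := by
    refine Metric.isOpen_iff.2 fun z hz => ?_
    obtain ⟨r, hr, h, h'⟩ := key z hz.1
    refine ⟨r, hr, fun w hw => ⟨h hw, fun hwA => hz.2 ⟨hz.1, ?_⟩⟩⟩
    obtain ⟨J, hJ⟩ := hwA.2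
    exact ⟨_, hJ.step (h' w hw).2⟩
  have hsub : D ⊆ A := by
    refine hDc.subset_left_of_subset_union hAo hBo disjoint_sdiff_right (fun z hz => ?_)
      ⟨a, ha, ha, _, .refl⟩
    by_cases h : z ∈ A
    · exact Or.inl h
    · exact Or.inr ⟨hz, h⟩
  exact (hsub hb).2

/-- On a bounded domain with connected complement every holomorphic function has a primitive. -/
theorem isExactOn_of_isPreconnected_compl {D : Set ℂ} (hD : IsOpen D) (hDc : IsPreconnected D)
    (hDb : Bornology.IsBounded D) (hDc' : IsPreconnected Dᶜ) {f : ℂ → ℂ}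
    (hf : DifferentiableOn ℂ f D) : Complex.IsExactOn f D := by
  rcases D.eq_empty_or_nonempty with rfl | ⟨a, ha⟩
  · exact ⟨0, by simp⟩
  choose! J hJ using fun z (hz : z ∈ D) => exists_polyChain hD hDc ha hz
  refine ⟨fun z => J z f, fun z hz => ?_⟩
  obtain ⟨r, hr, hrD⟩ := Metric.isOpen_iff.1 hD z hz
  obtain ⟨P, hP⟩ := (hf.mono hrD).isExactOn_ball
  have hloc : ∀ w ∈ ball z r, J w f = P w + (J z f - P z) := by
    intro w hw
    have hseg : segment ℝ z w ⊆ ball z r := (convex_ball z r).segment_subset (mem_ball_self hr) hw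
    have h1 := PolyChain.eq_zero hD hDb hDc' ha
      (((hJ z hz).step (hseg.trans hrD)).trans (hJ w (hrD hw)).symm) hf
    have h2 := segInt_eq_sub_of_hasDerivAt (fun x hx => hP x (hseg hx))
      (hf.continuousOn.mono (hseg.trans hrD))
    rw [h2] at h1
    linear_combination -h1
  refine ((hP z (mem_ball_self hr)).add_const (J z f - P z)).congr_of_eventuallyEq ?_
  filter_upwards [ball_mem_nhds z hr] with w hw using hloc w hw

/-! ### Winding numbers and tubular neighbourhoods of smooth Jordan curves -/

/-- The integral `∮ dw / (w - z)` along a curve of period one. -/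
noncomputable def windInt (γ : ℝ → ℂ) (z : ℂ) : ℂ := ∫ t in (0 : ℝ)..1, deriv γ t / (γ t - z)

/-- The tubular coordinates `t + i s ↦ γ t + s i γ' t` of a curve. -/
noncomputable def tube (γ : ℝ → ℂ) (w : ℂ) : ℂ := γ w.re + w.im * Complex.I * deriv γ w.re

/-- The line integral depends continuously on the pole off the curve. -/
theorem continuousAt_cauchyInt {γ γ' : ℝ → ℂ} {a b : ℝ} (hab : a ≤ b) (hγ : ContinuousOn γ (Icc a b))
    (hγ' : ContinuousOn γ' (Icc a b)) {z₀ : ℂ} (hz₀ : z₀ ∉ γ '' Icc a b) :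
    ContinuousAt (fun z => ∫ t in a..b, γ' t / (γ t - z)) z₀ := by
  have hcl : IsClosed (γ '' Icc a b) := (isCompact_Icc.image_of_continuousOn hγ).isClosed
  obtain ⟨r, hr, hrC⟩ := Metric.isOpen_iff.1 hcl.isOpen_compl z₀ hz₀
  obtain ⟨M, hM⟩ := isCompact_Icc.exists_bound_of_continuousOn hγ'
  have hsub : Ι a b ⊆ Icc a b := by rw [uIoc_of_le hab]; exact Ioc_subset_Icc_self
  have hball : ∀ z ∈ ball z₀ (r / 2), ∀ t ∈ Icc a b, r / 2 ≤ ‖γ t - z‖ := by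
    intro z hz t ht
    have h1 : r ≤ dist (γ t) z₀ := not_lt.1 fun h => hrC (mem_ball.2 h) (mem_image_of_mem _ ht)
    rw [← dist_eq_norm]
    rw [mem_ball] at hz
    linarith [dist_triangle (γ t) z z₀]
  refine intervalIntegral.continuousAt_of_dominated_interval (bound := fun _ => M / (r / 2))
    ?_ ?_ intervalIntegrable_const ?_
  · filter_upwards [ball_mem_nhds z₀ (half_pos hr)] with z hz
    refine ContinuousOn.aestronglyMeasurable ?_ measurableSet_uIoc
    refine ContinuousOn.mono ?_ hsub
    refine hγ'.div (hγ.sub continuousOn_const) fun t ht h0 => ?_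
    have := hball z hz t ht
    rw [show γ t - z = 0 from h0, norm_zero] at this
    linarith
  · filter_upwards [ball_mem_nhds z₀ (half_pos hr)] with z hz
    refine ae_of_all _ fun t ht => ?_
    rw [norm_div]
    have := hball z hz t (hsub ht)
    have hM0 := hM t (hsub ht)
    have : 0 ≤ M := (norm_nonneg _).trans hM0
    gcongr
  · refine ae_of_all _ fun t ht => ?_
    have h0 : γ t - z₀ ≠ 0 := fun h => hz₀ ⟨t, hsub ht, sub_eq_zero.1 h⟩
    exact continuousAt_const.div (continuousAt_const.sub continuousAt_id) h0

/-- `γ` is a regular smooth parametrization, with period one, of the smooth Jordan curve `C`, with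
either orientation. -/
structure IsJordanLoop (γ : ℝ → ℂ) (C : Set ℂ) : Prop where
  smooth : ContDiff ℝ ∞ γ
  periodic : Function.Periodic γ 1
  injOn : InjOn γ (Ico 0 1)
  regular : ∀ t, deriv γ t ≠ 0
  range_eq : range γ = C

theorem IsJordanParam.isJordanLoop {γ : ℝ → ℂ} {C : Set ℂ} (h : IsJordanParam γ C) :
    IsJordanLoop γ C :=
  ⟨h.smooth, h.periodic, h.injOn, h.regular, h.range_eq⟩

namespace IsJordanLoop

variable {γ : ℝ → ℂ} {C : Set ℂ}

theorem continuous (h : IsJordanLoop γ C) : Continuous γ := h.smooth.continuous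

theorem contDiff_deriv (h : IsJordanLoop γ C) : ContDiff ℝ ∞ (deriv γ) :=
  (contDiff_infty_iff_deriv.1 h.smooth).2

theorem continuous_deriv (h : IsJordanLoop γ C) : Continuous (deriv γ) :=
  h.contDiff_deriv.continuous

theorem hasDerivAt (h : IsJordanLoop γ C) (t : ℝ) : HasDerivAt γ (deriv γ t) t :=
  (h.smooth.differentiable (by simp) t).hasDerivAt

theorem hasDerivAt_deriv (h : IsJordanLoop γ C) (t : ℝ) :
    HasDerivAt (deriv γ) (deriv (deriv γ) t) t :=
  (h.contDiff_deriv.differentiable (by simp) t).hasDerivAt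

theorem periodic_deriv (h : IsJordanLoop γ C) : Function.Periodic (deriv γ) 1 := fun t => by
  have h1 : (fun x => γ (x + 1)) = γ := funext h.periodic
  rw [← deriv_comp_add_const, h1]

theorem mem (h : IsJordanLoop γ C) (t : ℝ) : γ t ∈ C := h.range_eq ▸ mem_range_self t

theorem exists_eq (h : IsJordanLoop γ C) {z : ℂ} (hz : z ∈ C) : ∃ t, γ t = z := by
  rwa [← h.range_eq] at hz

theorem nonempty (h : IsJordanLoop γ C) : C.Nonempty := ⟨_, h.mem 0⟩

theorem periodic_int (h : IsJordanLoop γ C) (t : ℝ) (n : ℤ) : γ (t + n) = γ t := by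
  simpa using h.periodic.int_mul n t

theorem image_Icc (h : IsJordanLoop γ C) (a : ℝ) : γ '' Icc a (a + 1) = C := by
  rw [h.periodic.image_Icc one_pos, h.range_eq]

theorem isCompact (h : IsJordanLoop γ C) : IsCompact C := by
  rw [← h.image_Icc 0]
  exact isCompact_Icc.image h.continuous

theorem exists_int_of_eq (h : IsJordanLoop γ C) {t t' : ℝ} (ht : γ t = γ t') :
    ∃ n : ℤ, t = t' + n := by
  have h1 : ∀ x, γ (Int.fract x) = γ x := fun x => by
    have := h.periodic_int (Int.fract x) ⌊x⌋
    rw [← this, Int.fract_add_floor]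
  have hf : ∀ x : ℝ, Int.fract x ∈ Ico (0 : ℝ) 1 := fun x => ⟨Int.fract_nonneg x, Int.fract_lt_one x⟩
  have h2 : Int.fract t = Int.fract t' :=
    h.injOn (hf t) (hf t') (by rw [h1, h1, ht])
  obtain ⟨n, hn⟩ := Int.fract_eq_fract.1 h2
  exact ⟨n, by linarith⟩

/-- Points of the curve near `γ t₀` have parameters near `t₀` modulo one. -/
theorem eventually_param_near (h : IsJordanLoop γ C) (t₀ : ℝ) {δ : ℝ} (hδ : 0 < δ) :
    ∀ᶠ z in 𝓝 (γ t₀), ∀ t, γ t = z → ∃ n : ℤ, |t + n - t₀| < δ := by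
  set K : Set ℝ := Icc (t₀ - 1 / 2) (t₀ + 1 / 2) ∩ {t | δ ≤ |t - t₀|} with hK
  have hKc : IsCompact K :=
    isCompact_Icc.inter_right (isClosed_le continuous_const (by fun_prop))
  have hKcl : IsClosed (γ '' K) := (hKc.image h.continuous).isClosed
  have hnot : γ t₀ ∉ γ '' K := by
    rintro ⟨t, ⟨⟨ht1, ht2⟩, ht3⟩, hte⟩
    obtain ⟨n, hn⟩ := h.exists_int_of_eq hte
    have h1 : (n : ℝ) < 1 := by linarith
    have h2 : (-1 : ℝ) < n := by linarith
    have : n = 0 := by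
      have h1' : n < 1 := by exact_mod_cast h1
      have h2' : -1 < n := by exact_mod_cast h2
      omega
    rw [this] at hn
    simp only [mem_ofPred_eq, hn] at ht3
    simp at ht3
    linarith
  filter_upwards [hKcl.isOpen_compl.mem_nhds hnot] with z hz t ht
  refine ⟨-round (t - t₀), ?_⟩
  by_contra hcon
  refine hz ⟨t + (-round (t - t₀) : ℤ), ⟨?_, ?_⟩, ?_⟩
  · have := abs_le.1 (abs_sub_round (t - t₀))
    push_cast
    constructor <;> linarith [this.1, this.2]
  · exact not_lt.1 hcon
  · rw [h.periodic_int, ht]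

theorem tube_ofReal (t : ℝ) : tube γ (t : ℂ) = γ t := by simp [tube]

theorem tube_add_one (h : IsJordanLoop γ C) (w : ℂ) : tube γ (w + 1) = tube γ w := by
  simp [tube, h.periodic w.re, h.periodic_deriv w.re]

theorem tube_add_int (h : IsJordanLoop γ C) (w : ℂ) (n : ℤ) : tube γ (w + n) = tube γ w := by
  have : Function.Periodic (tube γ) 1 := h.tube_add_one
  simpa using this.int_mul n w

theorem contDiff_tube (h : IsJordanLoop γ C) : ContDiff ℝ ∞ (tube γ) := by
  have h1 := h.contDiff_deriv
  have h2 := h.smooth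
  unfold tube
  have hre : ContDiff ℝ ∞ Complex.re := Complex.reCLM.contDiff
  have him : ContDiff ℝ ∞ (fun w : ℂ => (w.im : ℂ)) :=
    Complex.ofRealCLM.contDiff.comp Complex.imCLM.contDiff
  exact (h2.comp hre).add ((him.mul contDiff_const).mul (h1.comp hre))

theorem continuous_tube (h : IsJordanLoop γ C) : Continuous (tube γ) := h.contDiff_tube.continuous

/-- Multiplication by the velocity, as a linear automorphism of the plane. -/
theorem exists_equiv_tube (h : IsJordanLoop γ C) (t : ℝ) :
    ∃ e : ℂ ≃L[ℝ] ℂ, HasStrictFDerivAt (tube γ) (e : ℂ →L[ℝ] ℂ) t := by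
  set e : ℂ ≃L[ℝ] ℂ :=
    (ContinuousLinearEquiv.unitsEquivAut ℂ (Units.mk0 _ (h.regular t))).restrictScalars ℝ with he
  refine ⟨e, ?_⟩
  have hs : HasStrictFDerivAt (tube γ) (fderiv ℝ (tube γ) t) t :=
    h.contDiff_tube.contDiffAt.hasStrictFDerivAt (by simp)
  convert hs using 1
  have h1 : HasFDerivAt (fun w : ℂ => γ w.re) (Complex.reCLM.smulRight (deriv γ t)) (t : ℂ) := by
    have := HasFDerivAt.comp (g := γ) (t : ℂ) (h.hasDerivAt t).hasFDerivAt
      (Complex.reCLM.hasFDerivAt (x := (t : ℂ)))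
    refine this.congr_fderiv ?_
    ext
    simp
  have h2 : HasFDerivAt (fun w : ℂ => deriv γ w.re)
      (Complex.reCLM.smulRight (deriv (deriv γ) t)) (t : ℂ) := by
    have := HasFDerivAt.comp (g := (deriv γ)) (t : ℂ) (h.hasDerivAt_deriv t).hasFDerivAt
      (Complex.reCLM.hasFDerivAt (x := (t : ℂ)))
    refine this.congr_fderiv ?_
    ext
    simp
  have h3 : HasFDerivAt (fun w : ℂ => (w.im : ℂ) * Complex.I)
      ((Complex.imCLM.smulRight (Complex.I))) (t : ℂ) := by
    have := ((Complex.ofRealCLM.comp Complex.imCLM).hasFDerivAt (x := (t : ℂ))).mul_const Complex.I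
    refine this.congr_fderiv ?_
    ext x
    simp [mul_comm]
  have h4 := h1.add (h3.mul h2)
  have h5 : fderiv ℝ (tube γ) t = _ := h4.fderiv
  rw [h5]
  ext x
  simp only [he]
  simp only [ContinuousLinearEquiv.coe_coe, ContinuousLinearEquiv.restrictScalars_apply,
    ContinuousLinearEquiv.unitsEquivAut_apply, Units.val_mk0]
  simp
  linear_combination (-(deriv γ t)) * Complex.re_add_im x

theorem map_nhds_tube (h : IsJordanLoop γ C) (t : ℝ) :
    map (tube γ) (𝓝 (t : ℂ)) = 𝓝 (γ t) := by
  obtain ⟨e, he⟩ := h.exists_equiv_tube t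
  rw [he.map_nhds_eq_of_equiv, tube_ofReal]

/-- The tube map is injective near t₀, and a point of C near γ t₀ has a parameter near t₀ modulo
one, so it is already the image of a real point. -/
theorem eventually_tube_mem (h : IsJordanLoop γ C) (t₀ : ℝ) :
    ∀ᶠ w in 𝓝 (t₀ : ℂ), tube γ w ∈ C → w.im = 0 := by
  obtain ⟨e, he⟩ := h.exists_equiv_tube t₀
  set Ψ := he.toOpenPartialHomeomorph (tube γ)
  have hsrc : Ψ.source ∈ 𝓝 (t₀ : ℂ) :=
    Ψ.open_source.mem_nhds he.mem_toOpenPartialHomeomorph_source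
  obtain ⟨δ, hδ, hδs⟩ := Metric.mem_nhds_iff.1 hsrc
  have hnear := h.eventually_param_near t₀ hδ
  rw [← tube_ofReal (γ := γ)] at hnear
  filter_upwards [hsrc, h.continuous_tube.continuousAt.eventually hnear] with w hw hw' hwC
  obtain ⟨t, ht⟩ := h.exists_eq hwC
  obtain ⟨n, hn⟩ := hw' t ht
  have h1 : ((t + n : ℝ) : ℂ) ∈ Ψ.source := by
    apply hδs
    rw [mem_ball, Complex.dist_eq, ← Complex.ofReal_sub, Complex.norm_real]
    exact hn
  have h2 : w = ((t + n : ℝ) : ℂ) := by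
    refine Ψ.injOn hw h1 ?_
    change tube γ w = tube γ _
    rw [tube_ofReal, h.periodic_int, ht]
  rw [h2, Complex.ofReal_im]

/-- A uniform width of a tubular neighbourhood meeting the curve only along its core. -/
theorem exists_tube_width (h : IsJordanLoop γ C) :
    ∃ η > 0, ∀ w : ℂ, |w.im| < η → w.im ≠ 0 → tube γ w ∉ C := by
  have key : ∀ᶠ s : ℝ in 𝓝 0, ∀ t ∈ Icc (0 : ℝ) 1, tube γ (t + s * Complex.I) ∈ C → s = 0 := by
    refine isCompact_Icc.eventually_forall_of_forall_eventually
      (P := fun (s : ℝ) (t : ℝ) => tube γ (t + s * Complex.I) ∈ C → s = 0) fun t _ => ?_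
    have hc : ContinuousAt (fun x : ℝ × ℝ => (x.2 + x.1 * Complex.I : ℂ)) (0, t) := by fun_prop
    have hlim : Tendsto (fun x : ℝ × ℝ => (x.2 + x.1 * Complex.I : ℂ)) (𝓝 (0, t)) (𝓝 (t : ℂ)) := by
      simpa [ContinuousAt] using hc
    filter_upwards [hlim.eventually (h.eventually_tube_mem t)] with x hx hxC
    simpa using hx hxC
  obtain ⟨η, hη, hη'⟩ := Metric.eventually_nhds_iff.1 key
  refine ⟨η, hη, fun w hw hw0 hwC => hw0 ?_⟩
  refine hη' (y := w.im) (by simpa using hw) (Int.fract w.re)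
    ⟨Int.fract_nonneg _, (Int.fract_lt_one _).le⟩ ?_
  have : tube γ (Int.fract w.re + w.im * Complex.I) = tube γ w := by
    rw [← h.tube_add_int _ ⌊w.re⌋]
    congr 1
    apply Complex.ext <;> simp
  rwa [this]

theorem exp_windInt (h : IsJordanLoop γ C) {z : ℂ} (hz : z ∉ C) :
    Complex.exp (windInt γ z) = 1 := by
  have hne : ∀ t, γ t - z ≠ 0 := fun t h0 => hz (sub_eq_zero.1 h0 ▸ h.mem t)
  have := exp_integral_logDeriv (u := fun t => γ t - z) (u' := deriv γ) zero_le_one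
    (fun t _ => (h.hasDerivAt t).sub_const z) h.continuous_deriv.continuousOn (fun t _ => hne t)
  rw [windInt, this, ← zero_add (1 : ℝ), h.periodic 0, div_self (hne 0)]

theorem continuousOn_windInt (h : IsJordanLoop γ C) : ContinuousOn (windInt γ) Cᶜ := by
  intro z hz
  refine (continuousAt_cauchyInt zero_le_one h.continuous.continuousOn
    h.continuous_deriv.continuousOn fun hz' => hz ?_).continuousWithinAt
  have := h.image_Icc 0
  rw [zero_add] at this
  rwa [this] at hz'

/-- Nearby values differ by less than 1 while the exponential of their difference is 1, so the
winding integral is locally constant off the curve. -/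
theorem windInt_eq_of_isPreconnected (h : IsJordanLoop γ C) {A : Set ℂ} (hA : IsPreconnected A)
    (hAC : Disjoint A C) {x y : ℂ} (hx : x ∈ A) (hy : y ∈ A) : windInt γ x = windInt γ y := by
  have hCo : IsOpen Cᶜ := h.isCompact.isClosed.isOpen_compl
  have hsub : A ⊆ Cᶜ := hAC.subset_compl_right
  set U : Set ℂ := {z | z ∈ Cᶜ ∧ windInt γ z = windInt γ x} with hU
  have hUo : IsOpen U := by
    refine isOpen_iff_mem_nhds.2 fun z hz => ?_
    have hc : Tendsto (fun w => ‖windInt γ w - windInt γ x‖) (𝓝 z) (𝓝 ‖windInt γ z - windInt γ x‖) :=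
      ((h.continuousOn_windInt.continuousAt (hCo.mem_nhds hz.1)).sub continuousAt_const).norm
    simp only [hz.2, sub_self, norm_zero] at hc
    filter_upwards [hCo.mem_nhds hz.1, hc.eventually_lt_const one_pos] with w hw hw'
    refine ⟨hw, sub_eq_zero.1 (eq_zero_of_exp_eq_one_of_norm_lt_one ?_ hw')⟩
    rw [Complex.exp_sub, h.exp_windInt hw, h.exp_windInt (hsub hx), div_one]
  have hVo : IsOpen (Cᶜ ∩ windInt γ ⁻¹' {windInt γ x}ᶜ) :=
    h.continuousOn_windInt.isOpen_inter_preimage hCo isOpen_compl_singleton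
  have := hA.subset_left_of_subset_union hUo hVo
    (Set.disjoint_left.2 fun z hz hz' => hz'.2 hz.2) (fun z hz => by
      by_cases hzx : windInt γ z = windInt γ x
      · exact Or.inl ⟨hsub hz, hzx⟩
      · exact Or.inr ⟨hsub hz, hzx⟩) ⟨x, hx, hsub hx, rfl⟩
  exact (this hy).2.symm

/-- Far away the integral has modulus at most M/(M + 1) < 1, with M a bound for |γ'|. -/
theorem eventually_windInt_eq_zero (h : IsJordanLoop γ C) :
    ∀ᶠ z in Bornology.cobounded ℂ, windInt γ z = 0 := by
  obtain ⟨M, hM⟩ := (isCompact_Icc (a := (0 : ℝ)) (b := 1)).exists_bound_of_continuousOn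
    h.continuous_deriv.continuousOn
  obtain ⟨R, hR⟩ := h.isCompact.isBounded.exists_norm_le
  have hM0 : 0 ≤ M := (norm_nonneg _).trans (hM 0 (by simp))
  have hev : ∀ᶠ z : ℂ in Bornology.cobounded ℂ, R + M + 1 < ‖z‖ :=
    tendsto_norm_cobounded_atTop.eventually_gt_atTop _
  filter_upwards [hev] with z hz
  have hzC : z ∉ C := fun h' => by linarith [hR z h']
  refine eq_zero_of_exp_eq_one_of_norm_lt_one (h.exp_windInt hzC) ?_
  have : ‖windInt γ z‖ ≤ M / (M + 1) * |1 - 0| := by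
    refine intervalIntegral.norm_integral_le_of_norm_le_const fun t ht => ?_
    rw [uIoc_of_le zero_le_one] at ht
    have h1 : M + 1 ≤ ‖γ t - z‖ := by
      have := norm_sub_norm_le z (γ t)
      rw [norm_sub_rev] at this
      linarith [hR _ (h.mem t)]
    rw [norm_div]
    have := hM t ⟨ht.1.le, ht.2⟩
    gcongr
  refine this.trans_lt ?_
  rw [sub_zero, abs_one, mul_one, div_lt_one (by linarith)]
  linarith

end IsJordanLoop

theorem log_neg_of_im_pos {z : ℂ} (hz : 0 < z.im) :
    Complex.log (-z) = Complex.log z - Real.pi * Complex.I := by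
  rw [Complex.log, Complex.log, norm_neg, Complex.arg_neg_eq_arg_sub_pi_of_im_pos hz]
  push_cast
  ring

theorem log_neg_of_im_neg {z : ℂ} (hz : z.im < 0) :
    Complex.log (-z) = Complex.log z + Real.pi * Complex.I := by
  rw [Complex.log, Complex.log, norm_neg, Complex.arg_neg_eq_arg_add_pi_of_im_neg hz]
  push_cast
  ring

/-- The variation of `log (w - s i)` along an arc crossing the imaginary axis once, at `0`, from
left to right; `ε = 1` above and `ε = -1` below the pole. -/
theorem integral_logDeriv_crossing {u u' : ℝ → ℂ} {a b m s ε : ℝ} (ham : a ≤ b)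
    (hu : ∀ t ∈ Icc a b, HasDerivAt u (u' t) t) (hu' : ContinuousOn u' (Icc a b))
    (hre : ∀ t ∈ Icc a b, t ≠ m → (u t).re ≠ 0) (hm : u m = 0) (hε : ε ≠ 0) (hs : 0 < ε * s) :
    ∫ t in a..b, u' t / (u t - s * Complex.I) =
      Complex.log (ε * Complex.I * (u b - s * Complex.I)) -
        Complex.log (ε * Complex.I * (u a - s * Complex.I)) := by
  -- The factor εi turns the path into the slit plane: at t = m the value is εs > 0, and elsewhere
  -- the imaginary part ε·Re u is nonzero. One branch of log therefore serves the whole arc.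
  have hslit : ∀ t ∈ Icc a b, (ε * Complex.I * (u t - s * Complex.I) : ℂ) ∈ Complex.slitPlane := by
    intro t ht
    rw [Complex.mem_slitPlane_iff]
    by_cases htm : t = m
    · left
      subst htm
      simpa [hm] using hs
    · right
      simpa using ⟨hε, hre t ht htm⟩
  have hne : ∀ t ∈ Icc a b, u t - s * Complex.I ≠ 0 := fun t ht h0 => by
    have := Complex.slitPlane_ne_zero (hslit t ht)
    simp [h0] at this
  have hεC : (ε * Complex.I : ℂ) ≠ 0 := by simpa using hε
  have huc : ContinuousOn u (Icc a b) := fun t ht => (hu t ht).continuousAt.continuousWithinAt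
  refine intervalIntegral.integral_eq_sub_of_hasDerivAt
    (f := fun t => Complex.log (ε * Complex.I * (u t - s * Complex.I))) (fun t ht => ?_) ?_
  · rw [uIcc_of_le ham] at ht
    have h1 := (((hu t ht).sub_const (s * Complex.I)).const_mul (ε * Complex.I : ℂ)).clog_real
      (hslit t ht)
    refine h1.congr_deriv ?_
    rw [mul_div_mul_left _ _ hεC]
  · refine ContinuousOn.intervalIntegrable ?_
    rw [uIcc_of_le ham]
    exact hu'.div (huc.sub continuousOn_const) hne

namespace IsJordanLoop

variable {γ : ℝ → ℂ} {C : Set ℂ}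

theorem isPreconnected_side (h : IsJordanLoop γ C) (a b : ℝ) :
    IsPreconnected (tube γ '' {w | a < w.im ∧ w.im < b}) := by
  refine IsPreconnected.image ?_ _ h.continuous_tube.continuousOn
  have : {w : ℂ | a < w.im ∧ w.im < b} = Complex.imLm ⁻¹' Ioo a b := rfl
  rw [this]
  exact ((convex_Ioo a b).linear_preimage _).isPreconnected

theorem integral_shift (h : IsJordanLoop γ C) (z : ℂ) (a : ℝ) :
    windInt γ z = ∫ t in a..(a + 1), deriv γ t / (γ t - z) := by
  have hp : Function.Periodic (fun t => deriv γ t / (γ t - z)) 1 := fun t => by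
    simp only [h.periodic t, h.periodic_deriv t]
  have := hp.intervalIntegral_add_eq 0 a
  rw [zero_add] at this
  exact this

/-- The winding number jumps by one across the curve. -/
theorem windInt_jump (h : IsJordanLoop γ C) {η : ℝ}
    (hη : ∀ w : ℂ, |w.im| < η → w.im ≠ 0 → tube γ w ∉ C) {w₁ w₂ : ℂ}
    (hw₁ : 0 < w₁.im ∧ w₁.im < η) (hw₂ : -η < w₂.im ∧ w₂.im < 0) :
    windInt γ (tube γ w₁) - windInt γ (tube γ w₂) = 2 * Real.pi * Complex.I := by
  have hη0 : 0 < η := hw₁.1.trans hw₁.2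
  set v := deriv γ 0 with hv
  have hv0 : v ≠ 0 := h.regular 0
  -- In this coordinate the curve passes through 0 in the direction 1, so Re u is strictly
  -- increasing on a short arc, and the normal at γ 0 becomes the imaginary axis.
  set u : ℝ → ℂ := fun t => (γ t - γ 0) / v with hu
  have hud : ∀ t, HasDerivAt u (deriv γ t / v) t := fun t =>
    ((h.hasDerivAt t).sub_const _).div_const v
  have huc : Continuous u := continuous_iff_continuousAt.2 fun t => (hud t).continuousAt
  have hu'c : Continuous fun t => deriv γ t / v := h.continuous_deriv.div_const v
  obtain ⟨δ, hδ, hδ2, hpos⟩ : ∃ δ > 0, δ < 1 / 2 ∧ ∀ t ∈ Icc (-δ) δ, 0 < (deriv γ t / v).re := by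
    have hc : ContinuousAt (fun t => (deriv γ t / v).re) 0 :=
      (Complex.continuous_re.comp hu'c).continuousAt
    have h1 : ∀ᶠ t in 𝓝 (0 : ℝ), 0 < (deriv γ t / v).re := by
      refine hc.eventually (lt_mem_nhds ?_)
      simp [← hv, div_self hv0]
    obtain ⟨r, hr, hr'⟩ := Metric.eventually_nhds_iff.1 h1
    refine ⟨min (r / 2) (1 / 4), by positivity, (min_le_right _ _).trans_lt (by norm_num),
      fun t ht => hr' ?_⟩
    have := min_le_left (r / 2) (1 / 4 : ℝ)
    rw [Real.dist_eq, sub_zero, abs_lt]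
    constructor <;> linarith [ht.1, ht.2]
  have hu0 : u 0 = 0 := by simp [hu]
  have hmono : StrictMonoOn (fun t => (u t).re) (Icc (-δ) δ) := by
    refine strictMonoOn_of_deriv_pos (convex_Icc _ _)
      (Complex.continuous_re.comp huc).continuousOn fun t ht => ?_
    rw [interior_Icc] at ht
    have h1 : HasDerivAt (fun t => (u t).re) (deriv γ t / v).re t :=
      Complex.reCLM.hasFDerivAt.comp_hasDerivAt t (hud t)
    rw [h1.deriv]
    exact hpos t ⟨ht.1.le, ht.2.le⟩
  have h0mem : (0 : ℝ) ∈ Icc (-δ) δ := ⟨by linarith, hδ.le⟩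
  have hre : ∀ t ∈ Icc (-δ) δ, t ≠ 0 → (u t).re ≠ 0 := fun t ht ht0 hh => by
    refine ht0 (hmono.injOn ht h0mem ?_)
    simp [hh, hu0]
  have hplus : 0 < (u δ).re := by
    have := hmono h0mem ⟨by linarith, le_rfl⟩ hδ
    simpa [hu0] using this
  have hminus : (u (-δ)).re < 0 := by
    have := hmono ⟨le_rfl, by linarith⟩ h0mem (by linarith : -δ < 0)
    simpa [hu0] using this
  -- The contribution of the rest of the curve, which stays away from γ 0 and so is continuous
  -- there. The jump comes from the short arc alone.
  set R : ℂ → ℂ := fun z => ∫ t in δ..(-δ + 1), deriv γ t / (γ t - z) with hR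
  have hRc : ContinuousAt R (γ 0) := by
    refine continuousAt_cauchyInt (by linarith) h.continuous.continuousOn
      h.continuous_deriv.continuousOn ?_
    rintro ⟨t, ht, hte⟩
    obtain ⟨n, hn⟩ := h.exists_int_of_eq hte
    rw [zero_add] at hn
    have h1 : (0 : ℝ) < n := by linarith [ht.1]
    have h2 : (n : ℝ) < 1 := by linarith [ht.2]
    have h1' : 0 < n := by exact_mod_cast h1
    have h2' : n < 1 := by exact_mod_cast h2
    omega
  set q : ℝ → ℂ := fun s => tube γ (s * Complex.I) with hq
  have hqv : ∀ s : ℝ, q s = γ 0 + s * Complex.I * v := fun s => by simp [hq, tube, hv]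
  have hqc : Continuous q := h.continuous_tube.comp (by fun_prop)
  have hq0 : q 0 = γ 0 := by simp [hqv]
  have hRlim : Tendsto (fun s => R (q s)) (𝓝 0) (𝓝 (R (γ 0))) := by
    have := hqc.tendsto 0
    rw [hq0] at this
    exact hRc.tendsto.comp this
  set L : ℝ → ℝ → ℂ := fun ε s => Complex.log (ε * Complex.I * (u δ - s * Complex.I)) -
        Complex.log (ε * Complex.I * (u (-δ) - s * Complex.I)) with hL
  have hLlim : ∀ ε : ℝ, ε ≠ 0 → Tendsto (L ε) (𝓝 0) (𝓝 (L ε 0)) := by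
    intro ε hε
    have h1 : ∀ x : ℂ, x.re ≠ 0 →
        ContinuousAt (fun s : ℝ => Complex.log (ε * Complex.I * (x - s * Complex.I))) 0 := by
      intro x hx
      refine ContinuousAt.clog (by fun_prop) ?_
      rw [Complex.mem_slitPlane_iff]
      right
      simpa using ⟨hε, hx⟩
    exact ((h1 _ hplus.ne').sub (h1 _ hminus.ne)).tendsto
  have hsplit : ∀ ε s : ℝ, 0 < ε * s → |s| < η → windInt γ (q s) = L ε s + R (q s) := by
    intro ε s hεs hsη
    have hs0 : s ≠ 0 := by rintro rfl; simp at hεs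
    have hε0 : ε ≠ 0 := by rintro rfl; simp at hεs
    have hqC : q s ∉ C := hη _ (by simpa using hsη) (by simpa using hs0)
    have hne : ∀ t, γ t - q s ≠ 0 := fun t h0 => hqC (sub_eq_zero.1 h0 ▸ h.mem t)
    have hcont : Continuous fun t => deriv γ t / (γ t - q s) :=
      h.continuous_deriv.div (h.continuous.sub continuous_const) hne
    rw [h.integral_shift _ (-δ), ← intervalIntegral.integral_add_adjacent_intervals
      (hcont.intervalIntegrable (-δ) δ) (hcont.intervalIntegrable δ (-δ + 1))]
    congr 1
    change _ = Complex.log _ - Complex.log _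
    rw [← integral_logDeriv_crossing (m := 0) (by linarith) (fun t _ => hud t) hu'c.continuousOn hre
      hu0 hε0 hεs]
    refine intervalIntegral.integral_congr fun t _ => ?_
    have : γ t - q s = v * (u t - s * Complex.I) := by
      rw [hqv, hu]
      field_simp
      ring
    rw [this]
    field_simp
  have hside : ∀ a b : ℝ, (∀ w : ℂ, a < w.im ∧ w.im < b → |w.im| < η ∧ w.im ≠ 0) →
      ∀ w w' : ℂ, a < w.im ∧ w.im < b → a < w'.im ∧ w'.im < b →
      windInt γ (tube γ w) = windInt γ (tube γ w') := by
    intro a b hab w w' hw hw'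
    refine h.windInt_eq_of_isPreconnected (h.isPreconnected_side a b) ?_ (mem_image_of_mem _ hw)
      (mem_image_of_mem _ hw')
    refine Set.disjoint_left.2 ?_
    rintro _ ⟨x, hx, rfl⟩
    exact hη x (hab x hx).1 (hab x hx).2
  have hW1 : windInt γ (tube γ w₁) = L 1 0 + R (γ 0) := by
    refine tendsto_nhds_unique (f := fun s : ℝ => windInt γ (q s)) (l := 𝓝[>] (0 : ℝ)) ?_ ?_
    · refine tendsto_const_nhds.congr' ?_
      filter_upwards [Ioo_mem_nhdsGT hη0] with s hs
      refine hside 0 η (fun w hw => ⟨by rw [abs_of_pos hw.1]; exact hw.2, hw.1.ne'⟩) _ _ hw₁ ?_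
      simpa using hs
    · refine (((hLlim 1 one_ne_zero).add hRlim).mono_left nhdsWithin_le_nhds).congr' ?_
      filter_upwards [Ioo_mem_nhdsGT hη0] with s hs
      exact (hsplit 1 s (by linarith [hs.1]) (by rw [abs_of_pos hs.1]; exact hs.2)).symm
  have hW2 : windInt γ (tube γ w₂) = L (-1) 0 + R (γ 0) := by
    refine tendsto_nhds_unique (f := fun s : ℝ => windInt γ (q s)) (l := 𝓝[<] (0 : ℝ)) ?_ ?_
    · refine tendsto_const_nhds.congr' ?_
      filter_upwards [Ioo_mem_nhdsLT (neg_lt_zero.2 hη0)] with s hs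
      refine hside (-η) 0 (fun w hw => ⟨by rw [abs_of_neg hw.2]; linarith [hw.1], hw.2.ne⟩) _ _ hw₂ ?_
      simpa using hs
    · refine (((hLlim (-1) (by norm_num)).add hRlim).mono_left nhdsWithin_le_nhds).congr' ?_
      filter_upwards [Ioo_mem_nhdsLT (neg_lt_zero.2 hη0)] with s hs
      exact (hsplit (-1) s (by linarith [hs.2]) (by rw [abs_of_neg hs.2]; linarith [hs.1])).symm
  rw [hW1, hW2, hL]
  simp only [Complex.ofReal_one, Complex.ofReal_zero, zero_mul, sub_zero, one_mul,
    Complex.ofReal_neg, neg_mul]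
  -- The two determinations of the logarithm differ by πi at each end of the arc, with opposite
  -- signs, so the difference of the variations is 2πi.
  rw [log_neg_of_im_pos (by simpa using hplus), log_neg_of_im_neg (by simpa using hminus)]
  ring

/-- Every component of the complement of the curve contains one of its sides. -/
theorem exists_side_subset (h : IsJordanLoop γ C) {η : ℝ} (hη0 : 0 < η)
    (hη : ∀ w : ℂ, |w.im| < η → w.im ≠ 0 → tube γ w ∉ C) {z : ℂ} (hz : z ∉ C) :
    tube γ '' {w | 0 < w.im ∧ w.im < η} ⊆ connectedComponentIn Cᶜ z ∨
      tube γ '' {w | -η < w.im ∧ w.im < 0} ⊆ connectedComponentIn Cᶜ z := by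
  set V := connectedComponentIn Cᶜ z with hV
  have hVo : IsOpen V := h.isCompact.isClosed.isOpen_compl.connectedComponentIn
  have hzV : z ∈ V := mem_connectedComponentIn hz
  have hVC : V ⊆ Cᶜ := connectedComponentIn_subset _ _
  have hfr : (frontier V).Nonempty := by
    refine nonempty_frontier_iff.2 ⟨⟨z, hzV⟩, fun hu => ?_⟩
    obtain ⟨x, hx⟩ := h.nonempty
    exact hVC (hu ▸ mem_univ x) hx
  obtain ⟨x, hx⟩ := hfr
  have hxC : x ∈ C := by
    by_contra hxC
    -- A frontier point of V off C could be adjoined to V, contradicting the maximality of a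
    -- component.
    have hpre : IsPreconnected (insert x V) :=
      isPreconnected_connectedComponentIn.subset_closure (subset_insert _ _)
        (insert_subset hx.1 subset_closure)
    have hsub : insert x V ⊆ V :=
      hpre.subset_connectedComponentIn (mem_insert_of_mem _ hzV) (insert_subset hxC hVC)
    have := hsub (mem_insert _ _)
    rw [hVo.frontier_eq] at hx
    exact hx.2 this
  obtain ⟨t, rfl⟩ := h.exists_eq hxC
  have hnh : tube γ '' {w | |w.im| < η} ∈ 𝓝 (γ t) := by
    rw [← h.map_nhds_tube t]
    refine image_mem_map ?_
    refine (isOpen_lt (by fun_prop : Continuous fun w : ℂ => |w.im|) continuous_const).mem_nhds ?_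
    simpa using hη0
  obtain ⟨y, ⟨w, hw, rfl⟩, hyV⟩ := mem_closure_iff_nhds.1 hx.1 _ hnh
  have hw0 : w.im ≠ 0 := fun h0 => by
    have : w = (w.re : ℂ) := by apply Complex.ext <;> simp [h0]
    rw [this, tube_ofReal] at hyV
    exact hVC hyV (h.mem _)
  have hmain : ∀ a b : ℝ, (∀ w : ℂ, a < w.im ∧ w.im < b → |w.im| < η ∧ w.im ≠ 0) →
      a < w.im ∧ w.im < b → tube γ '' {w | a < w.im ∧ w.im < b} ⊆ V := by
    intro a b hab hw'
    rw [hV, connectedComponentIn_eq hyV]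
    refine (h.isPreconnected_side a b).subset_connectedComponentIn (mem_image_of_mem _ hw') ?_
    rintro _ ⟨x, hx, rfl⟩
    exact hη x (hab x hx).1 (hab x hx).2
  have hw' := abs_lt.1 (show |w.im| < η from hw)
  rcases lt_or_gt_of_ne hw0 with h1 | h1
  · exact Or.inr (hmain _ _ (fun w hw => ⟨by rw [abs_of_neg hw.2]; linarith [hw.1], hw.2.ne⟩)
      ⟨hw'.1, h1⟩)
  · exact Or.inl (hmain _ _ (fun w hw => ⟨by rw [abs_of_pos hw.1]; exact hw.2, hw.1.ne'⟩)
      ⟨h1, hw'.2⟩)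

end IsJordanLoop

namespace IsJordanLoop

variable {γ : ℝ → ℂ} {C : Set ℂ}

/-- The winding numbers of the two sides: one of them vanishes. -/
theorem exists_windInt_sides (h : IsJordanLoop γ C) {η : ℝ} (hη0 : 0 < η)
    (hη : ∀ w : ℂ, |w.im| < η → w.im ≠ 0 → tube γ w ∉ C) :
    ∃ σ : ℝ, (σ = 1 ∨ σ = -1) ∧ ∀ w : ℂ,
      (0 < σ * w.im ∧ σ * w.im < η → windInt γ (tube γ w) = σ * (2 * Real.pi * Complex.I)) ∧
      (-η < σ * w.im ∧ σ * w.im < 0 → windInt γ (tube γ w) = 0) := by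
  -- The component of a far point has winding number zero and contains one of the sides; the jump
  -- determines the value on the other.
  obtain ⟨z, hz0, hzC⟩ := (h.eventually_windInt_eq_zero.and
    (Bornology.isBounded_def.1 h.isCompact.isBounded)).exists
  have hVC := connectedComponentIn_subset Cᶜ z
  have hdis : Disjoint (connectedComponentIn Cᶜ z) C :=
    Set.disjoint_left.2 fun x hx hxC => hVC hx hxC
  have hzero : ∀ x ∈ connectedComponentIn Cᶜ z, windInt γ x = 0 := fun x hx => by
    rw [h.windInt_eq_of_isPreconnected isPreconnected_connectedComponentIn hdis hx
      (mem_connectedComponentIn hzC), hz0]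
  have hp : (0 : ℝ) < (Complex.I * (η / 2 : ℝ) : ℂ).im ∧ (Complex.I * (η / 2 : ℝ) : ℂ).im < η := by
    rw [Complex.I_mul_im, Complex.ofReal_re]
    constructor <;> linarith
  have hn : -η < (-Complex.I * (η / 2 : ℝ) : ℂ).im ∧ (-Complex.I * (η / 2 : ℝ) : ℂ).im < 0 := by
    rw [neg_mul, Complex.neg_im, Complex.I_mul_im, Complex.ofReal_re]
    constructor <;> linarith
  rcases h.exists_side_subset hη0 hη hzC with hs | hs
  · have hup : ∀ w : ℂ, 0 < w.im ∧ w.im < η → windInt γ (tube γ w) = 0 := fun w hw =>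
      hzero _ (hs (mem_image_of_mem _ hw))
    refine ⟨-1, Or.inr rfl, fun w => ⟨fun hw => ?_, fun hw => hup w ⟨by linarith, by linarith⟩⟩⟩
    have := h.windInt_jump hη hp (w₂ := w) ⟨by linarith, by linarith⟩
    rw [hup _ hp] at this
    push_cast
    linear_combination -this
  · have hdn : ∀ w : ℂ, -η < w.im ∧ w.im < 0 → windInt γ (tube γ w) = 0 := fun w hw =>
      hzero _ (hs (mem_image_of_mem _ hw))
    refine ⟨1, Or.inl rfl, fun w => ⟨fun hw => ?_, fun hw => hdn w ⟨by linarith, by linarith⟩⟩⟩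
    have := h.windInt_jump hη (w₁ := w) (by simpa using hw) hn
    rw [hdn _ hn] at this
    push_cast
    linear_combination this

/-- Off the curve the winding number takes the value `0` and one of the values `± 1`. -/
theorem exists_windInt_values (h : IsJordanLoop γ C) :
    ∃ σ : ℝ, (σ = 1 ∨ σ = -1) ∧
      (∀ z ∉ C, windInt γ z = 0 ∨ windInt γ z = σ * (2 * Real.pi * Complex.I)) ∧
      ∃ z ∉ C, windInt γ z ≠ 0 := by
  obtain ⟨η, hη0, hη⟩ := h.exists_tube_width
  obtain ⟨σ, hσ, hw⟩ := h.exists_windInt_sides hη0 hη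
  have hdis : ∀ z, Disjoint (connectedComponentIn Cᶜ z) C := fun z =>
    Set.disjoint_left.2 fun x hx hxC => connectedComponentIn_subset Cᶜ z hx hxC
  have hval : ∀ w : ℂ, |w.im| < η → w.im ≠ 0 → windInt γ (tube γ w) = 0 ∨
      windInt γ (tube γ w) = σ * (2 * Real.pi * Complex.I) := by
    intro w hw1 hw2
    have h1 := abs_lt.1 hw1
    rcases lt_or_gt_of_ne hw2 with h2 | h2 <;> rcases hσ with rfl | rfl
    · exact Or.inl ((hw w).2 ⟨by linarith, by linarith⟩)
    · exact Or.inr ((hw w).1 ⟨by linarith, by linarith⟩)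
    · exact Or.inr ((hw w).1 ⟨by linarith, by linarith⟩)
    · exact Or.inl ((hw w).2 ⟨by linarith, by linarith⟩)
  have hσ0 : σ ≠ 0 := by rcases hσ with rfl | rfl <;> norm_num
  refine ⟨σ, hσ, fun z hz => ?_, ?_⟩
  · obtain ⟨w, hw1, hw2, hwV⟩ : ∃ w : ℂ, |w.im| < η ∧ w.im ≠ 0 ∧
        tube γ w ∈ connectedComponentIn Cᶜ z := by
      rcases h.exists_side_subset hη0 hη hz with hs | hs
      · refine ⟨Complex.I * (η / 2 : ℝ), ?_, ?_, hs (mem_image_of_mem _ ?_)⟩ <;>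
          simp only [mem_ofPred_eq, Complex.I_mul_im, Complex.ofReal_re]
        · rw [abs_of_pos] <;> linarith
        · linarith
        · constructor <;> linarith
      · refine ⟨-Complex.I * (η / 2 : ℝ), ?_, ?_, hs (mem_image_of_mem _ ?_)⟩ <;>
          simp only [mem_ofPred_eq, neg_mul, Complex.neg_im, Complex.I_mul_im, Complex.ofReal_re]
        · rw [abs_of_neg] <;> linarith
        · linarith
        · constructor <;> linarith
    rw [h.windInt_eq_of_isPreconnected isPreconnected_connectedComponentIn (hdis z)
      (mem_connectedComponentIn hz) hwV]
    exact hval w hw1 hw2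
  · have him : ((σ * (η / 2) : ℝ) * Complex.I).im = σ * (η / 2) := by simp
    have hσσ : σ * (σ * (η / 2)) = η / 2 := by
      rcases hσ with rfl | rfl <;> ring
    refine ⟨tube γ ((σ * (η / 2) : ℝ) * Complex.I), hη _ ?_ ?_, ?_⟩
    · rw [him]
      rcases hσ with rfl | rfl
      · rw [abs_of_pos] <;> linarith
      · rw [abs_of_neg] <;> linarith
    · rw [him]; exact mul_ne_zero hσ0 (by linarith)
    · rw [(hw _).1 (by rw [him, hσσ]; constructor <;> linarith)]
      simp [hσ0, Real.pi_ne_zero]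

end IsJordanLoop

/-! ### The boundary of Ω and the region it encloses -/

theorem subset_of_isPreconnected_of_disjoint_frontier {Ω A : Set ℂ} (hΩ : IsOpen Ω)
    (hA : IsPreconnected A) (hd : Disjoint A (frontier Ω)) (hne : (A ∩ Ω).Nonempty) : A ⊆ Ω := by
  refine hA.subset_left_of_subset_union hΩ isClosed_closure.isOpen_compl
    (Set.disjoint_left.2 fun x hx hx' => hx' (subset_closure hx)) (fun x hx => ?_) hne
  by_cases hxΩ : x ∈ Ω
  · exact Or.inl hxΩ
  · refine Or.inr fun hxc => Set.disjoint_left.1 hd hx ?_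
    rw [hΩ.frontier_eq]
    exact ⟨hxc, hxΩ⟩

/-- Such a set is the image of A × ℝ under polar coordinates. -/
theorem isPreconnected_setOf_norm_sub_mem {A : Set ℝ} (hA : IsPreconnected A) (hA0 : A ⊆ Ici 0)
    (c : ℂ) : IsPreconnected {z : ℂ | ‖z - c‖ ∈ A} := by
  have h : {z : ℂ | ‖z - c‖ ∈ A} =
      (fun x : ℝ × ℝ => c + x.1 * Complex.exp (x.2 * Complex.I)) '' (A ×ˢ univ) := by
    ext z
    constructor
    · intro hz
      refine ⟨(‖z - c‖, Complex.arg (z - c)), ⟨hz, mem_univ _⟩, ?_⟩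
      simp [Complex.norm_mul_exp_arg_mul_I]
    · rintro ⟨x, hx, rfl⟩
      have h0 : 0 ≤ x.1 := hA0 hx.1
      simpa [Complex.norm_exp_ofReal_mul_I, abs_of_nonneg h0] using hx.1
  rw [h]
  exact (hA.prod isPreconnected_univ).image _ (by fun_prop)

namespace IsJordanExterior

variable {Ω : Set ℂ} {γ : ℝ → ℂ}

theorem loop (h : IsJordanExterior Ω γ) : IsJordanLoop γ (frontier Ω) := h.boundary.isJordanLoop

theorem notMem_of_mem_frontier (h : IsJordanExterior Ω γ) {z : ℂ} (hz : z ∈ frontier Ω) : z ∉ Ω := by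
  rw [h.isOpen.frontier_eq] at hz
  exact hz.2

/-- The outside of a large disc is connected, avoids the frontier and meets the unbounded set Ω, so
it lies in Ω. -/
theorem isBounded_compl (h : IsJordanExterior Ω γ) : Bornology.IsBounded Ωᶜ := by
  obtain ⟨R, hR0, hR⟩ := h.loop.isCompact.isBounded.exists_pos_norm_le
  have hpre : IsPreconnected {z : ℂ | R < ‖z‖} := by
    simpa using isPreconnected_setOf_norm_sub_mem (isPreconnected_Ioi (a := R))
      (fun x hx => (hR0.trans hx).le) 0
  have hsub : {z : ℂ | R < ‖z‖} ⊆ Ω := by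
    refine subset_of_isPreconnected_of_disjoint_frontier h.isOpen hpre
      (Set.disjoint_left.2 fun z hz hz' => not_lt.2 (hR z hz') hz) ?_
    by_contra hne
    refine h.unbounded (isBounded_iff_forall_norm_le.2 ⟨R, fun z hz => ?_⟩)
    by_contra hlt
    exact hne ⟨z, not_le.1 hlt, hz⟩
  refine isBounded_iff_forall_norm_le.2 ⟨R, fun z hz => ?_⟩
  by_contra hlt
  exact hz (hsub (not_le.1 hlt))

/-- Ω is connected, avoids the curve and contains points near infinity, where the winding number
vanishes. -/
theorem windInt_eq_zero (h : IsJordanExterior Ω γ) {z : ℂ} (hz : z ∈ Ω) : windInt γ z = 0 := by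
  obtain ⟨y, hy0, hyΩ⟩ := (h.loop.eventually_windInt_eq_zero.and
    (Bornology.isBounded_def.1 h.isBounded_compl)).exists
  rw [notMem_compl_iff] at hyΩ
  rw [h.loop.windInt_eq_of_isPreconnected h.isConnected.isPreconnected
    (Set.disjoint_left.2 fun x hx hx' => h.notMem_of_mem_frontier hx' hx) hz hyΩ, hy0]

/-- The Jordan curve theorem for a smooth curve: the sides of the boundary curve, and the
connectedness of the enclosed region. -/
theorem jordan (h : IsJordanExterior Ω γ) :
    IsPreconnected (closure Ω)ᶜ ∧ ∃ σ : ℝ, (σ = 1 ∨ σ = -1) ∧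
      (∀ z ∈ (closure Ω)ᶜ, windInt γ z = σ * (2 * Real.pi * Complex.I)) ∧
      ∃ η > 0, ∀ t s : ℝ, 0 < s → s < η →
        tube γ (t + (σ * s : ℝ) * Complex.I) ∈ (closure Ω)ᶜ ∧
        tube γ (t + (-(σ * s) : ℝ) * Complex.I) ∈ Ω := by
  have hγ := h.loop
  obtain ⟨η, hη0, hη⟩ := hγ.exists_tube_width
  obtain ⟨σ, hσ, hw⟩ := hγ.exists_windInt_sides hη0 hη
  have hσ0 : σ ≠ 0 := by rcases hσ with rfl | rfl <;> norm_num
  have hpi : (σ * (2 * Real.pi * Complex.I) : ℂ) ≠ 0 := by simp [hσ0, Real.pi_ne_zero]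
  have hC : ∀ w : ℂ, w.im = 0 → tube γ w ∈ frontier Ω := fun w h0 => by
    have : w = (w.re : ℂ) := by apply Complex.ext <;> simp [h0]
    rw [this, IsJordanLoop.tube_ofReal]
    exact hγ.mem _
  -- the side with zero winding number meets `Ω`
  set Aout : Set ℂ := tube γ '' {w | -η < σ * w.im ∧ σ * w.im < 0} with hAout
  set Ain : Set ℂ := tube γ '' {w | 0 < σ * w.im ∧ σ * w.im < η} with hAin
  have habs : ∀ w : ℂ, |σ * w.im| = |w.im| := fun w => by
    rcases hσ with rfl | rfl <;> simp
  have hpre : ∀ a b : ℝ, IsPreconnected (tube γ '' {w | a < σ * w.im ∧ σ * w.im < b}) := by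
    intro a b
    rcases hσ with rfl | rfl
    · simpa using hγ.isPreconnected_side a b
    · have := hγ.isPreconnected_side (-b) (-a)
      convert this using 2
      ext w
      simp only [mem_ofPred_eq, neg_mul, one_mul]
      constructor <;> rintro ⟨h1, h2⟩ <;> constructor <;> linarith
  have hout0 : ∀ x ∈ Aout, x ∉ frontier Ω ∧ windInt γ x = 0 := by
    rintro _ ⟨w, hw', rfl⟩
    refine ⟨hη w ?_ ?_, (hw w).2 hw'⟩
    · rw [← habs, abs_of_neg hw'.2]; linarith [hw'.1]
    · rintro h0; simp [h0] at hw'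
  have hin0 : ∀ x ∈ Ain, x ∉ frontier Ω ∧ windInt γ x = σ * (2 * Real.pi * Complex.I) := by
    rintro _ ⟨w, hw', rfl⟩
    refine ⟨hη w ?_ ?_, (hw w).1 hw'⟩
    · rw [← habs, abs_of_pos hw'.1]; exact hw'.2
    · rintro h0; simp [h0] at hw'
  have hinD : Ain ⊆ (closure Ω)ᶜ := by
    intro x hx hxc
    have hxΩ : x ∈ Ω := by
      by_contra hxΩ
      refine (hin0 x hx).1 ?_
      rw [h.isOpen.frontier_eq]
      exact ⟨hxc, hxΩ⟩
    have := (hin0 x hx).2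
    rw [h.windInt_eq_zero hxΩ] at this
    exact hpi this.symm
  have houtΩ : Aout ⊆ Ω := by
    refine subset_of_isPreconnected_of_disjoint_frontier h.isOpen (hpre _ _)
      (Set.disjoint_left.2 fun x hx => (hout0 x hx).1) ?_
    have hx : γ 0 ∈ closure Ω := frontier_subset_closure (hγ.mem 0)
    have hnh : tube γ '' {w | |w.im| < η} ∈ 𝓝 (γ 0) := by
      rw [← hγ.map_nhds_tube 0]
      refine image_mem_map ?_
      refine (isOpen_lt (by fun_prop : Continuous fun w : ℂ => |w.im|) continuous_const).mem_nhds ?_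
      simpa using hη0
    obtain ⟨y, ⟨w, hw', rfl⟩, hyΩ⟩ := mem_closure_iff_nhds.1 hx _ hnh
    have hw'' := abs_lt.1 (show |σ * w.im| < η from (habs w).symm ▸ hw')
    refine ⟨_, mem_image_of_mem _ ⟨hw''.1, ?_⟩, hyΩ⟩
    by_contra hge
    rcases (not_lt.1 hge).eq_or_lt with h0 | h0
    · refine h.notMem_of_mem_frontier (hC w ?_) hyΩ
      rcases mul_eq_zero.1 h0.symm with h1 | h1
      · exact absurd h1 hσ0
      · exact h1
    · exact hinD (mem_image_of_mem _ ⟨h0, hw''.2⟩) (subset_closure hyΩ)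
  have hDC : (closure Ω)ᶜ ⊆ (frontier Ω)ᶜ := compl_subset_compl.2 frontier_subset_closure
  set y₀ : ℂ := tube γ ((σ * (η / 2) : ℝ) * Complex.I) with hy₀
  have hσσ : ∀ x : ℝ, σ * (σ * x) = x := fun x => by
    rcases hσ with rfl | rfl <;> ring
  have hy₀in : y₀ ∈ Ain := by
    refine mem_image_of_mem _ ?_
    simp only [mem_ofPred_eq, Complex.mul_I_im, Complex.ofReal_re, hσσ]
    constructor <;> linarith
  -- The component of a point outside the closure of Ω contains one side of the curve. It cannot be
  -- the outer side, which lies in Ω, since the component would then be contained in Ω.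
  have hcomp : ∀ z ∈ (closure Ω)ᶜ, Ain ⊆ connectedComponentIn (frontier Ω)ᶜ z := by
    intro z hz
    have hside : Ain ⊆ connectedComponentIn (frontier Ω)ᶜ z ∨
        Aout ⊆ connectedComponentIn (frontier Ω)ᶜ z := by
      have := hγ.exists_side_subset hη0 hη (hDC hz)
      rcases hσ with rfl | rfl
      · simpa [hAin, hAout] using this
      · have e1 : Ain = tube γ '' {w | -η < w.im ∧ w.im < 0} := by
          rw [hAin]; congr 1; ext w; simp only [mem_ofPred_eq]
          constructor <;> rintro ⟨h1, h2⟩ <;> constructor <;> linarith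
        have e2 : Aout = tube γ '' {w | 0 < w.im ∧ w.im < η} := by
          rw [hAout]; congr 1; ext w; simp only [mem_ofPred_eq]
          constructor <;> rintro ⟨h1, h2⟩ <;> constructor <;> linarith
        rw [e1, e2]
        exact this.symm
    refine hside.resolve_right fun hs => ?_
    have hVΩ : connectedComponentIn (frontier Ω)ᶜ z ⊆ Ω := by
      refine subset_of_isPreconnected_of_disjoint_frontier h.isOpen
        isPreconnected_connectedComponentIn (Set.disjoint_left.2 fun x hx hxC =>
          connectedComponentIn_subset _ _ hx hxC) ?_
      have hmem : tube γ ((-(σ * (η / 2)) : ℝ) * Complex.I) ∈ Aout := by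
        refine mem_image_of_mem _ ?_
        simp only [mem_ofPred_eq, Complex.mul_I_im, Complex.ofReal_re, mul_neg, hσσ]
        constructor <;> linarith
      exact ⟨_, hs hmem, houtΩ hmem⟩
    exact hz (subset_closure (hVΩ (mem_connectedComponentIn (hDC hz))))
  -- All these components share the inner side, so they coincide.
  have hDeq : (closure Ω)ᶜ = connectedComponentIn (frontier Ω)ᶜ y₀ := by
    refine Subset.antisymm (fun z hz => ?_) fun z hz hzc => ?_
    · rw [← connectedComponentIn_eq (hcomp z hz hy₀in)]
      exact mem_connectedComponentIn (hDC hz)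
    · have hzΩ : z ∈ Ω := by
        by_contra hzΩ
        refine connectedComponentIn_subset _ _ hz ?_
        rw [h.isOpen.frontier_eq]
        exact ⟨hzc, hzΩ⟩
      have hsub : connectedComponentIn (frontier Ω)ᶜ y₀ ⊆ Ω :=
        subset_of_isPreconnected_of_disjoint_frontier h.isOpen
          isPreconnected_connectedComponentIn (Set.disjoint_left.2 fun x hx hxC =>
            connectedComponentIn_subset _ _ hx hxC) ⟨z, hz, hzΩ⟩
      exact hinD hy₀in (subset_closure (hsub (mem_connectedComponentIn (hDC (hinD hy₀in)))))
  have hDpre : IsPreconnected (closure Ω)ᶜ := by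
    rw [hDeq]; exact isPreconnected_connectedComponentIn
  refine ⟨hDpre, σ, hσ, fun z hz => ?_, η, hη0, fun t s hs0 hsη => ⟨hinD (mem_image_of_mem _ ?_),
    houtΩ (mem_image_of_mem _ ?_)⟩⟩
  · rw [hγ.windInt_eq_of_isPreconnected hDpre
      (Set.disjoint_left.2 fun x hx hxC => hDC hx hxC) hz (hinD hy₀in)]
    exact (hin0 _ hy₀in).2
  · simp only [mem_ofPred_eq, Complex.add_im, Complex.ofReal_im, Complex.mul_I_im,
      Complex.ofReal_re, zero_add, hσσ]
    exact ⟨hs0, hsη⟩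
  · simp only [mem_ofPred_eq, Complex.add_im, Complex.ofReal_im, Complex.mul_I_im,
      Complex.ofReal_re, zero_add, mul_neg, hσσ]
    constructor <;> linarith

end IsJordanExterior

/-! ### The Cauchy transform of a disc and the signed area -/

theorem circleAverage_sub_inv_of_lt {w : ℂ} {r : ℝ} (hr : 0 < r) (hrw : r < ‖w‖) :
    Real.circleAverage (fun z => (w - z)⁻¹) 0 r = w⁻¹ := by
  have hd : DiffContOnCl ℂ (fun z => (w - z)⁻¹) (ball 0 |r|) := by
    refine DifferentiableOn.diffContOnCl fun z hz => ?_
    refine (DifferentiableAt.inv (by fun_prop) fun h0 => ?_).differentiableWithinAt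
    have hz' := closure_ball_subset_closedBall hz
    rw [mem_closedBall, dist_zero_right, abs_of_pos hr, ← sub_eq_zero.1 h0] at hz'
    linarith
  simpa using hd.circleAverage

/-- By partial fractions 1/(z(w − z)) = w⁻¹(1/z − 1/(z − w)), whose two residues cancel; for w = 0
the integrand is −z⁻², which has no residue. -/
theorem circleAverage_sub_inv_of_gt {w : ℂ} {r : ℝ} (hrw : ‖w‖ < r) :
    Real.circleAverage (fun z => (w - z)⁻¹) 0 r = 0 := by
  have hr : 0 < r := (norm_nonneg w).trans_lt hrw
  rw [Real.circleAverage_eq_circleIntegral hr.ne']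
  have : (∮ z in C(0, r), (z - 0)⁻¹ • (w - z)⁻¹) = 0 := by
    rcases eq_or_ne w 0 with rfl | hw
    · have h1 : (∮ z in C(0, r), (z - 0)⁻¹ • ((0 : ℂ) - z)⁻¹) =
          ∮ z in C(0, r), (-1 : ℂ) • (z - 0) ^ (-2 : ℤ) := by
        refine circleIntegral.integral_congr hr.le fun z hz => ?_
        have hz0 : z ≠ 0 := by
          rintro rfl
          simp at hz
          linarith
        simp only [smul_eq_mul, sub_zero, zero_sub, zpow_neg]
        field_simp
      rw [h1, circleIntegral.integral_smul, circleIntegral.integral_sub_zpow_of_ne (by norm_num),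
        smul_zero]
    · have h1 : (∮ z in C(0, r), (z - 0)⁻¹ • (w - z)⁻¹) =
          ∮ z in C(0, r), w⁻¹ • ((z - 0)⁻¹ - (z - w)⁻¹) := by
        refine circleIntegral.integral_congr hr.le fun z hz => ?_
        have hzr : ‖z‖ = r := by simpa using hz
        have hz0 : z ≠ 0 := by
          rintro rfl
          simp at hzr
          linarith
        have hzw : w - z ≠ 0 := fun h0 => by
          rw [sub_eq_zero.1 h0] at hrw
          linarith
        have hzw' : z - w ≠ 0 := sub_ne_zero.2 (sub_ne_zero.1 hzw).symm
        simp only [smul_eq_mul, sub_zero]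
        field_simp
        ring
      have hci : ∀ x : ℂ, ‖x‖ < r → CircleIntegrable (fun z => (z - x)⁻¹) 0 r := fun x hx => by
        rw [circleIntegrable_sub_inv_iff]
        right
        simp [abs_of_pos hr, hx.ne]
      rw [h1, circleIntegral.integral_smul, circleIntegral.integral_sub
        (hci 0 (by simpa using hr)) (hci w hrw),
        circleIntegral.integral_sub_inv_of_mem_ball (by simpa using hr),
        circleIntegral.integral_sub_inv_of_mem_ball (by simpa using hrw), sub_self, smul_zero]
  rw [this, smul_zero]

theorem integrableOn_inv_norm_ball (R : ℝ) :
    IntegrableOn (fun z : ℂ => ‖z‖⁻¹) (ball 0 R) := by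
  refine integrableOn_ball_of_norm_le_rpow (C := 1) (α := 1) (by simp) (by simp) ?_ ?_
  · refine ae_of_all _ fun z => ?_
    simp [Real.rpow_neg_one]
  · exact (measurable_norm.inv).aestronglyMeasurable

theorem integrableOn_sub_inv_ball (w : ℂ) (R : ℝ) :
    IntegrableOn (fun z : ℂ => (w - z)⁻¹) (ball 0 R) := by
  have h1 := (integrableOn_inv_norm_ball (‖w‖ + R))
  have h2 : IntegrableOn (fun z : ℂ => ‖w - z‖⁻¹) (ball w (‖w‖ + R)) := by
    have := (Measure.measurePreserving_sub_left (volume : Measure ℂ) w).integrableOn_comp_preimage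
      (Homeomorph.subLeft w).measurableEmbedding (f := fun z : ℂ => ‖z‖⁻¹) (s := ball 0 (‖w‖ + R))
    have h3 := this.2 h1
    convert h3 using 1
    · ext z
      simp
    · ext z
      simp [dist_eq_norm, norm_sub_rev]
  have hsub : ball (0 : ℂ) R ⊆ ball w (‖w‖ + R) := fun z hz => by
    rw [mem_ball, dist_zero_right] at hz
    rw [mem_ball, dist_eq_norm]
    linarith [norm_sub_le z w]
  have hm : Measurable fun z : ℂ => (w - z)⁻¹ := (measurable_const.sub measurable_id).inv
  refine (integrable_norm_iff hm.aestronglyMeasurable).1 ?_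
  have h4 : Integrable (fun z : ℂ => ‖w - z‖⁻¹) (volume.restrict (ball 0 R)) := h2.mono_set hsub
  simpa using h4

/-- The Cauchy transform of a disc. -/
theorem integral_ball_sub_inv {w : ℂ} {R : ℝ} (hw : ‖w‖ < R) :
    ∫ z in ball (0 : ℂ) R, (w - z)⁻¹ = Real.pi * (starRingEnd ℂ) w := by
  set f : ℂ → ℂ := (ball (0 : ℂ) R).indicator fun z => (w - z)⁻¹ with hf
  have hfm : Measurable f :=
    ((measurable_const.sub measurable_id).inv).indicator measurableSet_ball
  have hfi : Integrable f := (integrable_indicator_iff measurableSet_ball).2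
    (integrableOn_sub_inv_ball w R)
  have hpm : Measurable fun p : ℝ × ℝ => Complex.polarCoord.symm p := by
    simp only [Complex.polarCoord_symm_apply]
    fun_prop
  have htarget : polarCoord.target = Ioi (0 : ℝ) ×ˢ Ioo (-Real.pi) Real.pi := rfl
  have hpi : IntegrableOn (fun p : ℝ × ℝ => p.1 • f (Complex.polarCoord.symm p))
      (Ioi (0 : ℝ) ×ˢ Ioo (-Real.pi) Real.pi) (volume.prod volume) := by
    refine ⟨(measurable_fst.smul (hfm.comp hpm)).aestronglyMeasurable, ?_⟩
    have h1 := Complex.lintegral_comp_polarCoord_symm (fun z => ‖f z‖ₑ)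
    have h2 : ∫⁻ p in Ioi (0 : ℝ) ×ˢ Ioo (-Real.pi) Real.pi,
        ‖p.1 • f (Complex.polarCoord.symm p)‖ₑ =
        ∫⁻ p in polarCoord.target, ENNReal.ofReal p.1 • ‖f (Complex.polarCoord.symm p)‖ₑ := by
      rw [htarget]
      refine setLIntegral_congr_fun (measurableSet_Ioi.prod measurableSet_Ioo) fun p hp => ?_
      simp only [enorm_smul, smul_eq_mul]
      rw [Real.enorm_eq_ofReal (le_of_lt hp.1)]
    rw [HasFiniteIntegral]
    change ∫⁻ p in Ioi (0 : ℝ) ×ˢ Ioo (-Real.pi) Real.pi,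
        ‖p.1 • f (Complex.polarCoord.symm p)‖ₑ < _
    rw [h2, h1]
    exact hfi.2
  have hinner : ∀ r : ℝ, 0 < r → r < R → ∫ θ in Ioo (-Real.pi) Real.pi,
      r • f (Complex.polarCoord.symm (r, θ)) =
        (r * (2 * Real.pi)) • Real.circleAverage (fun z => (w - z)⁻¹) 0 r := by
    intro r hr hrR
    rw [integral_smul, ← integral_Ioc_eq_integral_Ioo,
      ← intervalIntegral.integral_of_le (by linarith [Real.pi_pos])]
    have h1 : ∫ θ in (-Real.pi)..Real.pi, f (Complex.polarCoord.symm (r, θ)) =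
        ∫ θ in (-Real.pi)..Real.pi, (w - circleMap 0 r θ)⁻¹ := by
      refine intervalIntegral.integral_congr fun θ _ => ?_
      have h2 : Complex.polarCoord.symm (r, θ) = circleMap 0 r θ := by
        rw [Complex.polarCoord_symm_apply, circleMap, Complex.exp_mul_I]
        simp
      simp only [h2]
      rw [hf, indicator_of_mem]
      simpa [abs_of_pos hr] using hrR
    have hper : Function.Periodic (fun θ => (w - circleMap 0 r θ)⁻¹) (2 * Real.pi) := fun θ => by
      simp only [periodic_circleMap 0 r θ]
    have h3 := hper.intervalIntegral_add_eq (-Real.pi) 0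
    rw [show -Real.pi + 2 * Real.pi = Real.pi by ring, zero_add] at h3
    rw [h1, h3, Real.circleAverage, smul_smul, mul_assoc r, mul_inv_cancel₀ (by positivity), mul_one]
  have hzero : ∀ r : ℝ, 0 < r → R ≤ r → ∫ θ in Ioo (-Real.pi) Real.pi,
      r • f (Complex.polarCoord.symm (r, θ)) = 0 := by
    intro r hr hrR
    refine integral_eq_zero_of_ae (ae_of_all _ fun θ => ?_)
    simp only [Pi.zero_apply]
    rw [hf, indicator_of_notMem, smul_zero]
    rw [mem_ball, dist_zero_right, Complex.norm_polarCoord_symm, abs_of_pos hr]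
    exact not_lt.2 hrR
  rw [← integral_indicator measurableSet_ball, ← hf, ← Complex.integral_comp_polarCoord_symm,
    htarget]
  change ∫ p in Ioi (0 : ℝ) ×ˢ Ioo (-Real.pi) Real.pi, _ ∂(volume.prod volume) = _
  rw [setIntegral_prod _ hpi]
  -- Only circles of radius r < |w| contribute, each giving 2πr/w. Integration from 0 to |w| yields
  -- π|w|²/w, the conjugate of w times π.
  have hae : ∀ᵐ r ∂(volume.restrict (Ioi (0 : ℝ))), ∫ θ in Ioo (-Real.pi) Real.pi,
      r • f (Complex.polarCoord.symm (r, θ)) =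
        (Ioc 0 ‖w‖).indicator (fun r : ℝ => (r : ℂ) * (2 * Real.pi * w⁻¹)) r := by
    have hne : ∀ᵐ r ∂(volume : Measure ℝ), r ≠ ‖w‖ := by
      rw [ae_iff]; simp
    filter_upwards [ae_restrict_mem measurableSet_Ioi, ae_restrict_of_ae hne] with r hr hrw
    rcases lt_or_ge r R with hrR | hrR
    · rw [hinner r hr hrR]
      rcases lt_or_gt_of_ne hrw with h1 | h1
      · rw [circleAverage_sub_inv_of_lt hr h1, indicator_of_mem (show r ∈ Ioc 0 ‖w‖ from ⟨hr, h1.le⟩)]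
        rw [Complex.real_smul]
        push_cast
        ring
      · rw [circleAverage_sub_inv_of_gt h1, indicator_of_notMem (fun h => not_lt.2 h.2 h1), smul_zero]
    · rw [hzero r hr hrR, indicator_of_notMem fun h => absurd (h.2.trans_lt hw) (not_lt.2 hrR)]
  rw [integral_congr_ae hae, integral_indicator measurableSet_Ioc,
    Measure.restrict_restrict measurableSet_Ioc, inter_eq_left.2 (fun r hr => hr.1),
    ← intervalIntegral.integral_of_le (norm_nonneg w), intervalIntegral.integral_mul_const,
    intervalIntegral.integral_ofReal, integral_id]
  rcases eq_or_ne w 0 with rfl | hw0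
  · simp
  · have := Complex.mul_conj' w
    push_cast
    field_simp
    linear_combination -this

namespace IsJordanLoop

variable {γ : ℝ → ℂ} {C : Set ℂ}

/-- The curve is the image of the plane under z ↦ γ (Re z), whose differential is everywhere
singular. -/
theorem volume_eq_zero (h : IsJordanLoop γ C) : volume C = 0 := by
  have hd : ∀ z ∈ (univ : Set ℂ), HasFDerivWithinAt (fun z : ℂ => γ z.re)
      (Complex.reCLM.smulRight (deriv γ z.re)) univ z := fun z _ => by
    have := HasFDerivAt.comp (g := γ) z (h.hasDerivAt z.re).hasFDerivAt
      (Complex.reCLM.hasFDerivAt (x := z))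
    refine (this.congr_fderiv ?_).hasFDerivWithinAt
    ext
    simp
  have h0 := addHaar_image_eq_zero_of_det_fderivWithin_eq_zero (μ := volume) hd fun z _ => by
    rw [ContinuousLinearMap.det]
    by_contra hne
    have hinj := (LinearMap.equivOfDetNeZero _ hne).injective
    have h1 : LinearMap.equivOfDetNeZero _ hne Complex.I = 0 := by simp
    have h2 := hinj (h1.trans (map_zero _).symm)
    exact Complex.I_ne_zero h2
  have : (fun z : ℂ => γ z.re) '' univ = C := by
    rw [image_univ, ← h.range_eq]
    ext x
    constructor
    · rintro ⟨z, rfl⟩; exact mem_range_self _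
    · rintro ⟨t, rfl⟩; exact ⟨t, by simp⟩
  rwa [this] at h0

/-- Fubini applied to γ'(t)/(γ(t) − z), followed by the Cauchy transform of the disc. It plays the
role of Green's theorem: it ties the area where the winding number is nonzero to the line integral.
-/
theorem integral_conj_mul_deriv (h : IsJordanLoop γ C) {R : ℝ} (hR : ∀ z ∈ C, ‖z‖ < R) :
    ∫ z in ball (0 : ℂ) R, windInt γ z =
      Real.pi * ∫ t in (0 : ℝ)..1, (starRingEnd ℂ) (γ t) * deriv γ t := by
  obtain ⟨M, hM⟩ := (isCompact_Icc (a := (0 : ℝ)) (b := 1)).exists_bound_of_continuousOn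
    h.continuous_deriv.continuousOn
  set A : ℝ := ∫ z in ball (0 : ℂ) (2 * R), ‖z‖⁻¹ with hA
  have hbound : ∀ w : ℂ, ‖w‖ < R → ∫ z in ball (0 : ℂ) R, ‖(w - z)⁻¹‖ ≤ A := by
    intro w hw
    have hpre := (Measure.measurePreserving_sub_left (volume : Measure ℂ) w).setIntegral_preimage_emb
      (Homeomorph.subLeft w).measurableEmbedding (fun z : ℂ => ‖z‖⁻¹) (ball 0 (2 * R))
    rw [hA, ← hpre]
    simp only [norm_inv]
    refine setIntegral_mono_set ?_ (ae_of_all _ fun z => by positivity)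
      (Eventually.of_forall (p := fun z => z ∈ ball (0 : ℂ) R → z ∈ (fun z => w - z) ⁻¹' ball 0 (2 * R)) fun z hz => ?_)
    · exact ((Measure.measurePreserving_sub_left (volume : Measure ℂ) w).integrableOn_comp_preimage
        (Homeomorph.subLeft w).measurableEmbedding (f := fun z : ℂ => ‖z‖⁻¹)).2
        (integrableOn_inv_norm_ball (2 * R))
    · rw [mem_ball, dist_zero_right] at hz
      rw [mem_preimage, mem_ball, dist_zero_right]
      linarith [norm_sub_le w z]
  have hintg : Integrable (fun p : ℝ × ℂ => deriv γ p.1 / (γ p.1 - p.2))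
      ((volume.restrict (Ioc (0 : ℝ) 1)).prod (volume.restrict (ball (0 : ℂ) R))) := by
    have hm : Measurable fun p : ℝ × ℂ => deriv γ p.1 / (γ p.1 - p.2) :=
      (h.continuous_deriv.measurable.comp measurable_fst).div
        ((h.continuous.measurable.comp measurable_fst).sub measurable_snd)
    refine (integrable_prod_iff hm.aestronglyMeasurable).2 ⟨ae_of_all _ fun t => ?_, ?_⟩
    · simp only [div_eq_mul_inv]
      exact (integrableOn_sub_inv_ball (γ t) R).const_mul _
    · refine Integrable.mono' (g := fun _ => M * A) (integrable_const _)
        hm.norm.aestronglyMeasurable.integral_prod_right' ?_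
      filter_upwards [ae_restrict_mem measurableSet_Ioc] with t ht
      rw [Real.norm_of_nonneg (integral_nonneg fun z => norm_nonneg _)]
      have h1 : ∫ z in ball (0 : ℂ) R, ‖deriv γ t / (γ t - z)‖ =
          ‖deriv γ t‖ * ∫ z in ball (0 : ℂ) R, ‖(γ t - z)⁻¹‖ := by
        rw [← integral_const_mul]
        simp only [div_eq_mul_inv, norm_mul]
      rw [h1]
      have h2 := hM t ⟨ht.1.le, ht.2⟩
      have h3 := hbound (γ t) (hR _ (h.mem t))
      have h4 : 0 ≤ ∫ z in ball (0 : ℂ) R, ‖(γ t - z)⁻¹‖ := integral_nonneg fun z => norm_nonneg _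
      exact mul_le_mul h2 h3 h4 ((norm_nonneg _).trans h2)
  have hswap := integral_integral_swap (f := fun t z => deriv γ t / (γ t - z)) hintg
  have h1 : ∫ z in ball (0 : ℂ) R, windInt γ z =
      ∫ z in ball (0 : ℂ) R, ∫ t in Ioc (0 : ℝ) 1, deriv γ t / (γ t - z) := by
    simp only [windInt, intervalIntegral.integral_of_le zero_le_one]
  rw [h1, ← hswap, intervalIntegral.integral_of_le zero_le_one, ← integral_const_mul]
  refine setIntegral_congr_fun measurableSet_Ioc fun t _ => ?_
  simp only [div_eq_mul_inv]
  rw [integral_const_mul, integral_ball_sub_inv (hR _ (h.mem t))]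
  ring

/-- The signed area of a smooth Jordan curve does not vanish. -/
theorem signedArea_ne_zero (h : IsJordanLoop γ C) :
    ∫ t in (0 : ℝ)..1, ((γ t).re * (deriv γ t).im - (γ t).im * (deriv γ t).re) ≠ 0 := by
  obtain ⟨σ, hσ, hval, z₀, hz₀C, hz₀⟩ := h.exists_windInt_values
  have hσ0 : σ ≠ 0 := by rcases hσ with rfl | rfl <;> norm_num
  obtain ⟨R₀, hR₀⟩ := h.isCompact.isBounded.exists_norm_le
  set R := max R₀ ‖z₀‖ + 1 with hR
  have hRC : ∀ z ∈ C, ‖z‖ < R := fun z hz => by linarith [hR₀ z hz, le_max_left R₀ ‖z₀‖]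
  have hz₀R : z₀ ∈ ball (0 : ℂ) R := by
    rw [mem_ball, dist_zero_right]; linarith [le_max_right R₀ ‖z₀‖]
  -- Almost everywhere the winding integral is 2πiσ times the indicator of the open set V below, so
  -- the imaginary part of this identity equates 2πσ times a positive area with π ∮ (x dy − y dx).
  have hmain := h.integral_conj_mul_deriv hRC
  have hCo : IsOpen Cᶜ := h.isCompact.isClosed.isOpen_compl
  set V : Set ℂ := Cᶜ ∩ windInt γ ⁻¹' {0}ᶜ with hV
  have hVo : IsOpen V := h.continuousOn_windInt.isOpen_inter_preimage hCo isOpen_compl_singleton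
  have hwind : ∫ z in ball (0 : ℂ) R, windInt γ z =
      (volume.real (V ∩ ball 0 R) : ℂ) * (σ * (2 * Real.pi * Complex.I)) := by
    have h1 : ∀ᵐ z ∂(volume.restrict (ball (0 : ℂ) R)), windInt γ z =
        V.indicator (fun _ => (σ * (2 * Real.pi * Complex.I) : ℂ)) z := by
      have hCae : ∀ᵐ z ∂(volume : Measure ℂ), z ∉ C := by
        rw [ae_iff]; simpa using h.volume_eq_zero
      filter_upwards [ae_restrict_of_ae hCae] with z hz
      rcases hval z hz with h0 | h0
      · rw [h0, indicator_of_notMem]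
        exact fun hzV => hzV.2 h0
      · rw [indicator_of_mem, h0]
        refine ⟨hz, ?_⟩
        rw [mem_preimage, h0]
        simp [hσ0, Real.pi_ne_zero]
    rw [integral_congr_ae h1, integral_indicator hVo.measurableSet,
      Measure.restrict_restrict hVo.measurableSet, setIntegral_const, Complex.real_smul]
  have hvol : 0 < volume.real (V ∩ ball 0 R) := by
    refine ENNReal.toReal_pos ?_ ?_
    · refine ((hVo.inter isOpen_ball).measure_pos volume ⟨z₀, ⟨hz₀C, hz₀⟩, hz₀R⟩).ne'
    · exact ((measure_mono inter_subset_right).trans_lt measure_ball_lt_top).ne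
  have hintg : IntervalIntegrable (fun t => (starRingEnd ℂ) (γ t) * deriv γ t) volume 0 1 :=
    ((Complex.continuous_conj.comp h.continuous).mul h.continuous_deriv).intervalIntegrable _ _
  have him : (∫ t in (0 : ℝ)..1, (starRingEnd ℂ) (γ t) * deriv γ t).im =
      ∫ t in (0 : ℝ)..1, ((γ t).re * (deriv γ t).im - (γ t).im * (deriv γ t).re) := by
    have := Complex.imCLM.intervalIntegral_comp_comm hintg
    simp only [Complex.imCLM_apply] at this
    rw [← this]
    refine intervalIntegral.integral_congr fun t _ => ?_
    simp
    ring
  intro h0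
  rw [← him] at h0
  rw [hwind] at hmain
  have := congrArg Complex.im hmain
  rw [Complex.im_ofReal_mul Real.pi, h0, mul_zero, Complex.im_ofReal_mul, Complex.im_ofReal_mul]
    at this
  simp [hvol.ne', hσ0, Real.pi_ne_zero] at this

end IsJordanLoop

/-! ### Collars and discs touching the boundary -/

/-- The open set `W` contains a one-sided collar of the curve `γ`, on the left for `τ = 1` and on
the right for `τ = -1`. -/
def HasCollar (γ : ℝ → ℂ) (W : Set ℂ) (τ : ℝ) : Prop :=
  (τ = 1 ∨ τ = -1) ∧ ∃ η > 0, ∀ t s : ℝ, 0 < s → s < η →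
    tube γ (t + (τ * s : ℝ) * Complex.I) ∈ W

namespace IsJordanLoop

variable {γ : ℝ → ℂ} {C : Set ℂ}

theorem comp_neg (h : IsJordanLoop γ C) : IsJordanLoop (fun t => γ (-t)) C where
  smooth := h.smooth.comp contDiff_neg
  periodic t := by
    have := h.periodic (-(t + 1))
    rw [neg_add, neg_add_cancel_right, ← neg_add] at this
    exact this.symm
  injOn x hx y hy hxy := by
    obtain ⟨n, hn⟩ := h.exists_int_of_eq hxy
    have h1 : (n : ℝ) < 1 := by linarith [hx.1, hy.2]
    have h2 : (-1 : ℝ) < n := by linarith [hx.2, hy.1]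
    have h3 : n < 1 := by exact_mod_cast h1
    have h4 : -1 < n := by exact_mod_cast h2
    have h5 : n = 0 := by omega
    rw [h5] at hn
    simp at hn
    exact hn
  regular t := by
    rw [deriv_comp_neg]
    exact neg_ne_zero.2 (h.regular _)
  range_eq := by
    rw [← h.range_eq]
    ext z
    constructor
    · rintro ⟨t, rfl⟩; exact ⟨-t, rfl⟩
    · rintro ⟨t, rfl⟩; exact ⟨-t, by simp⟩

/-- Up to reversal, a parametrization of a smooth Jordan curve is counterclockwise. -/
theorem exists_isJordanParam (h : IsJordanLoop γ C) : ∃ γ₁, IsJordanParam γ₁ C := by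
  rcases lt_or_gt_of_ne h.signedArea_ne_zero with h0 | h0
  · have h' := h.comp_neg
    refine ⟨_, ⟨h'.smooth, h'.periodic, h'.injOn, h'.regular, h'.range_eq, ?_⟩⟩
    simp only [deriv_comp_neg]
    set u : ℝ → ℝ := fun t => (γ t).re * (deriv γ t).im - (γ t).im * (deriv γ t).re with hu
    have hper : Function.Periodic u 1 := fun t => by
      simp only [hu, h.periodic t, h.periodic_deriv t]
    have h1 : ∫ t in (0 : ℝ)..1, ((γ (-t)).re * (-deriv γ (-t)).im -
        (γ (-t)).im * (-deriv γ (-t)).re) = ∫ t in (0 : ℝ)..1, -u (-t) := by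
      refine intervalIntegral.integral_congr fun t _ => ?_
      simp only [hu, Complex.neg_re, Complex.neg_im]
      ring
    rw [h1, intervalIntegral.integral_neg, intervalIntegral.integral_comp_neg]
    have h2 := hper.intervalIntegral_add_eq (-1) 0
    rw [neg_add_cancel, zero_add] at h2
    rw [neg_zero, h2]
    linarith
  · exact ⟨γ, ⟨h.smooth, h.periodic, h.injOn, h.regular, h.range_eq, by linarith⟩⟩

/-- Taylor's bound: γ' is differentiable at t₀, so γ' − γ'(t₀) is O(|t − t₀|), and the mean value
inequality adds one power. -/
theorem exists_norm_sub_sub_le (h : IsJordanLoop γ C) (t₀ : ℝ) :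
    ∃ M > 0, ∀ᶠ t in 𝓝 t₀, ‖γ t - γ t₀ - (t - t₀) * deriv γ t₀‖ ≤ M * (t - t₀) ^ 2 := by
  obtain ⟨M, hM0, hM⟩ := (h.hasDerivAt_deriv t₀).differentiableAt.isBigO_sub.exists_pos
  refine ⟨M, hM0, ?_⟩
  obtain ⟨δ, hδ, hball⟩ := Metric.eventually_nhds_iff_ball.1 hM.bound
  filter_upwards [Metric.ball_mem_nhds t₀ hδ] with t ht
  have hsub : closedBall t₀ |t - t₀| ⊆ ball t₀ δ := closedBall_subset_ball ht
  have hd : ∀ x ∈ closedBall t₀ |t - t₀|, HasDerivWithinAt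
      (fun x : ℝ => γ x - x * deriv γ t₀) (deriv γ x - deriv γ t₀) (closedBall t₀ |t - t₀|) x :=
    fun x _ => (((h.hasDerivAt x).sub
      ((Complex.ofRealCLM.hasDerivAt (x := x)).mul_const (deriv γ t₀))).congr_deriv
        (by simp)).hasDerivWithinAt
  have hb : ∀ x ∈ closedBall t₀ |t - t₀|, ‖deriv γ x - deriv γ t₀‖ ≤ M * |t - t₀| := fun x hx => by
    refine (hball x (hsub hx)).trans ?_
    have : ‖x - t₀‖ ≤ |t - t₀| := by simpa [dist_eq_norm] using hx
    gcongr
  have := (convex_closedBall t₀ |t - t₀|).norm_image_sub_le_of_norm_hasDerivWithin_le hd hb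
    (x := t₀) (y := t) (by simp) (by simp [Real.dist_eq])
  rw [Real.norm_eq_abs, mul_assoc, ← sq, sq_abs] at this
  refine le_trans (le_of_eq ?_) this
  congr 1
  ring

/-- The interior ball condition: a set with a collar of `γ` contains the small discs which touch
the curve on that side. -/
theorem eventually_ball_subset (h : IsJordanLoop γ C) {W : Set ℂ} {τ : ℝ} (hW : HasCollar γ W τ)
    (t₀ : ℝ) : ∃ ν : ℂ, ‖ν‖ = 1 ∧ ∀ᶠ R : ℝ in 𝓝[>] 0, ball (γ t₀ + R * ν) R ⊆ W := by
  obtain ⟨hτ, η, hη, hcol⟩ := hW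
  have hτ2 : τ * τ = 1 := by rcases hτ with rfl | rfl <;> norm_num
  set v := deriv γ t₀ with hv
  have hv0 : 0 < ‖v‖ := norm_pos_iff.2 (h.regular t₀)
  -- The unit normal at γ t₀ on the side of the collar.
  set ν : ℂ := τ * Complex.I * v / ‖v‖ with hν
  have hτn : |τ| = 1 := by rcases hτ with rfl | rfl <;> norm_num
  have hν1 : ‖ν‖ = 1 := by
    rw [hν, norm_div, norm_mul, norm_mul, Complex.norm_I, Complex.norm_real, Complex.norm_real,
      Real.norm_eq_abs, Real.norm_eq_abs, hτn, abs_of_pos hv0]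
    field_simp
  refine ⟨ν, hν1, ?_⟩
  obtain ⟨M, hM0, hM⟩ := h.exists_norm_sub_sub_le t₀
  obtain ⟨e, he⟩ := h.exists_equiv_tube t₀
  obtain ⟨K, hK0, hK⟩ : ∃ K > 0, ∀ᶠ w : ℂ in 𝓝 (t₀ : ℂ), ‖w - t₀‖ ≤ K * ‖tube γ w - γ t₀‖ := by
    have := (HasFDerivAt.isTheta_sub he.hasFDerivAt e.toHomeomorph.isInducing).2
    obtain ⟨K, hK0, hK⟩ := this.exists_pos
    refine ⟨K, hK0, ?_⟩
    simpa [tube_ofReal] using hK.bound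
  have hre : Tendsto Complex.re (𝓝 (t₀ : ℂ)) (𝓝 t₀) :=
    (Complex.continuous_re.tendsto (t₀ : ℂ)).trans (by simp)
  have him : Tendsto Complex.im (𝓝 (t₀ : ℂ)) (𝓝 0) :=
    (Complex.continuous_im.tendsto (t₀ : ℂ)).trans (by simp)
  have hpos : ∀ᶠ t in 𝓝 t₀, 0 < (deriv γ t * (starRingEnd ℂ) v).re := by
    have hc : ContinuousAt (fun t => (deriv γ t * (starRingEnd ℂ) v).re) t₀ :=
      (Complex.continuous_re.comp (h.continuous_deriv.mul continuous_const)).continuousAt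
    refine hc.eventually (lt_mem_nhds ?_)
    change 0 < (v * (starRingEnd ℂ) v).re
    rw [Complex.mul_conj, Complex.ofReal_re, Complex.normSq_eq_norm_sq]
    positivity
  have hN : ∀ᶠ w : ℂ in 𝓝 (t₀ : ℂ), |w.im| < η ∧ ‖w - t₀‖ ≤ K * ‖tube γ w - γ t₀‖ ∧
      ‖γ w.re - γ t₀ - (w.re - t₀) * v‖ ≤ M * (w.re - t₀) ^ 2 ∧
      0 < (deriv γ w.re * (starRingEnd ℂ) v).re := by
    refine (him.eventually (p := fun s => |s| < η) ?_).and (hK.and ((hre.eventually hM).and (hre.eventually hpos)))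
    filter_upwards [Metric.ball_mem_nhds (0 : ℝ) hη] with s hs
    simpa using hs
  have himg : ∀ᶠ z in 𝓝 (γ t₀), ∃ w : ℂ, tube γ w = z ∧ |w.im| < η ∧
      ‖w - t₀‖ ≤ K * ‖tube γ w - γ t₀‖ ∧ ‖γ w.re - γ t₀ - (w.re - t₀) * v‖ ≤ M * (w.re - t₀) ^ 2 ∧
      0 < (deriv γ w.re * (starRingEnd ℂ) v).re := by
    rw [← h.map_nhds_tube t₀, eventually_map]
    filter_upwards [hN] with w hw
    exact ⟨w, rfl, hw⟩
  obtain ⟨ρ, hρ, hball⟩ := Metric.eventually_nhds_iff_ball.1 himg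
  have hRlt : ∀ b : ℝ, 0 < b → ∀ᶠ R : ℝ in 𝓝[>] 0, R < b := fun b hb =>
    nhdsWithin_le_nhds (gt_mem_nhds hb)
  -- R < ρ/2 keeps the disc inside the range of the tube estimates; R < 1/(2MK²) makes it curve
  -- faster than the boundary, which departs from its tangent at most quadratically.
  filter_upwards [self_mem_nhdsWithin, hRlt (ρ / 2) (by linarith),
    hRlt (1 / (2 * M * K ^ 2)) (by positivity)] with R hR0 hR1 hR2
  have hR0 : 0 < R := hR0
  intro z hz
  rw [mem_ball, dist_eq_norm] at hz
  have hRν : ‖(R : ℂ) * ν‖ = R := by rw [norm_mul, hν1, Complex.norm_real, Real.norm_of_nonneg hR0.le, mul_one]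
  have hzρ : z ∈ ball (γ t₀) ρ := by
    rw [mem_ball, dist_eq_norm]
    calc ‖z - γ t₀‖ = ‖(z - (γ t₀ + R * ν)) + R * ν‖ := by congr 1; ring
      _ ≤ _ := norm_add_le _ _
      _ < ρ := by rw [hRν]; linarith
  obtain ⟨w, rfl, hw1, hw2, hw3, hw4⟩ := hball z hzρ
  rcases lt_or_ge 0 (τ * w.im) with hs | hs
  · have := hcol w.re (τ * w.im) hs (by
      calc τ * w.im ≤ |τ * w.im| := le_abs_self _
        _ < η := by rwa [abs_mul, hτn, one_mul])
    rw [← mul_assoc, hτ2, one_mul, Complex.re_add_im] at this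
    exact this
  · exfalso
    -- A disc point not on the collar side gives a contradiction. Membership in the disc means |x|²
    -- < 2R Re(x ν̄), whereas on the wrong side Re(x ν̄) ≤ M(Re w − t₀)² ≤ MK²|x|².
    set x := tube γ w - γ t₀ with hx
    have hsq : ‖x‖ ^ 2 < 2 * R * (x * (starRingEnd ℂ) ν).re := by
      have h1 : ‖x - R * ν‖ < R := by
        refine lt_of_eq_of_lt ?_ hz
        congr 1
        rw [hx]; ring
      have h2 : ‖x - R * ν‖ ^ 2 = ‖x‖ ^ 2 - 2 * R * (x * (starRingEnd ℂ) ν).re + R ^ 2 := by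
        have h3 : ν.re ^ 2 + ν.im ^ 2 = 1 := by
          have := Complex.sq_norm ν
          rw [hν1, Complex.normSq_apply] at this
          linarith
        rw [Complex.sq_norm, Complex.sq_norm, Complex.normSq_apply, Complex.normSq_apply]
        simp
        linear_combination (R ^ 2) * h3
      have h4 : ‖x - R * ν‖ ^ 2 < R ^ 2 := by gcongr
      linarith
    have hdec : x = (γ w.re - γ t₀ - (w.re - t₀) * v) + (w.re - t₀) * v +
        w.im * Complex.I * deriv γ w.re := by
      rw [hx, tube]; ring
    have hre1 : ((((w.re : ℂ) - t₀) * v) * (starRingEnd ℂ) ν).re = 0 := by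
      have : ((w.re : ℂ) - t₀) * v * (starRingEnd ℂ) ν =
          (((w.re - t₀) * τ * ‖v‖ : ℝ) : ℂ) * (-Complex.I) := by
        rw [hν]
        simp only [map_div₀, map_mul, Complex.conj_ofReal, Complex.conj_I]
        have h5 := Complex.mul_conj' v
        have h6 : (‖v‖ : ℂ) ≠ 0 := by exact_mod_cast hv0.ne'
        push_cast
        field_simp
        linear_combination -(((w.re : ℂ) - t₀) * τ) * h5
      rw [this, Complex.re_ofReal_mul]
      simp
    have hre2 : ((w.im * Complex.I * deriv γ w.re) * (starRingEnd ℂ) ν).re ≤ 0 := by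
      have : (w.im * Complex.I * deriv γ w.re) * (starRingEnd ℂ) ν =
          ((τ * w.im / ‖v‖ : ℝ) : ℂ) * (deriv γ w.re * (starRingEnd ℂ) v) := by
        rw [hν]
        simp only [map_div₀, map_mul, Complex.conj_ofReal, Complex.conj_I]
        push_cast
        ring_nf
        simp
      rw [this, Complex.re_ofReal_mul]
      exact mul_nonpos_of_nonpos_of_nonneg (div_nonpos_of_nonpos_of_nonneg hs hv0.le) hw4.le
    have hre3 : (x * (starRingEnd ℂ) ν).re ≤ M * (w.re - t₀) ^ 2 := by
      rw [hdec, add_mul, add_mul, Complex.add_re, Complex.add_re, hre1]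
      have := (Complex.re_le_norm ((γ w.re - γ t₀ - (w.re - t₀) * v) * (starRingEnd ℂ) ν))
      rw [norm_mul, Complex.norm_conj, hν1, mul_one] at this
      linarith
    have hw5 : |w.re - t₀| ≤ K * ‖x‖ := by
      refine le_trans ?_ hw2
      simpa using Complex.abs_re_le_norm (w - t₀)
    have hw6 : (w.re - t₀) ^ 2 ≤ K ^ 2 * ‖x‖ ^ 2 := by
      rw [← sq_abs, ← mul_pow]
      gcongr
    have h7 : 2 * R * M * K ^ 2 ≤ 1 := by
      have := hR2.le
      rw [le_div_iff₀ (by positivity)] at this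
      linarith
    have h8 : 2 * R * (x * (starRingEnd ℂ) ν).re ≤ 2 * R * (M * (K ^ 2 * ‖x‖ ^ 2)) := by
      have : (x * (starRingEnd ℂ) ν).re ≤ M * (K ^ 2 * ‖x‖ ^ 2) := hre3.trans (by gcongr)
      gcongr
    have h9 : 2 * R * (M * (K ^ 2 * ‖x‖ ^ 2)) ≤ ‖x‖ ^ 2 := by
      calc 2 * R * (M * (K ^ 2 * ‖x‖ ^ 2)) = (2 * R * M * K ^ 2) * ‖x‖ ^ 2 := by ring
        _ ≤ 1 * ‖x‖ ^ 2 := by gcongr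
        _ = _ := one_mul _
    linarith

end IsJordanLoop

/-- A punctured planar domain is connected. -/
theorem isPreconnected_diff_singleton {D : Set ℂ} (hD : IsOpen D) (hc : IsPreconnected D) {p : ℂ}
    (hp : p ∈ D) : IsPreconnected (D \ {p}) := by
  obtain ⟨r, hr, hrD⟩ := Metric.isOpen_iff.1 hD p hp
  set A : Set ℂ := {z | ‖z - p‖ ∈ Ioo 0 r} with hA
  have hApre : IsPreconnected A :=
    isPreconnected_setOf_norm_sub_mem isPreconnected_Ioo (fun x hx => hx.1.le) p
  have hAD : A ⊆ D \ {p} := fun z hz => ⟨hrD (by simpa [dist_eq_norm] using hz.2), fun h0 => by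
    rw [mem_singleton_iff] at h0
    simp [hA, h0] at hz⟩
  have hAne : A.Nonempty := ⟨p + (r / 2 : ℝ), by
    simp only [hA, mem_ofPred_eq, add_sub_cancel_left, Complex.norm_real, Real.norm_eq_abs,
      abs_of_pos (half_pos hr)]
    constructor <;> linarith⟩
  have hball : ball p r ⊆ A ∪ {p} := fun z hz => by
    rcases eq_or_ne z p with rfl | h0
    · exact Or.inr rfl
    · exact Or.inl ⟨norm_pos_iff.2 (sub_ne_zero.2 h0), by simpa [dist_eq_norm] using hz⟩
  rw [isPreconnected_iff_subset_of_disjoint] at hc ⊢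
  intro u v hu hv huv hd
  -- If the connected punctured disc A lies in u, then u may be enlarged by the whole disc and p
  -- removed from v, giving a separation of D itself.
  have key : ∀ u v : Set ℂ, IsOpen u → IsOpen v → D \ {p} ⊆ u ∪ v → D \ {p} ∩ (u ∩ v) = ∅ →
      A ⊆ u → D \ {p} ⊆ u := by
    intro u v hu hv huv hd hAu
    have hor := hc (u ∪ ball p r) (v \ {p}) (hu.union isOpen_ball)
      (hv.sdiff isClosed_singleton) ?_ ?_
    · rcases hor with h1 | h1
      · intro z hz
        rcases h1 hz.1 with h2 | h2
        · exact h2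
        · exact (hball h2).elim (fun h => hAu h) fun h => (hz.2 h).elim
      · exact ((h1 hp).2 rfl).elim
    · intro z hz
      by_cases h0 : z = p
      · exact Or.inl (Or.inr (h0 ▸ mem_ball_self hr))
      · rcases huv ⟨hz, h0⟩ with h2 | h2
        · exact Or.inl (Or.inl h2)
        · exact Or.inr ⟨h2, h0⟩
    · rw [eq_empty_iff_forall_notMem]
      rintro z ⟨hz, h2 | h2, h3⟩
      · exact (eq_empty_iff_forall_notMem.1 hd z) ⟨⟨hz, h3.2⟩, h2, h3.1⟩
      · have h4 : z ∈ A := (hball h2).resolve_right h3.2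
        exact (eq_empty_iff_forall_notMem.1 hd z) ⟨⟨hz, h3.2⟩, hAu h4, h3.1⟩
  rcases (isPreconnected_iff_subset_of_disjoint.1 hApre) u v hu hv (hAD.trans huv)
    (subset_empty_iff.1 (hd ▸ inter_subset_inter_left _ hAD)) with h1 | h1
  · exact Or.inl (key u v hu hv huv hd h1)
  · exact Or.inr (key v u hv hu (by rwa [union_comm]) (by rwa [inter_comm v u]) h1)

namespace IsJordanExterior

variable {Ω : Set ℂ} {γ : ℝ → ℂ}

theorem exists_collars (h : IsJordanExterior Ω γ) :
    ∃ τ, HasCollar γ (closure Ω)ᶜ τ ∧ HasCollar γ Ω (-τ) := by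
  obtain ⟨-, σ, hσ, -, η, hη, hcol⟩ := h.jordan
  refine ⟨σ, ⟨hσ, η, hη, fun t s h0 h1 => (hcol t s h0 h1).1⟩, ?_, η, hη, fun t s h0 h1 => ?_⟩
  · rcases hσ with rfl | rfl <;> simp
  · have := (hcol t s h0 h1).2
    rwa [← neg_mul] at this

theorem isPreconnected_enclosed (h : IsJordanExterior Ω γ) : IsPreconnected (closure Ω)ᶜ :=
  h.jordan.1

theorem isOpen_enclosed : IsOpen (closure Ω)ᶜ := isClosed_closure.isOpen_compl

theorem nonempty_enclosed (h : IsJordanExterior Ω γ) : (closure Ω)ᶜ.Nonempty := by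
  obtain ⟨τ, ⟨-, η, hη, hcol⟩, -⟩ := h.exists_collars
  exact ⟨_, hcol 0 (η / 2) (by linarith) (by linarith)⟩

end IsJordanExterior

theorem HasCollar.subset_closure {γ : ℝ → ℂ} {C W : Set ℂ} {τ : ℝ} (hγ : IsJordanLoop γ C)
    (hW : HasCollar γ W τ) : C ⊆ closure W := by
  intro z hz
  obtain ⟨t, rfl⟩ := hγ.exists_eq hz
  obtain ⟨-, η, hη, hcol⟩ := hW
  have hc : Tendsto (fun s : ℝ => tube γ (t + (τ * s : ℝ) * Complex.I)) (𝓝[>] 0) (𝓝 (γ t)) := by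
    have h1 : Continuous fun s : ℝ => tube γ (t + (τ * s : ℝ) * Complex.I) :=
      hγ.continuous_tube.comp (by fun_prop)
    have h2 := h1.tendsto 0
    simp only [mul_zero, Complex.ofReal_zero, zero_mul, add_zero, IsJordanLoop.tube_ofReal] at h2
    exact h2.mono_left nhdsWithin_le_nhds
  refine mem_closure_of_tendsto hc ?_
  filter_upwards [self_mem_nhdsWithin, nhdsWithin_le_nhds (gt_mem_nhds hη)] with s h0 h1
  exact hcol t s h0 h1

/-- The inner collar accumulates at every point of the boundary curve. -/
theorem IsJordanExterior.closure_enclosed {Ω : Set ℂ} {γ : ℝ → ℂ} (h : IsJordanExterior Ω γ) :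
    closure (closure Ω)ᶜ = Ωᶜ := by
  obtain ⟨τ, hτ, -⟩ := h.exists_collars
  refine Subset.antisymm ?_ fun z hz => ?_
  · exact closure_minimal (compl_subset_compl.2 subset_closure) h.isOpen.isClosed_compl
  · by_cases hzc : z ∈ closure Ω
    · exact hτ.subset_closure h.loop (by rw [h.isOpen.frontier_eq]; exact ⟨hzc, hz⟩)
    · exact subset_closure hzc

/-! ### Complex gradients and logarithmic singularities of harmonic functions -/

/-- The real linear form `v ↦ Re (a v)`. -/
noncomputable def reMul (a : ℂ) : ℂ →L[ℝ] ℝ :=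
  Complex.reCLM ∘L (ContinuousLinearMap.mul ℝ ℂ a)

@[simp]
theorem reMul_apply (a v : ℂ) : reMul a v = (a * v).re := rfl

/-- The complex number representing a real linear form. -/
noncomputable def formCoeff (A : ℂ →L[ℝ] ℝ) : ℂ := A 1 - Complex.I * A Complex.I

theorem formCoeff_reMul (a : ℂ) : formCoeff (reMul a) = a := by
  apply Complex.ext <;> simp [formCoeff]

theorem reMul_formCoeff (A : ℂ →L[ℝ] ℝ) : reMul (formCoeff A) = A := by
  ext v
  have h1 : v = v.re • (1 : ℂ) + v.im • Complex.I := by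
    apply Complex.ext <;> simp
  conv_rhs => rw [h1, map_add, map_smul, map_smul]
  simp [formCoeff]
  ring

/-- The complex gradient `f_x - i f_y`. -/
noncomputable def cgrad (f : ℂ → ℝ) (z : ℂ) : ℂ := formCoeff (fderiv ℝ f z)

theorem hasFDerivAt_reMul_cgrad {f : ℂ → ℝ} {z : ℂ} (hf : DifferentiableAt ℝ f z) :
    HasFDerivAt f (reMul (cgrad f z)) z := by
  rw [cgrad, reMul_formCoeff]
  exact hf.hasFDerivAt

theorem cgrad_eq {f : ℂ → ℝ} {z a : ℂ} (hf : HasFDerivAt f (reMul a) z) : cgrad f z = a := by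
  rw [cgrad, hf.fderiv, formCoeff_reMul]

theorem hasFDerivAt_re {h : ℂ → ℂ} {h' z : ℂ} (hh : HasDerivAt h h' z) :
    HasFDerivAt (fun w => (h w).re) (reMul h') z := by
  have h1 : HasFDerivAt h ((ContinuousLinearMap.toSpanSingleton ℂ h').restrictScalars ℝ) z :=
    hh.hasFDerivAt.restrictScalars ℝ
  have := HasFDerivAt.comp (g := Complex.reCLM) z (Complex.reCLM.hasFDerivAt) h1
  refine this.congr_fderiv ?_
  ext v
  simp
  ring

/-- Near w, log|z| is Re log(z/w) up to a constant, and z/w stays close to 1, away from the branch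
cut. -/
theorem hasFDerivAt_log_norm {w : ℂ} (hw : w ≠ 0) :
    HasFDerivAt (fun z : ℂ => Real.log ‖z‖) (reMul w⁻¹) w := by
  have h1 : HasDerivAt (fun z : ℂ => Complex.log (z / w)) w⁻¹ w := by
    have := ((hasDerivAt_id w).div_const w).clog (by simp [div_self hw])
    refine this.congr_deriv ?_
    simp [div_self hw]
  have h2 := (hasFDerivAt_re h1).add_const (Real.log ‖w‖)
  refine h2.congr_of_eventuallyEq ?_
  filter_upwards [isOpen_compl_singleton.mem_nhds hw] with z hz
  rw [Complex.log_re, norm_div, Real.log_div (norm_ne_zero_iff.2 hz) (norm_ne_zero_iff.2 hw)]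
  ring

theorem analyticOnNhd_cgrad {f : ℂ → ℝ} {s : Set ℂ} (hf : HarmonicOnNhd f s) :
    AnalyticOnNhd ℂ (cgrad f) s := fun z hz =>
  HarmonicAt.analyticAt_complex_partial (hf z hz)

theorem differentiableAt_of_harmonicAt {f : ℂ → ℝ} {z : ℂ} (hf : HarmonicAt f z) :
    DifferentiableAt ℝ f z := hf.1.differentiableAt (by norm_num)

/-- The gradient estimate for a bounded harmonic function on a disc. -/
theorem norm_cgrad_le {f : ℂ → ℝ} {z : ℂ} {R M : ℝ} (hR : 0 < R) (hM : 0 < M)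
    (hf : HarmonicOnNhd f (ball z R)) (hb : ∀ w ∈ ball z R, |f w| ≤ M) :
    ‖cgrad f z‖ ≤ 8 * M / R := by
  obtain ⟨h, hh, hre⟩ := hf.exists_analyticOnNhd_ball_re_eq
  have hzR : z ∈ ball z R := mem_ball_self hR
  -- Re u ≤ 2M, so Borel–Carathéodory gives |u| ≤ 4M on the circle of radius R/2, and Cauchy's
  -- estimate at the centre gives 8M/R.
  set u : ℂ → ℂ := fun w => h (z + w) - h z with hu
  have hmem : ∀ w ∈ ball (0 : ℂ) R, z + w ∈ ball z R := fun w hw => by simpa using hw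
  have hud : DifferentiableOn ℂ u (ball 0 R) := fun w hw => by
    refine DifferentiableAt.differentiableWithinAt ?_
    exact (((hh _ (hmem w hw)).differentiableAt).comp w (by fun_prop)).sub_const _
  have hum : MapsTo u (ball 0 R) {x | x.re ≤ 2 * M} := fun w hw => by
    have h1 := hre (hmem w hw)
    have h2 := hre hzR
    have h3 := hb _ (hmem w hw)
    have h4 := hb z hzR
    simp only at h1 h2
    simp only [hu, mem_ofPred_eq, Complex.sub_re, h1, h2]
    linarith [abs_le.1 h3, abs_le.1 h4]
  have hbound : ∀ w ∈ sphere (0 : ℂ) (R / 2), ‖u w‖ ≤ 4 * M := fun w hw => by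
    have hw' : ‖w‖ = R / 2 := by simpa using hw
    have := Complex.borelCaratheodory_zero (M := 2 * M) (by linarith) hud hum hR (z := w)
      (by rw [mem_ball_zero_iff, hw']; linarith) (by simp [hu])
    rw [hw'] at this
    refine this.trans (le_of_eq ?_)
    field_simp
    ring
  have hcl : DiffContOnCl ℂ u (ball 0 (R / 2)) := by
    refine DifferentiableOn.diffContOnCl (hud.mono ?_)
    exact closure_ball_subset_closedBall.trans (closedBall_subset_ball (by linarith))
  have hder := Complex.norm_deriv_le_of_forall_mem_sphere_norm_le (half_pos hR) hcl hbound
  have hd : deriv u 0 = cgrad f z := by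
    have h1 : HasDerivAt h (deriv h z) z := (hh z hzR).differentiableAt.hasDerivAt
    have h2 : HasDerivAt u (deriv h z) 0 := by
      have h3 : HasDerivAt h (deriv h z) (z + 0) := by simpa using h1
      exact (HasDerivAt.comp_const_add z 0 h3).sub_const _
    rw [h2.deriv]
    refine (cgrad_eq ?_).symm
    refine (hasFDerivAt_re h1).congr_of_eventuallyEq ?_
    filter_upwards [isOpen_ball.mem_nhds hzR] with w hw
    exact (hre hw).symm
  rw [hd] at hder
  refine hder.trans (le_of_eq ?_)
  field_simp
  ring

/-- A harmonic function with at most a logarithmic singularity has a gradient with at most a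
simple pole. -/
theorem exists_cgrad_eq_div_add {f : ℂ → ℝ} {D : Set ℂ} (hD : IsOpen D) (h0 : (0 : ℂ) ∈ D)
    (hf : HarmonicOnNhd f (D \ {0})) (hlog : f =O[𝓝[≠] 0] fun z => Real.log ‖z‖) :
    ∃ (k : ℂ) (M : ℂ → ℂ), DifferentiableOn ℂ M D ∧ ∀ z ∈ D \ {0}, cgrad f z = k / z + M z := by
  have hg := analyticOnNhd_cgrad hf
  -- The gradient is O(|log|z||/|z|), so z² times it tends to 0 and the singularity of m is
  -- removable. Dividing twice by z gives m = kz + z²M with k = m'(0).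
  set m : ℂ → ℂ := fun z => z ^ 2 * cgrad f z with hm
  have hm0 : m 0 = 0 := by simp [hm]
  have hmd : ∀ z ∈ D \ {0}, DifferentiableAt ℂ m z := fun z hz =>
    (differentiableAt_id.pow 2).mul (hg z hz).differentiableAt
  -- the gradient estimate near the pole
  have hmc : ContinuousAt m 0 := by
    obtain ⟨K, hK0, hK⟩ := hlog.exists_pos
    obtain ⟨r, hr, hrD⟩ := Metric.isOpen_iff.1 hD 0 h0
    have hK' := hK.bound
    rw [eventually_nhdsWithin_iff, Metric.eventually_nhds_iff_ball] at hK'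
    obtain ⟨δ, hδ, hδb⟩ := hK'
    set ρ := min (min r δ) (1 / 2) with hρ
    have hρ0 : 0 < ρ := lt_min (lt_min hr hδ) (by norm_num)
    have hest : ∀ z : ℂ, z ≠ 0 → ‖z‖ < ρ / 2 → ‖m z‖ ≤ 16 * K * (‖z‖ * (-Real.log (‖z‖ / 2))) := by
      intro z hz0 hzρ
      have hzn : 0 < ‖z‖ := norm_pos_iff.2 hz0
      have hρ1 : ρ ≤ 1 / 2 := min_le_right _ _
      -- On the disc of radius |z|/2 about z the logarithm is controlled by its value at |z|/2.
      have hball : ∀ w ∈ ball z (‖z‖ / 2), ‖z‖ / 2 < ‖w‖ ∧ ‖w‖ < ρ := fun w hw => by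
        rw [mem_ball, dist_eq_norm] at hw
        have h1 := norm_sub_norm_le z w
        have h2 := norm_sub_norm_le w z
        rw [norm_sub_rev] at h1
        constructor <;> linarith
      have hlogz : 0 < -Real.log (‖z‖ / 2) := by
        have := Real.log_neg (x := ‖z‖ / 2) (by linarith) (by linarith)
        linarith
      have h1 := norm_cgrad_le (f := f) (z := z) (R := ‖z‖ / 2) (M := K * (-Real.log (‖z‖ / 2)))
        (by linarith) (by positivity) (fun w hw => hf w ⟨hrD ?_, ?_⟩) (fun w hw => ?_)
      · rw [hm]
        simp only [norm_mul, norm_pow]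
        calc ‖z‖ ^ 2 * ‖cgrad f z‖ ≤ ‖z‖ ^ 2 * (8 * (K * (-Real.log (‖z‖ / 2))) / (‖z‖ / 2)) := by
              gcongr
          _ = _ := by field_simp; ring
      · rw [mem_ball_zero_iff]
        exact (hball w hw).2.trans_le ((min_le_left _ _).trans (min_le_left _ _))
      · rintro rfl
        have := (hball 0 hw).1
        simp at this
        linarith
      · have hw' := hball w hw
        have hw0 : w ≠ 0 := norm_pos_iff.1 (by linarith [hw'.1])
        have := hδb w (by
          rw [mem_ball_zero_iff]
          exact hw'.2.trans_le ((min_le_left _ _).trans (min_le_right _ _))) hw0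
        rw [Real.norm_eq_abs, Real.norm_eq_abs] at this
        refine this.trans ?_
        have hlw : Real.log ‖w‖ < 0 := Real.log_neg (by linarith [hw'.1]) (by linarith [hw'.2])
        rw [abs_of_neg hlw]
        have := Real.log_le_log (by linarith) hw'.1.le
        gcongr
    have hlim : Tendsto (fun z : ℂ => 16 * K * (‖z‖ * (-Real.log (‖z‖ / 2)))) (𝓝 0) (𝓝 0) := by
      have h1 := Real.continuous_mul_log.tendsto 0
      have h2 : Tendsto (fun z : ℂ => ‖z‖ / 2) (𝓝 0) (𝓝 0) := by
        have : Continuous fun z : ℂ => ‖z‖ / 2 := by fun_prop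
        simpa using this.tendsto 0
      have h3 := (h1.comp h2).const_mul (-32 * K)
      simp only [zero_mul, mul_zero] at h3
      refine h3.congr fun z => ?_
      simp only [Function.comp]
      ring
    rw [ContinuousAt, hm0]
    refine squeeze_zero_norm' ?_ hlim
    filter_upwards [Metric.ball_mem_nhds (0 : ℂ) (half_pos hρ0)] with z hz
    rcases eq_or_ne z 0 with rfl | hz0
    · simp [hm0]
    · exact hest z hz0 (by simpa using hz)
  have hmD : DifferentiableOn ℂ m D :=
    (Complex.differentiableOn_compl_singleton_and_continuousAt_iff (hD.mem_nhds h0)).1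
      ⟨fun z hz => (hmd z hz).differentiableWithinAt, hmc⟩
  have hN : DifferentiableOn ℂ (dslope m 0) D :=
    (Complex.differentiableOn_dslope (hD.mem_nhds h0)).2 hmD
  have hM : DifferentiableOn ℂ (dslope (dslope m 0) 0) D :=
    (Complex.differentiableOn_dslope (hD.mem_nhds h0)).2 hN
  refine ⟨dslope m 0 0, dslope (dslope m 0) 0, hM, fun z hz => ?_⟩
  have hz0 : z ≠ 0 := hz.2
  rw [dslope_of_ne _ hz0, slope_def_field, dslope_of_ne _ hz0, slope_def_field, hm0, sub_zero,
    sub_zero, hm]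
  field_simp
  ring

/-- The circulation of the complex gradient around the pole. -/
theorem circleIntegral_cgrad {f : ℂ → ℝ} {D : Set ℂ} {k : ℂ} {M : ℂ → ℂ} {r : ℝ} (hr : 0 < r)
    (hrD : closedBall 0 r ⊆ D) (hM : DifferentiableOn ℂ M D)
    (hg : ∀ z ∈ D \ {0}, cgrad f z = k / z + M z) :
    ∮ z in C(0, r), cgrad f z = 2 * Real.pi * Complex.I * k := by
  have h1 : ∮ z in C(0, r), cgrad f z = ∮ z in C(0, r), (k • (z - 0)⁻¹ + M z) := by
    refine circleIntegral.integral_congr hr.le fun z hz => ?_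
    have hz' : ‖z‖ = r := by simpa using hz
    rw [hg z ⟨hrD (sphere_subset_closedBall hz), fun h0 => ?_⟩]
    · simp [div_eq_mul_inv]
    · rw [mem_singleton_iff] at h0
      rw [h0] at hz'
      simp at hz'
      linarith
  have hMc : DiffContOnCl ℂ M (ball 0 r) :=
    DifferentiableOn.diffContOnCl (hM.mono (closure_ball_subset_closedBall.trans hrD))
  have h2 : CircleIntegrable (fun z : ℂ => k • (z - 0)⁻¹) 0 r := by
    refine CircleIntegrable.const_smul ?_
    rw [circleIntegrable_sub_inv_iff]
    right
    simp [abs_of_pos hr, hr.ne]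
  have h3 : CircleIntegrable M 0 r :=
    (hM.continuousOn.mono (sphere_subset_closedBall.trans hrD)).circleIntegrable hr.le
  rw [h1, circleIntegral.integral_add h2 h3, circleIntegral.integral_smul,
    circleIntegral.integral_sub_inv_of_mem_ball (by simpa using hr),
    hMc.circleIntegral_eq_zero hr.le]
  simp
  ring

/-- The real part of the complex gradient times dz is df, and f is single-valued. This forces the
residue at the pole to be real. -/
theorem re_circleIntegral_cgrad {f : ℂ → ℝ} {r : ℝ} (hr : 0 < r)
    (hf : HarmonicOnNhd f (sphere 0 r)) : (∮ z in C(0, r), cgrad f z).re = 0 := by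
  have hmem : ∀ θ, circleMap 0 r θ ∈ sphere (0 : ℂ) r := fun θ => circleMap_mem_sphere 0 hr.le θ
  have hc : Continuous fun θ => deriv (circleMap 0 r) θ • cgrad f (circleMap 0 r θ) := by
    have h1 : Continuous fun θ => cgrad f (circleMap 0 r θ) :=
      (analyticOnNhd_cgrad hf).continuousOn.comp_continuous (continuous_circleMap 0 r) hmem
    simp only [deriv_circleMap]
    exact ((continuous_circleMap 0 r).mul continuous_const).smul h1
  have hd : ∀ θ ∈ uIcc 0 (2 * Real.pi), HasDerivAt (fun θ => f (circleMap 0 r θ))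
      (deriv (circleMap 0 r) θ • cgrad f (circleMap 0 r θ)).re θ := fun θ _ => by
    have h1 := hasFDerivAt_reMul_cgrad (differentiableAt_of_harmonicAt (hf _ (hmem θ)))
    refine (h1.comp_hasDerivAt θ (hasDerivAt_circleMap 0 r θ)).congr_deriv ?_
    rw [deriv_circleMap, smul_eq_mul, mul_comm, reMul_apply, mul_comm]
  have h1 := intervalIntegral.integral_eq_sub_of_hasDerivAt hd
    ((Complex.continuous_re.comp hc).intervalIntegrable _ _)
  have h2 := Complex.reCLM.intervalIntegral_comp_comm (hc.intervalIntegrable (μ := volume) 0 (2 * Real.pi))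
  rw [circleIntegral]
  simp only [Complex.reCLM_apply] at h2
  rw [← h2, h1]
  have := periodic_circleMap 0 r 0
  rw [zero_add] at this
  rw [this, sub_self]

/-- The structure of a harmonic function with a logarithmic singularity at the origin on a bounded
simply connected domain. -/
theorem exists_eq_log_add_re {f : ℂ → ℝ} {D : Set ℂ} (hD : IsOpen D) (hDc : IsPreconnected D)
    (hDb : Bornology.IsBounded D) (hDc' : IsPreconnected Dᶜ) (h0 : (0 : ℂ) ∈ D)
    (hf : HarmonicOnNhd f (D \ {0})) (hlog : f =O[𝓝[≠] 0] fun z => Real.log ‖z‖) :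
    ∃ (k : ℝ) (L : ℂ → ℂ), DifferentiableOn ℂ L D ∧
      (∀ z ∈ D \ {0}, cgrad f z = k / z + deriv L z) ∧
      ∀ z ∈ D \ {0}, f z = k * Real.log ‖z‖ + (L z).re := by
  obtain ⟨k, M, hM, hg⟩ := exists_cgrad_eq_div_add hD h0 hf hlog
  obtain ⟨r, hr, hrD⟩ := Metric.isOpen_iff.1 hD 0 h0
  have hr2 : closedBall (0 : ℂ) (r / 2) ⊆ D := (closedBall_subset_ball (by linarith)).trans hrD
  -- Re(2πik) = −2π Im k is the increment of f around a circle, hence zero.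
  have hk : k = (k.re : ℂ) := by
    have h1 := re_circleIntegral_cgrad (f := f) (half_pos hr) (fun z hz => hf z
      ⟨hr2 (sphere_subset_closedBall hz), fun h0 => by
        rw [mem_singleton_iff] at h0
        simp [h0] at hz
        linarith⟩)
    rw [circleIntegral_cgrad (half_pos hr) hr2 hM hg] at h1
    have h2 : (2 * Real.pi * Complex.I * k).re = -(2 * Real.pi * k.im) := by simp
    rw [h2] at h1
    have h3 : k.im = 0 := by
      have := Real.pi_pos
      nlinarith
    apply Complex.ext <;> simp [h3]
  obtain ⟨L, hL⟩ := isExactOn_of_isPreconnected_compl hD hDc hDb hDc' hM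
  have hpre := isPreconnected_diff_singleton hD hDc h0
  have hopen : IsOpen (D \ {0}) := hD.sdiff isClosed_singleton
  -- The gradients agree, so u is constant on the connected punctured domain; the constant is
  -- absorbed into L.
  set u : ℂ → ℝ := fun z => f z - (k.re * Real.log ‖z‖ + (L z).re) with hu
  have hud : ∀ z ∈ D \ {0}, HasFDerivAt u 0 z := fun z hz => by
    have h1 := hasFDerivAt_reMul_cgrad (differentiableAt_of_harmonicAt (hf z hz))
    have h2 := (hasFDerivAt_log_norm (w := z) hz.2).const_mul k.re
    have h3 := hasFDerivAt_re (hL z hz.1)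
    refine (h1.sub (h2.add h3)).congr_fderiv ?_
    ext v
    rw [hg z hz, hk]
    simp only [_root_.sub_apply, _root_.add_apply, _root_.smul_apply,
      reMul_apply, smul_eq_mul, _root_.zero_apply, Complex.ofReal_re]
    rw [← Complex.re_ofReal_mul, ← Complex.add_re, ← Complex.sub_re]
    have : ((k.re : ℂ) / z + M z) * v - (k.re * (z⁻¹ * v) + M z * v) = 0 := by
      field_simp
      ring
    rw [this, Complex.zero_re]
  obtain ⟨a, ha⟩ := hopen.exists_is_const_of_fderiv_eq_zero hpre
    (fun z hz => (hud z hz).differentiableAt.differentiableWithinAt) (fun z hz => (hud z hz).fderiv)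
  refine ⟨k.re, fun z => L z + a, fun z hz =>
    ((hL z hz).differentiableAt.add_const _).differentiableWithinAt, fun z hz => ?_, fun z hz => ?_⟩
  · rw [hg z hz, ((hL z hz.1).add_const (a : ℂ)).deriv]
    nth_rw 1 [hk]
  · have := ha z hz
    simp only [hu] at this
    rw [Complex.add_re, Complex.ofReal_re]
    linarith

/-! ### Holomorphic bijections onto the disc -/

/-- Near a critical point a holomorphic function takes its values at least twice. -/
theorem eventually_exists_ne_of_deriv_eq_zero {F : ℂ → ℂ} {a : ℂ} (hF : AnalyticAt ℂ F a)
    (hnc : ¬ ∀ᶠ z in 𝓝 a, F z = F a) (hd : deriv F a = 0) {U : Set ℂ} (hU : U ∈ 𝓝 a) :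
    ∀ᶠ b in 𝓝[≠] (F a), ∃ z₁ ∈ U, ∃ z₂ ∈ U, z₁ ≠ z₂ ∧ F z₁ = b ∧ F z₂ = b := by
  have hf : AnalyticAt ℂ (fun z => F z - F a) a := hF.sub analyticAt_const
  obtain ⟨n, g, hg, hga, hfg⟩ := hf.exists_eventuallyEq_pow_smul_nonzero_iff.2
    (by simpa [sub_eq_zero] using hnc)
  have hfa := hfg.self_of_nhds
  have hn2 : 2 ≤ n := by
    by_contra hlt
    have : n = 0 ∨ n = 1 := by omega
    rcases this with rfl | rfl
    · simp at hfa
      exact hga hfa.symm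
    · have h1 : HasDerivAt (fun z => F z - F a) (g a) a := by
        have h2 : HasDerivAt (fun z => (z - a) ^ 1 • g z) (g a) a := by
          have := ((hasDerivAt_id a).sub_const a).mul hg.differentiableAt.hasDerivAt
          refine (this.congr_deriv (by simp)).congr_of_eventuallyEq ?_
          exact Eventually.of_forall fun z => by simp
        exact h2.congr_of_eventuallyEq hfg
      have h3 := h1.deriv
      rw [deriv_sub_const, hd] at h3
      exact hga h3.symm
  have hn0 : n ≠ 0 := by omega
  have hn0' : (n : ℂ) ≠ 0 := by exact_mod_cast hn0
  -- An analytic n-th root of g near a. Then φ = (z − a)v is a local coordinate in which F = F(a) +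
  -- φⁿ.
  set v : ℂ → ℂ := fun z => Complex.exp (Complex.log (g z / g a) / n + Complex.log (g a) / n) with hv
  have hva : AnalyticAt ℂ v a := by
    refine AnalyticAt.cexp (AnalyticAt.add (AnalyticAt.div (AnalyticAt.clog
      (hg.div analyticAt_const hga) ?_) analyticAt_const hn0') analyticAt_const)
    simp [div_self hga]
  have hvn : ∀ᶠ z in 𝓝 a, v z ^ n = g z := by
    filter_upwards [hg.continuousAt.eventually_ne hga] with z hz
    rw [hv]
    simp only
    rw [← Complex.exp_nat_mul, mul_add, mul_div_cancel₀ _ hn0', mul_div_cancel₀ _ hn0',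
      Complex.exp_add, Complex.exp_log (div_ne_zero hz hga), Complex.exp_log hga,
      div_mul_cancel₀ _ hga]
  set φ : ℂ → ℂ := fun z => (z - a) * v z with hφ
  have hφa : φ a = 0 := by simp [hφ]
  have hφs : HasStrictDerivAt φ (v a) a := by
    have h1 : HasStrictDerivAt (fun z : ℂ => z - a) 1 a := (hasStrictDerivAt_id a).sub_const a
    have := HasStrictDerivAt.mul h1 hva.hasStrictDerivAt
    exact this.congr_deriv (by simp)
  have hU' : {z | z ∈ U ∧ F z = F a + φ z ^ n} ∈ 𝓝 a := by
    filter_upwards [hU, hfg, hvn] with z h1 h2 h3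
    refine ⟨h1, ?_⟩
    rw [hφ]
    simp only
    rw [mul_pow, h3]
    rw [smul_eq_mul] at h2
    linear_combination h2
  have himg : φ '' {z | z ∈ U ∧ F z = F a + φ z ^ n} ∈ 𝓝 (0 : ℂ) := by
    rw [← hφa, ← hφs.map_nhds_eq (Complex.exp_ne_zero _)]
    exact image_mem_map hU'
  obtain ⟨δ, hδ, hball⟩ := Metric.mem_nhds_iff.1 himg
  have hb : ∀ᶠ b in 𝓝[≠] (F a), ‖b - F a‖ < δ ^ n ∧ b ≠ F a := by
    refine Filter.Eventually.and (nhdsWithin_le_nhds ?_) self_mem_nhdsWithin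
    filter_upwards [Metric.ball_mem_nhds (F a) (pow_pos hδ n)] with b hb
    rwa [mem_ball, dist_eq_norm] at hb
  filter_upwards [hb] with b hb
  have hb0 : b - F a ≠ 0 := sub_ne_zero.2 hb.2
  set w : ℂ := Complex.exp (Complex.log (b - F a) / n) with hw
  have hwn : w ^ n = b - F a := by
    rw [hw, ← Complex.exp_nat_mul, mul_div_cancel₀ _ hn0', Complex.exp_log hb0]
  have hwδ : ‖w‖ < δ := by
    refine lt_of_pow_lt_pow_left₀ n hδ.le ?_
    rw [← norm_pow, hwn]
    exact hb.1
  -- As n ≥ 2, w and ζw are distinct n-th roots of b − F(a); their φ-preimages are the two required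
  -- points.
  have hζ := Complex.isPrimitiveRoot_exp n hn0
  set ζ := Complex.exp (2 * Real.pi * Complex.I / n) with hζd
  have hζ1 : ζ ≠ 1 := hζ.ne_one (by omega)
  have hζn : ‖ζ‖ = 1 := hζ.norm'_eq_one hn0
  obtain ⟨z₁, ⟨hz₁U, hz₁F⟩, hz₁⟩ := hball (show w ∈ ball 0 δ by simpa using hwδ)
  obtain ⟨z₂, ⟨hz₂U, hz₂F⟩, hz₂⟩ := hball (show ζ * w ∈ ball 0 δ by simpa [hζn] using hwδ)
  refine ⟨z₁, hz₁U, z₂, hz₂U, ?_, ?_, ?_⟩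
  · rintro rfl
    rw [hz₁] at hz₂
    have h1 : (1 - ζ) * w = 0 := by linear_combination hz₂
    exact (mul_ne_zero (sub_ne_zero.2 hζ1.symm) (Complex.exp_ne_zero _)) h1
  · rw [hz₁F, hz₁, hwn]; ring
  · rw [hz₂F, hz₂, mul_pow, hζ.pow_eq_one, one_mul, hwn]; ring

/-- A holomorphic function on a bounded domain whose modulus tends to one at the boundary and
whose only zero is a simple one. -/
structure IsDiscMap (D : Set ℂ) (F : ℂ → ℂ) : Prop where
  isOpen : IsOpen D
  isPreconnected : IsPreconnected D
  isBounded : Bornology.IsBounded D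
  zero_mem : (0 : ℂ) ∈ D
  differentiableOn : DifferentiableOn ℂ F D
  map_zero : F 0 = 0
  deriv_zero : deriv F 0 ≠ 0
  eq_zero : ∀ z ∈ D, F z = 0 → z = 0
  tendsto : ∀ z ∈ frontier D, Tendsto (fun w => ‖F w‖) (𝓝[D] z) (𝓝 1)

namespace IsDiscMap

variable {D : Set ℂ} {F : ℂ → ℂ}

theorem analyticOnNhd (h : IsDiscMap D F) : AnalyticOnNhd ℂ F D :=
  h.differentiableOn.analyticOnNhd h.isOpen

theorem not_eventually_eq (h : IsDiscMap D F) {a : ℂ} (ha : a ∈ D) :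
    ¬ ∀ᶠ z in 𝓝 a, F z = F a := by
  intro hev
  have h1 := h.analyticOnNhd.eqOn_of_preconnected_of_eventuallyEq
    (g := fun _ => F a) (fun _ _ => analyticAt_const) h.isPreconnected ha hev
  refine h.deriv_zero ?_
  have h2 : F =ᶠ[𝓝 0] fun _ => F a := by
    filter_upwards [h.isOpen.mem_nhds h.zero_mem] with z hz using h1 hz
  rw [h2.deriv_eq, deriv_const]

theorem map_nhds_eq (h : IsDiscMap D F) {a : ℂ} (ha : a ∈ D) : map F (𝓝 a) = 𝓝 (F a) := by
  refine le_antisymm (h.analyticOnNhd a ha).continuousAt ?_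
  exact ((h.analyticOnNhd a ha).eventually_constant_or_nhds_le_map_nhds).resolve_left
    (h.not_eventually_eq ha)

/-- Extended by 1, |F| is continuous on the compact closure of D. Were some value at least 1, the
maximum would be attained inside D and F would be constant. -/
theorem norm_lt_one (h : IsDiscMap D F) {z : ℂ} (hz : z ∈ D) : ‖F z‖ < 1 := by
  classical
  by_contra hge
  rw [not_lt] at hge
  set u : ℂ → ℝ := fun w => if w ∈ D then ‖F w‖ else 1 with hu
  have huc : ContinuousOn u (closure D) := by
    intro w hw
    by_cases hwD : w ∈ D
    · have h1 : ContinuousAt (fun w => ‖F w‖) w := (h.analyticOnNhd w hwD).continuousAt.norm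
      refine (h1.congr ?_).continuousWithinAt
      filter_upwards [h.isOpen.mem_nhds hwD] with x hx
      simp [hu, hx]
    · have hwf : w ∈ frontier D := by
        rw [h.isOpen.frontier_eq]; exact ⟨hw, hwD⟩
      have h1 := h.tendsto w hwf
      rw [ContinuousWithinAt]
      have huw : u w = 1 := by simp [hu, hwD]
      rw [huw]
      have h2 : Tendsto u (𝓝[D] w) (𝓝 1) := by
        refine h1.congr' ?_
        filter_upwards [self_mem_nhdsWithin] with x hx
        simp [hu, hx]
      have h3 : Tendsto u (𝓝[Dᶜ] w) (𝓝 1) := by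
        refine tendsto_const_nhds.congr' ?_
        filter_upwards [self_mem_nhdsWithin] with x hx
        simp [hu, show x ∉ D from hx]
      have h4 := h2.sup h3
      rw [← nhdsWithin_union, union_compl_self, nhdsWithin_univ] at h4
      exact h4.mono_left nhdsWithin_le_nhds
  obtain ⟨x, hx, hmax⟩ := (h.isBounded.isCompact_closure).exists_isMaxOn
    ⟨z, subset_closure hz⟩ huc
  have hzx : ‖F z‖ ≤ u x := by
    have := hmax (subset_closure hz)
    simpa [hu, hz] using this
  obtain ⟨y, hyD, hy⟩ : ∃ y ∈ D, ∀ w ∈ D, ‖F w‖ ≤ ‖F y‖ := by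
    have hle : ∀ w ∈ D, ‖F w‖ ≤ u x := fun w hw => by
      have := hmax (subset_closure hw)
      simpa [hu, hw] using this
    by_cases hxD : x ∈ D
    · refine ⟨x, hxD, fun w hw => (hle w hw).trans (le_of_eq ?_)⟩
      simp [hu, hxD]
    · have hux : u x = 1 := by simp [hu, hxD]
      exact ⟨z, hz, fun w hw => (hle w hw).trans (hux.le.trans hge)⟩
  have := Complex.eventually_eq_of_isLocalMax_norm (f := F) (c := y) ?_ ?_
  · exact h.not_eventually_eq hyD this
  · filter_upwards [h.isOpen.mem_nhds hyD] with w hw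
    exact (h.analyticOnNhd w hw).differentiableAt
  · filter_upwards [h.isOpen.mem_nhds hyD] with w hw using hy w hw

/-- Properness of F as a map into the disc: since |F| → 1 at the frontier, no point of a sublevel
set can escape there. -/
theorem isCompact_sublevel (h : IsDiscMap D F) {r : ℝ} (hr : r < 1) :
    IsCompact {z | z ∈ D ∧ ‖F z‖ ≤ r} := by
  refine Metric.isCompact_of_isClosed_isBounded ?_ (h.isBounded.subset fun z hz => hz.1)
  refine isClosed_of_closure_subset fun z hz => ?_
  have hfr := mem_closure_iff_frequently.1 hz
  by_cases hzD : z ∈ D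
  · refine ⟨hzD, ?_⟩
    have h1 : ContinuousAt (fun w => ‖F w‖) z := (h.analyticOnNhd z hzD).continuousAt.norm
    by_contra hlt
    rw [not_le] at hlt
    refine hfr ?_
    filter_upwards [h1.eventually (lt_mem_nhds hlt)] with w hw hw'
    exact not_lt.2 hw'.2 hw
  · exfalso
    have hzc : z ∈ closure D := closure_mono (fun w hw => hw.1) hz
    have h1 := (h.tendsto z (by rw [h.isOpen.frontier_eq]; exact ⟨hzc, hzD⟩)).eventually
      (lt_mem_nhds hr)
    rw [eventually_nhdsWithin_iff] at h1
    refine hfr ?_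
    filter_upwards [h1] with w hw hw'
    exact not_lt.2 hw'.2 (hw hw'.1)

/-- Continuity method: the values taken exactly once, at a noncritical point, form an open and
relatively closed subset of the connected disc containing 0. Openness uses the inverse function
theorem and properness; closedness uses the open mapping theorem and the branching at critical
points. -/
theorem exists_unique_preimage (h : IsDiscMap D F) {b : ℂ} (hb : ‖b‖ < 1) :
    ∃ a ∈ D, F a = b ∧ deriv F a ≠ 0 ∧ ∀ a' ∈ D, F a' = b → a' = a := by
  set A : Set ℂ := {b | ‖b‖ < 1 ∧ ∃ a ∈ D, F a = b ∧ deriv F a ≠ 0 ∧ ∀ a' ∈ D, F a' = b → a' = a}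
    with hA
  suffices hsub : ball (0 : ℂ) 1 ⊆ A from (hsub (by simpa using hb)).2
  refine (convex_ball (0 : ℂ) 1).isPreconnected.subset_of_closure_inter_subset ?_ ?_ ?_
  · rw [isOpen_iff_mem_nhds]
    rintro b ⟨hb1, a, haD, rfl, hda, huniq⟩
    have han := h.analyticOnNhd a haD
    have hs := han.hasStrictDerivAt
    set e := (hs.hasStrictFDerivAt_equiv hda).toOpenPartialHomeomorph F with he
    have hsrc : e.source ∈ 𝓝 a := e.open_source.mem_nhds
      (hs.hasStrictFDerivAt_equiv hda).mem_toOpenPartialHomeomorph_source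
    have hinj : InjOn F e.source := e.injOn
    have hdne : ∀ᶠ z in 𝓝 a, deriv F z ≠ 0 := han.deriv.continuousAt.eventually_ne hda
    obtain ⟨U, hUsub, hUo, haU⟩ := _root_.mem_nhds_iff.1
      (inter_mem (inter_mem hsrc (h.isOpen.mem_nhds haD)) hdne)
    obtain ⟨r, hr1, hr2⟩ := exists_between hb1
    -- Outside U the sublevel set is compact and its image misses F a, so values near F a have no
    -- preimage outside U.
    have hK : IsCompact ({z | z ∈ D ∧ ‖F z‖ ≤ r} \ U) := (h.isCompact_sublevel hr2).diff hUo
    have hKcl : IsClosed (F '' ({z | z ∈ D ∧ ‖F z‖ ≤ r} \ U)) :=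
      (hK.image_of_continuousOn (h.differentiableOn.continuousOn.mono fun z hz => hz.1.1)).isClosed
    have hbK : F a ∉ F '' ({z | z ∈ D ∧ ‖F z‖ ≤ r} \ U) := by
      rintro ⟨x, hx, hxa⟩
      exact hx.2 (huniq x hx.1.1 hxa ▸ haU)
    have himg : F '' U ∈ 𝓝 (F a) := by
      rw [← h.map_nhds_eq haD]
      exact image_mem_map (hUo.mem_nhds haU)
    filter_upwards [hKcl.isOpen_compl.mem_nhds hbK, himg,
      continuous_norm.continuousAt.eventually (gt_mem_nhds hr1)] with b' h1 h2 h3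
    obtain ⟨a', ha'U, rfl⟩ := h2
    refine ⟨lt_trans h3 hr2, a', (hUsub ha'U).1.2, rfl, (hUsub ha'U).2, fun x hxD hx => ?_⟩
    have hxU : x ∈ U := by
      by_contra hxU
      exact h1 ⟨x, ⟨⟨hxD, by rw [hx]; exact le_of_lt h3⟩, hxU⟩, hx⟩
    exact hinj (hUsub hxU).1.1 (hUsub ha'U).1.1 hx
  · refine ⟨0, by simp, by simp, 0, h.zero_mem, h.map_zero, h.deriv_zero, h.eq_zero⟩
  · rintro b ⟨hbA, hb1⟩
    have hb1 : ‖b‖ < 1 := by simpa using hb1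
    have hfr := mem_closure_iff_frequently.1 hbA
    obtain ⟨r, hr1, hr2⟩ := exists_between hb1
    obtain ⟨a, ⟨haD, -⟩, hab⟩ : b ∈ F '' {z | z ∈ D ∧ ‖F z‖ ≤ r} := by
      have hcl : IsClosed (F '' {z | z ∈ D ∧ ‖F z‖ ≤ r}) :=
        ((h.isCompact_sublevel hr2).image_of_continuousOn
          (h.differentiableOn.continuousOn.mono fun z hz => hz.1)).isClosed
      by_contra hnot
      refine hfr ?_
      filter_upwards [hcl.isOpen_compl.mem_nhds hnot,
        continuous_norm.continuousAt.eventually (gt_mem_nhds hr1)] with b' h1 h2 h3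
      obtain ⟨a', ha'D, rfl, -⟩ := h3.2
      exact h1 ⟨a', ⟨ha'D, le_of_lt h2⟩, rfl⟩
    by_contra hbn
    -- The limit value fails either by having two preimages or by having a critical one. In both
    -- cases all nearby values, apart possibly from b, are taken at least twice, whereas b is a
    -- limit of values taken once.
    by_cases hex : ∃ a' ∈ D, F a' = b ∧ a' ≠ a
    · obtain ⟨a', ha'D, ha'b, hne⟩ := hex
      obtain ⟨V, V', hVo, hV'o, haV, haV', hdis⟩ := t2_separation hne
      have h1 : F '' (V ∩ D) ∈ 𝓝 b := by
        rw [← ha'b, ← h.map_nhds_eq ha'D]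
        exact image_mem_map (inter_mem (hVo.mem_nhds haV) (h.isOpen.mem_nhds ha'D))
      have h2 : F '' (V' ∩ D) ∈ 𝓝 b := by
        rw [← hab, ← h.map_nhds_eq haD]
        exact image_mem_map (inter_mem (hV'o.mem_nhds haV') (h.isOpen.mem_nhds haD))
      refine hfr ?_
      filter_upwards [h1, h2] with b' h3 h4 h5
      obtain ⟨x, hx, rfl⟩ := h3
      obtain ⟨y, hy, hyx⟩ := h4
      obtain ⟨c, -, -, -, huniq⟩ := h5.2
      have hxy : x = y := (huniq x hx.2 rfl).trans (huniq y hy.2 hyx).symm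
      exact Set.disjoint_left.1 hdis hx.1 (hxy ▸ hy.1)
    · push Not at hex
      have hd : deriv F a = 0 := by
        by_contra hd
        exact hbn ⟨hb1, a, haD, hab, hd, hex⟩
      have h1 := eventually_exists_ne_of_deriv_eq_zero (h.analyticOnNhd a haD)
        (h.not_eventually_eq haD) hd (h.isOpen.mem_nhds haD)
      rw [hab, eventually_nhdsWithin_iff] at h1
      refine hfr ?_
      filter_upwards [h1] with b' h2 h3
      obtain ⟨x, hx, y, hy, hxy, hxb, hyb⟩ := h2 fun h0 => hbn (h0 ▸ h3)
      obtain ⟨c, -, -, -, huniq⟩ := h3.2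
      exact hxy ((huniq x hx hxb).trans (huniq y hy hyb).symm)

theorem injOn (h : IsDiscMap D F) : InjOn F D := fun x hx y hy hxy => by
  obtain ⟨a, -, -, -, huniq⟩ := h.exists_unique_preimage (h.norm_lt_one hy)
  exact (huniq x hx hxy).trans (huniq y hy rfl).symm

theorem deriv_ne_zero (h : IsDiscMap D F) {z : ℂ} (hz : z ∈ D) : deriv F z ≠ 0 := by
  obtain ⟨a, -, -, hd, huniq⟩ := h.exists_unique_preimage (h.norm_lt_one hz)
  rw [huniq z hz rfl]
  exact hd

/-- The inverse of a disc map. -/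
theorem exists_inverse (h : IsDiscMap D F) : ∃ ψ : ℂ → ℂ, DifferentiableOn ℂ ψ (ball 0 1) ∧
    MapsTo ψ (ball 0 1) D ∧ (∀ b ∈ ball (0 : ℂ) 1, F (ψ b) = b) ∧ ∀ z ∈ D, ψ (F z) = z := by
  have hex : ∀ b : ℂ, ∃ a, b ∈ ball (0 : ℂ) 1 → a ∈ D ∧ F a = b := fun b => by
    by_cases hb : b ∈ ball (0 : ℂ) 1
    · obtain ⟨a, ha, hab, -⟩ := h.exists_unique_preimage (b := b) (by simpa using hb)
      exact ⟨a, fun _ => ⟨ha, hab⟩⟩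
    · exact ⟨0, fun hb' => (hb hb').elim⟩
  choose ψ hψ using hex
  have hmem : ∀ z ∈ D, F z ∈ ball (0 : ℂ) 1 := fun z hz => by simpa using h.norm_lt_one hz
  have hleft : ∀ z ∈ D, ψ (F z) = z := fun z hz =>
    h.injOn (hψ _ (hmem z hz)).1 hz (hψ _ (hmem z hz)).2
  refine ⟨ψ, fun b hb => ?_, fun b hb => (hψ b hb).1, fun b hb => (hψ b hb).2, hleft⟩
  have hψD := (hψ b hb).1
  have hc : ContinuousAt ψ b := by
    rw [ContinuousAt, tendsto_def]
    intro U hU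
    have h1 : F '' (U ∩ D) ∈ 𝓝 b := by
      have h2 := h.map_nhds_eq hψD
      rw [(hψ b hb).2] at h2
      rw [← h2]
      exact image_mem_map (inter_mem hU (h.isOpen.mem_nhds hψD))
    filter_upwards [h1] with b' hb'
    obtain ⟨x, hx, rfl⟩ := hb'
    rw [mem_preimage, hleft x hx.2]
    exact hx.1
  refine (HasDerivAt.of_local_left_inverse hc
    ((h.analyticOnNhd _ hψD).differentiableAt.hasDerivAt) (h.deriv_ne_zero hψD)
    ?_).differentiableAt.differentiableWithinAt
  filter_upwards [isOpen_ball.mem_nhds hb] with y hy using (hψ y hy).2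

end IsDiscMap

/-- A form of the Schwarz-Pick inequality. -/
theorem one_sub_mul_le_one_sub_norm_sq {F : ℂ → ℂ} {a z : ℂ} {R : ℝ}
    (hF : DifferentiableOn ℂ F (ball a R)) (hm : MapsTo F (ball a R) (ball 0 1))
    (hz : z ∈ ball a R) : (1 - ‖z - a‖ / R) * (1 - ‖F a‖) ^ 2 ≤ 1 - ‖F z‖ ^ 2 := by
  have hR : 0 < R := pos_of_mem_ball hz
  have haR : a ∈ ball a R := mem_ball_self hR
  set b := F a with hb
  have hb1 : ‖b‖ < 1 := by simpa using hm haR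
  have hlow : ∀ w ∈ ball a R, 1 - ‖b‖ ≤ ‖1 - (starRingEnd ℂ) b * F w‖ := fun w hw => by
    have h1 : ‖F w‖ < 1 := by simpa using hm hw
    have h2 := norm_sub_norm_le (1 : ℂ) ((starRingEnd ℂ) b * F w)
    rw [norm_one, norm_mul, Complex.norm_conj] at h2
    have h3 : ‖b‖ * ‖F w‖ ≤ ‖b‖ * 1 := by gcongr
    linarith
  have hne : ∀ w ∈ ball a R, 1 - (starRingEnd ℂ) b * F w ≠ 0 := fun w hw =>
    norm_pos_iff.1 (by linarith [hlow w hw])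
  have hid : ∀ w : ℂ, ‖1 - (starRingEnd ℂ) b * w‖ ^ 2 - ‖w - b‖ ^ 2 =
      (1 - ‖w‖ ^ 2) * (1 - ‖b‖ ^ 2) := fun w => by
    simp only [Complex.sq_norm, Complex.normSq_apply]
    simp
    ring
  -- F followed by the disc automorphism sending F a to 0, so that the Schwarz lemma applies.
  set φ : ℂ → ℂ := fun w => (F w - b) / (1 - (starRingEnd ℂ) b * F w) with hφ
  have hφa : φ a = 0 := by simp [hφ, ← hb]
  have hφd : DifferentiableOn ℂ φ (ball a R) :=
    (hF.sub_const _).div ((differentiableOn_const _).sub ((differentiableOn_const _).mul hF)) hne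
  have hφm : MapsTo φ (ball a R) (closedBall (φ a) 1) := fun w hw => by
    have h1 : ‖F w‖ < 1 := by simpa using hm hw
    rw [hφa, mem_closedBall_zero_iff, hφ]
    simp only [norm_div]
    rw [div_le_one (norm_pos_iff.2 (hne w hw))]
    have h2 := hid (F w)
    have h3 : 0 ≤ (1 - ‖F w‖ ^ 2) * (1 - ‖b‖ ^ 2) := by
      apply mul_nonneg <;> nlinarith [norm_nonneg (F w), norm_nonneg b]
    exact le_of_sq_le_sq (by linarith) (norm_nonneg _)
  have hsch := Complex.dist_le_div_mul_dist_of_mapsTo_ball hφd hφm hz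
  rw [hφa, dist_zero_right, dist_eq_norm] at hsch
  set ρ := ‖z - a‖ / R with hρ
  have hρ0 : 0 ≤ ρ := by positivity
  have hρ1 : ρ < 1 := by
    rw [hρ, div_lt_one hR]
    rwa [mem_ball, dist_eq_norm] at hz
  have hφρ : ‖F z - b‖ ≤ ρ * ‖1 - (starRingEnd ℂ) b * F z‖ := by
    have h1 : ‖φ z‖ ≤ ρ := by rw [hρ]; refine hsch.trans (le_of_eq ?_); ring
    rw [hφ] at h1
    simp only [norm_div] at h1
    rwa [div_le_iff₀ (norm_pos_iff.2 (hne z hz))] at h1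
  have hz1 : ‖F z‖ < 1 := by simpa using hm hz
  have h1 := hid (F z)
  have h2 := hlow z hz
  have h3 : ‖F z - b‖ ^ 2 ≤ ρ ^ 2 * ‖1 - (starRingEnd ℂ) b * F z‖ ^ 2 := by
    rw [← mul_pow]; gcongr
  have h4 : (1 - ‖b‖) ^ 2 ≤ ‖1 - (starRingEnd ℂ) b * F z‖ ^ 2 := by
    have : 0 ≤ 1 - ‖b‖ := by linarith
    gcongr
  have h5 : (1 - ρ) * (1 - ‖b‖) ^ 2 ≤ (1 - ρ ^ 2) * ‖1 - (starRingEnd ℂ) b * F z‖ ^ 2 := by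
    have h6 : 1 - ρ ≤ 1 - ρ ^ 2 := by nlinarith
    have h7 : 0 ≤ 1 - ρ ^ 2 := by nlinarith
    exact mul_le_mul h6 h4 (sq_nonneg _) h7
  have h8 : (1 - ‖F z‖ ^ 2) * (1 - ‖b‖ ^ 2) ≤ 1 - ‖F z‖ ^ 2 := by
    have : 0 ≤ 1 - ‖F z‖ ^ 2 := by nlinarith [norm_nonneg (F z)]
    nlinarith [sq_nonneg ‖b‖]
  linarith

/-! ### The gradient of a Green field up to the boundary -/

/-- The complex gradient within a set. -/
noncomputable def wgrad (S : Set ℂ) (f : ℂ → ℝ) (z : ℂ) : ℂ := formCoeff (fderivWithin ℝ f S z)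

/-- The complex derivative of the complex gradient. -/
noncomputable def wgradDeriv (S : Set ℂ) (f : ℂ → ℝ) (z : ℂ) : ℂ :=
  fderivWithin ℝ (wgrad S f) S z 1

theorem hasFDerivWithinAt_reMul_wgrad {S : Set ℂ} {f : ℂ → ℝ} {z : ℂ}
    (hf : DifferentiableWithinAt ℝ f S z) : HasFDerivWithinAt f (reMul (wgrad S f z)) S z := by
  rw [wgrad, reMul_formCoeff]
  exact hf.hasFDerivWithinAt

theorem wgrad_eq {S : Set ℂ} {f : ℂ → ℝ} {z a : ℂ} (hS : UniqueDiffWithinAt ℝ S z)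
    (hf : HasFDerivWithinAt f (reMul a) S z) : wgrad S f z = a := by
  rw [wgrad, hf.fderivWithin hS, formCoeff_reMul]

theorem gradientWithin_eq (S : Set ℂ) (f : ℂ → ℝ) (z : ℂ) :
    gradientWithin f S z = (starRingEnd ℂ) (wgrad S f z) := by
  rw [gradientWithin, LinearIsometryEquiv.symm_apply_eq]
  ext v
  rw [toDual_apply_apply, Complex.inner, ← reMul_formCoeff (fderivWithin ℝ f S z)]
  simp [wgrad]
  ring

theorem intensity_eq (S : Set ℂ) (f : ℂ → ℝ) (z : ℂ) : intensity S f z = ‖wgrad S f z‖ := by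
  rw [intensity, gradientWithin_eq, Complex.norm_conj]

/-- The integral of an exact form along a closed curve inside `O`. -/
theorem IsJordanLoop.integral_mul_deriv_eq_zero {γ : ℝ → ℂ} {Γ O : Set ℂ}
    (hγ : IsJordanLoop γ Γ) (hΓ : Γ ⊆ O) {H P : ℂ → ℂ} (hH : ContinuousOn H O)
    (hP : ∀ z ∈ O, HasDerivAt P (H z) z) : ∫ t in (0 : ℝ)..1, H (γ t) * deriv γ t = 0 := by
  have h1 := intervalIntegral.integral_eq_sub_of_hasDerivAt (a := 0) (b := 1)
    (f := fun t => P (γ t)) (f' := fun t => H (γ t) * deriv γ t)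
    (fun t _ => by
      have := (hP _ (hΓ (hγ.mem t))).scomp t (hγ.hasDerivAt t)
      exact this.congr_deriv (by simp [mul_comm]))
    (((hH.comp_continuous hγ.continuous fun t => hΓ (hγ.mem t)).mul
      hγ.continuous_deriv).intervalIntegrable _ _)
  rw [h1, show γ 1 = γ 0 by simpa using hγ.periodic 0, sub_self]

/-- The integral of an exact form along a boundary curve. -/
theorem IsJordanLoop.integral_mul_deriv_eq_zero_of_collar {γ : ℝ → ℂ}
    {C O S : Set ℂ} {τ : ℝ} (hγ : IsJordanLoop γ C) (hτ : HasCollar γ O τ) (hS : O ∪ C = S)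
    {H P : ℂ → ℂ} (hH : ContinuousOn H S) (hP : ∀ z ∈ O, HasDerivAt P (H z) z) :
    ∫ t in (0 : ℝ)..1, H (γ t) * deriv γ t = 0 := by
  obtain ⟨-, η, hη, hcol⟩ := hτ
  -- Clamping s to [0, η/2] defines J for all real s, with every curve inside S and the boundary
  -- itself at s = 0.
  set cl : ℝ → ℝ := fun s => max 0 (min s (η / 2)) with hcl
  have hclc : Continuous cl := by fun_prop
  have hcl0 : cl 0 = 0 := by simp [hcl]
  have hcurve : ∀ s t : ℝ, tube γ (t + (τ * s : ℝ) * Complex.I) =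
      γ t + (τ * s : ℝ) * Complex.I * deriv γ t := fun s t => by simp [tube]
  have hmem : ∀ s t : ℝ, γ t + (τ * cl s : ℝ) * Complex.I * deriv γ t ∈ S := fun s t => by
    rw [← hS]
    rcases le_or_gt s 0 with h0 | h0
    · have : cl s = 0 := by
        rw [hcl]
        simp only
        rw [max_eq_left ((min_le_left _ _).trans h0)]
      rw [this]
      simpa using Or.inr (hγ.mem t)
    · refine Or.inl ?_
      rw [← hcurve]
      refine hcol t _ ?_ ?_
      · exact lt_max_of_lt_right (lt_min h0 (half_pos hη))
      · exact max_lt hη ((min_le_right _ _).trans_lt (half_lt_self hη))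
  set J : ℝ → ℂ := fun s => ∫ t in (0 : ℝ)..1,
    H (γ t + (τ * cl s : ℝ) * Complex.I * deriv γ t) *
      (deriv γ t + (τ * cl s : ℝ) * Complex.I * deriv (deriv γ) t) with hJ
  have hγc := hγ.continuous
  have hγ'c := hγ.continuous_deriv
  have hγ''c : Continuous (deriv (deriv γ)) :=
    ((contDiff_infty_iff_deriv.1 hγ.contDiff_deriv).2).continuous
  have hJc : Continuous J := by
    refine intervalIntegral.continuous_parametric_intervalIntegral_of_continuous' ?_ 0 1
    refine Continuous.mul ?_ ?_
    · exact hH.comp_continuous (by fun_prop) fun x => hmem x.1 x.2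
    · fun_prop
  have hJ0 : ∀ s : ℝ, 0 < s → J s = 0 := fun s hs => by
    have hO : ∀ t, γ t + (τ * cl s : ℝ) * Complex.I * deriv γ t ∈ O := fun t => by
      rw [← hcurve]
      refine hcol t _ ?_ ?_
      · exact lt_max_of_lt_right (lt_min hs (half_pos hη))
      · exact max_lt hη ((min_le_right _ _).trans_lt (half_lt_self hη))
    have h1 := intervalIntegral.integral_eq_sub_of_hasDerivAt (a := 0) (b := 1)
      (f := fun t => P (γ t + (τ * cl s : ℝ) * Complex.I * deriv γ t))
      (f' := fun t => H (γ t + (τ * cl s : ℝ) * Complex.I * deriv γ t) *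
        (deriv γ t + (τ * cl s : ℝ) * Complex.I * deriv (deriv γ) t))
      (fun t _ => by
        have h2 : HasDerivAt (fun t => γ t + (τ * cl s : ℝ) * Complex.I * deriv γ t)
            (deriv γ t + (τ * cl s : ℝ) * Complex.I * deriv (deriv γ) t) t :=
          (hγ.hasDerivAt t).add ((hγ.hasDerivAt_deriv t).const_mul _)
        have := (hP _ (hO t)).scomp t h2
        exact this.congr_deriv (by simp [mul_comm]))
      (by
        refine Continuous.intervalIntegrable (Continuous.mul ?_ (by fun_prop)) _ _
        exact hH.comp_continuous (by fun_prop) fun t => hmem s t)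
    rw [hJ]
    simp only
    rw [h1, show γ 1 = γ 0 by simpa using hγ.periodic 0,
      show deriv γ 1 = deriv γ 0 by simpa using hγ.periodic_deriv 0, sub_self]
  -- The primitive exists only on O, so exactness gives J = 0 for s > 0; continuity of H up to the
  -- boundary carries this to s = 0.
  have h1 : Tendsto J (𝓝[>] 0) (𝓝 (J 0)) := (hJc.tendsto 0).mono_left nhdsWithin_le_nhds
  have h2 : J 0 = 0 := by
    refine tendsto_nhds_unique h1 (tendsto_const_nhds.congr' ?_)
    filter_upwards [self_mem_nhdsWithin] with s hs using (hJ0 s hs).symm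
  rw [hJ] at h2
  simpa [hcl0] using h2

/-- A field `f = c + k log |F|` on the open set `O`, up to the boundary curve `C`, where `F` maps
`O` conformally to a punctured disc. -/
structure IsGreenField (S O C : Set ℂ) (f : ℂ → ℝ) (c k : ℝ) (F ψ Q L : ℂ → ℂ) (p : ℂ)
    (ε q : ℝ) : Prop where
  isOpen : IsOpen O
  union_eq : O ∪ C = S
  exists_loop : ∃ γ, IsJordanLoop γ C
  collar : ∀ γ, IsJordanParam γ C → ∃ τ, HasCollar γ O τ
  regular : ContDiffOn ℝ 2 f S
  boundary : ∀ z ∈ C, f z = c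
  k_ne_zero : k ≠ 0
  differentiableOn : DifferentiableOn ℂ F O
  mapsTo : MapsTo F O (ball 0 1 \ {0})
  deriv_ne_zero : ∀ z ∈ O, deriv F z ≠ 0
  eq_log : ∀ z ∈ O, f z = c + k * Real.log ‖F z‖
  differentiableOn_inv : DifferentiableOn ℂ ψ (ball 0 1 \ {0})
  mapsTo_inv : MapsTo ψ (ball 0 1 \ {0}) O
  right_inv : ∀ b ∈ ball (0 : ℂ) 1 \ {0}, F (ψ b) = b
  left_inv : ∀ z ∈ O, ψ (F z) = z
  differentiableOn_Q : DifferentiableOn ℂ Q (ball 0 1)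
  hasDerivAt_div : ∀ z ∈ O, HasDerivAt (fun w => F w / deriv F w) (Q (F z)) z
  Q_zero : Q 0 = q
  q_sq : q ^ 2 = 1
  hasDerivAt_L : ∀ z ∈ O, HasDerivAt L (deriv F z / F z - ε / (z - p)) z
  ε_sq : ε ^ 2 = 1
  notMem : p ∉ S

namespace IsGreenField

variable {S O C : Set ℂ} {f : ℂ → ℝ} {c k : ℝ} {F ψ Q L : ℂ → ℂ} {p : ℂ} {ε q : ℝ}

theorem subset_left (h : IsGreenField S O C f c k F ψ Q L p ε q) : O ⊆ S :=
  h.union_eq ▸ subset_union_left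

theorem subset_right (h : IsGreenField S O C f c k F ψ Q L p ε q) : C ⊆ S :=
  h.union_eq ▸ subset_union_right

theorem exists_ball (h : IsGreenField S O C f c k F ψ Q L p ε q) {z : ℂ} (hz : z ∈ C) :
    ∃ ν : ℂ, ‖ν‖ = 1 ∧ ∃ R > 0, ball (z + (R : ℝ) * ν) R ⊆ O := by
  obtain ⟨γ, hγ⟩ := h.exists_loop
  obtain ⟨γ₁, hγ₁⟩ := hγ.exists_isJordanParam
  obtain ⟨τ, hτ⟩ := h.collar γ₁ hγ₁
  obtain ⟨t, rfl⟩ := hγ₁.isJordanLoop.exists_eq hz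
  obtain ⟨ν, hν, hev⟩ := hγ₁.isJordanLoop.eventually_ball_subset hτ t
  obtain ⟨R, hR, hR0⟩ := (hev.and self_mem_nhdsWithin).exists
  exact ⟨ν, hν, R, hR0, hR⟩

theorem subset_closure (h : IsGreenField S O C f c k F ψ Q L p ε q) : S ⊆ closure O := by
  obtain ⟨γ, hγ⟩ := h.exists_loop
  obtain ⟨γ₁, hγ₁⟩ := hγ.exists_isJordanParam
  obtain ⟨τ, hτ⟩ := h.collar γ₁ hγ₁
  rw [← h.union_eq]
  exact union_subset _root_.subset_closure (hτ.subset_closure hγ₁.isJordanLoop)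

theorem mem_nhds (h : IsGreenField S O C f c k F ψ Q L p ε q) {z : ℂ} (hz : z ∈ O) : S ∈ 𝓝 z :=
  mem_of_superset (h.isOpen.mem_nhds hz) h.subset_left

/-- At a boundary point S contains a touching disc, which is convex with nonempty interior. This
makes derivatives within S well defined there. -/
theorem uniqueDiffOn (h : IsGreenField S O C f c k F ψ Q L p ε q) : UniqueDiffOn ℝ S := by
  intro z hz
  rw [← h.union_eq] at hz
  rcases hz with hz | hz
  · exact uniqueDiffWithinAt_of_mem_nhds (h.mem_nhds hz)
  · obtain ⟨ν, hν, R, hR, hball⟩ := h.exists_ball hz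
    refine UniqueDiffWithinAt.mono (uniqueDiffWithinAt_convex (convex_ball (z + (R : ℝ) * ν) R) ?_ ?_)
      (hball.trans h.subset_left)
    · rw [isOpen_ball.interior_eq]
      exact ⟨_, mem_ball_self hR⟩
    · rw [closure_ball _ hR.ne', mem_closedBall, dist_eq_norm]
      simp [hν, abs_of_pos hR]

theorem F_ne_zero (h : IsGreenField S O C f c k F ψ Q L p ε q) {z : ℂ} (hz : z ∈ O) : F z ≠ 0 :=
  (h.mapsTo hz).2

theorem norm_F_lt_one (h : IsGreenField S O C f c k F ψ Q L p ε q) {z : ℂ} (hz : z ∈ O) :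
    ‖F z‖ < 1 := by simpa using (h.mapsTo hz).1

theorem analyticOnNhd (h : IsGreenField S O C f c k F ψ Q L p ε q) : AnalyticOnNhd ℂ F O :=
  h.differentiableOn.analyticOnNhd h.isOpen

theorem hasDerivAt_F (h : IsGreenField S O C f c k F ψ Q L p ε q) {z : ℂ} (hz : z ∈ O) :
    HasDerivAt F (deriv F z) z := (h.analyticOnNhd z hz).differentiableAt.hasDerivAt

theorem wgrad_of_mem (h : IsGreenField S O C f c k F ψ Q L p ε q) {z : ℂ} (hz : z ∈ O) :
    wgrad S f z = k * (deriv F z / F z) := by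
  refine wgrad_eq (h.uniqueDiffOn z (h.subset_left hz)) (HasFDerivAt.hasFDerivWithinAt ?_)
  have h1 : HasFDerivAt F ((ContinuousLinearMap.toSpanSingleton ℂ (deriv F z)).restrictScalars ℝ) z :=
    (h.hasDerivAt_F hz).hasFDerivAt.restrictScalars ℝ
  have h2 := HasFDerivAt.comp (g := fun w : ℂ => Real.log ‖w‖) z
    (hasFDerivAt_log_norm (h.F_ne_zero hz)) h1
  have h3 := ((h2.const_mul k).const_add c)
  refine (h3.congr_of_eventuallyEq ?_).congr_fderiv ?_
  · filter_upwards [h.isOpen.mem_nhds hz] with w hw using h.eq_log w hw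
  · ext v
    have : k * (deriv F z / F z) * v = k * ((F z)⁻¹ * (v * deriv F z)) := by ring
    rw [reMul_apply, this, Complex.re_ofReal_mul]
    simp

theorem wgrad_ne_zero_of_mem (h : IsGreenField S O C f c k F ψ Q L p ε q) {z : ℂ} (hz : z ∈ O) :
    wgrad S f z ≠ 0 := by
  rw [h.wgrad_of_mem hz]
  exact mul_ne_zero (by exact_mod_cast h.k_ne_zero)
    (div_ne_zero (h.deriv_ne_zero z hz) (h.F_ne_zero hz))

/-- The Hopf boundary lemma. -/
theorem wgrad_ne_zero (h : IsGreenField S O C f c k F ψ Q L p ε q) {z : ℂ} (hz : z ∈ S) :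
    wgrad S f z ≠ 0 := by
  have hz' := hz
  rw [← h.union_eq] at hz
  rcases hz with hz | hz
  · exact h.wgrad_ne_zero_of_mem hz
  intro h0
  obtain ⟨ν, hν, R, hR, hball⟩ := h.exists_ball hz
  set a := z + (R : ℝ) * ν with ha
  have hd : HasFDerivWithinAt f (reMul 0) S z := by
    rw [← h0]
    exact hasFDerivWithinAt_reMul_wgrad ((h.regular.differentiableOn (by norm_num)) z hz')
  have haO : a ∈ O := hball (mem_ball_self hR)
  -- Schwarz–Pick on the touching disc shows that f moves away from its boundary value along the
  -- normal with speed at least this κ; a vanishing gradient would eventually allow only κ/2.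
  have hκ : 0 < |k| * ((1 - ‖F a‖) ^ 2 / (2 * R)) := by
    have h1 := h.norm_F_lt_one haO
    have h2 := abs_pos.2 h.k_ne_zero
    have h3 : 0 < 1 - ‖F a‖ := by linarith
    positivity
  set κ := |k| * ((1 - ‖F a‖) ^ 2 / (2 * R)) with hκd
  have hlo := (hasFDerivWithinAt_iff_isLittleO.1 hd).def (half_pos hκ)
  have hpath : Tendsto (fun s : ℝ => z + s * ν) (𝓝[>] 0) (𝓝[S] z) := by
    refine tendsto_nhdsWithin_iff.2 ⟨?_, ?_⟩
    · have : Continuous fun s : ℝ => z + s * ν := by fun_prop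
      have h1 := this.tendsto 0
      simp only [Complex.ofReal_zero, zero_mul, add_zero] at h1
      exact h1.mono_left nhdsWithin_le_nhds
    · filter_upwards [self_mem_nhdsWithin, nhdsWithin_le_nhds (gt_mem_nhds hR)] with s hs0 hsR
      have hs0 : 0 < s := hs0
      refine h.subset_left (hball ?_)
      rw [mem_ball, dist_eq_norm, ha]
      have : z + (s : ℂ) * ν - (z + R * ν) = ((s - R : ℝ) : ℂ) * ν := by push_cast; ring
      rw [this, norm_mul, hν, mul_one, Complex.norm_real, Real.norm_eq_abs, abs_of_neg (by linarith)]
      linarith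
  obtain ⟨s, hs, hs0, hsR⟩ := ((hpath.eventually hlo).and
    (Filter.Eventually.and self_mem_nhdsWithin (nhdsWithin_le_nhds (gt_mem_nhds hR)))).exists
  have hs0 : 0 < s := hs0
  have hsa : ‖z + (s : ℂ) * ν - a‖ = R - s := by
    have : z + (s : ℂ) * ν - a = ((s - R : ℝ) : ℂ) * ν := by rw [ha]; push_cast; ring
    rw [this, norm_mul, hν, mul_one, Complex.norm_real, Real.norm_eq_abs, abs_of_neg (by linarith)]
    ring
  have hsball : z + (s : ℂ) * ν ∈ ball a R := by
    rw [mem_ball, dist_eq_norm, hsa]; linarith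
  have hsO := hball hsball
  have hpick := one_sub_mul_le_one_sub_norm_sq (F := F) (h.differentiableOn.mono hball)
    (fun w hw => (h.mapsTo (hball hw)).1) hsball
  rw [hsa] at hpick
  have hF1 := h.norm_F_lt_one hsO
  have hF0 : 0 < ‖F (z + s * ν)‖ := norm_pos_iff.2 (h.F_ne_zero hsO)
  have hlog : Real.log ‖F (z + s * ν)‖ ≤ ‖F (z + s * ν)‖ - 1 := Real.log_le_sub_one_of_pos hF0
  have hval : |f (z + s * ν) - f z| = |k| * (-Real.log ‖F (z + s * ν)‖) := by
    rw [h.eq_log _ hsO, h.boundary z hz, add_sub_cancel_left, abs_mul,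
      abs_of_neg (Real.log_neg hF0 hF1)]
  have hlower : κ * s ≤ |f (z + s * ν) - f z| := by
    rw [hval, hκd, mul_assoc]
    refine mul_le_mul_of_nonneg_left ?_ (abs_nonneg k)
    -- −log r ≥ 1 − r ≥ (1 − r²)/2 for 0 < r < 1.
    have h1 : 1 - ‖F (z + s * ν)‖ ^ 2 ≤ 2 * (-Real.log ‖F (z + s * ν)‖) := by nlinarith
    have h2 : (1 - (R - s) / R) * (1 - ‖F a‖) ^ 2 = 2 * ((1 - ‖F a‖) ^ 2 / (2 * R) * s) := by
      field_simp
      ring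
    linarith
  have hupper : |f (z + s * ν) - f z| ≤ κ / 2 * s := by
    have h1 : reMul 0 (z + s * ν - z) = 0 := by simp
    rw [h1, sub_zero, Real.norm_eq_abs, add_sub_cancel_left, norm_mul, hν, mul_one,
      Complex.norm_real, Real.norm_of_nonneg hs0.le] at hs
    exact hs
  nlinarith [mul_pos hκ hs0]

theorem contDiffOn_wgrad (h : IsGreenField S O C f c k F ψ Q L p ε q) :
    ContDiffOn ℝ 1 (wgrad S f) S := by
  have h1 : ContDiffOn ℝ 1 (fun z => fderivWithin ℝ f S z) S :=
    h.regular.fderivWithin h.uniqueDiffOn (by norm_num)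
  have h2 : ∀ v : ℂ, ContDiffOn ℝ 1 (fun z => ((fderivWithin ℝ f S z v : ℝ) : ℂ)) S := fun v =>
    Complex.ofRealCLM.contDiff.comp_contDiffOn (h1.clm_apply contDiffOn_const)
  exact (h2 1).sub (contDiffOn_const.mul (h2 Complex.I))

/-- The gradient is k divided by F/F', and the derivative of F/F' is Q∘F. -/
theorem hasDerivAt_logDeriv (h : IsGreenField S O C f c k F ψ Q L p ε q) {z : ℂ} (hz : z ∈ O) :
    HasDerivAt (fun w => k * (deriv F w / F w))
      (-(k * Q (F z) * (deriv F z / F z) ^ 2)) z := by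
  have h1 := (h.hasDerivAt_div z hz).inv (div_ne_zero (h.F_ne_zero hz) (h.deriv_ne_zero z hz))
  have h2 := h1.const_mul (k : ℂ)
  refine (h2.congr_deriv ?_).congr_of_eventuallyEq ?_
  · have := h.F_ne_zero hz
    have := h.deriv_ne_zero z hz
    field_simp
  · exact Eventually.of_forall fun w => by simp [inv_div]

theorem fderivWithin_wgrad_of_mem (h : IsGreenField S O C f c k F ψ Q L p ε q) {z : ℂ}
    (hz : z ∈ O) (v : ℂ) : fderivWithin ℝ (wgrad S f) S z v =
      -(k * Q (F z) * (deriv F z / F z) ^ 2) * v := by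
  have h1 : HasFDerivAt (wgrad S f) ((ContinuousLinearMap.toSpanSingleton ℂ
      (-(k * Q (F z) * (deriv F z / F z) ^ 2))).restrictScalars ℝ) z := by
    refine ((h.hasDerivAt_logDeriv hz).hasFDerivAt.restrictScalars ℝ).congr_of_eventuallyEq ?_
    filter_upwards [h.isOpen.mem_nhds hz] with w hw using h.wgrad_of_mem hw
  rw [h1.hasFDerivWithinAt.fderivWithin (h.uniqueDiffOn z (h.subset_left hz))]
  simp [mul_comm]

theorem wgradDeriv_of_mem (h : IsGreenField S O C f c k F ψ Q L p ε q) {z : ℂ} (hz : z ∈ O) :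
    wgradDeriv S f z = -(k * Q (F z) * (deriv F z / F z) ^ 2) := by
  rw [wgradDeriv, h.fderivWithin_wgrad_of_mem hz, mul_one]

theorem continuousOn_fderivWithin_wgrad (h : IsGreenField S O C f c k F ψ Q L p ε q) (v : ℂ) :
    ContinuousOn (fun z => fderivWithin ℝ (wgrad S f) S z v) S :=
  (h.contDiffOn_wgrad.continuousOn_fderivWithin h.uniqueDiffOn le_rfl).clm_apply continuousOn_const

theorem continuousOn_wgrad (h : IsGreenField S O C f c k F ψ Q L p ε q) :
    ContinuousOn (wgrad S f) S := h.contDiffOn_wgrad.continuousOn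

theorem continuousOn_wgradDeriv (h : IsGreenField S O C f c k F ψ Q L p ε q) :
    ContinuousOn (wgradDeriv S f) S := h.continuousOn_fderivWithin_wgrad 1

/-- Complex linearity of the derivative holds on O by holomorphy and passes to the boundary by
continuity, since O is dense in S. -/
theorem fderivWithin_wgrad (h : IsGreenField S O C f c k F ψ Q L p ε q) {z : ℂ} (hz : z ∈ S)
    (v : ℂ) : fderivWithin ℝ (wgrad S f) S z v = wgradDeriv S f z * v := by
  have h1 := (h.continuousOn_fderivWithin_wgrad v z hz).mono h.subset_left
  have h2 := ((h.continuousOn_wgradDeriv z hz).mono h.subset_left).mul_const v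
  have : (𝓝[O] z).NeBot := mem_closure_iff_nhdsWithin_neBot.1 (h.subset_closure hz)
  refine tendsto_nhds_unique h1.tendsto (h2.tendsto.congr' ?_)
  filter_upwards [self_mem_nhdsWithin] with w hw
  rw [h.fderivWithin_wgrad_of_mem hw, h.wgradDeriv_of_mem hw]

theorem hasFDerivWithinAt_wgrad (h : IsGreenField S O C f c k F ψ Q L p ε q) {z : ℂ} (hz : z ∈ S) :
    HasFDerivWithinAt (wgrad S f) (ContinuousLinearMap.mul ℝ ℂ (wgradDeriv S f z)) S z := by
  refine ((h.contDiffOn_wgrad.differentiableOn one_ne_zero) z hz).hasFDerivWithinAt.congr_fderiv ?_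
  ext v
  simp [h.fderivWithin_wgrad hz]

end IsGreenField

/-! ### Line integrals over level curves -/

theorem cross_outwardNormal (γ : ℝ → ℂ) (t : ℝ) (w : ℂ) :
    cross (outwardNormal γ t) ((starRingEnd ℂ) w) = (w * deriv γ t).re / ‖deriv γ t‖ := by
  have h1 : outwardNormal γ t = ((‖deriv γ t‖⁻¹ : ℝ) : ℂ) * (-Complex.I * deriv γ t) := by
    rw [outwardNormal]; push_cast; ring
  rw [cross, h1, Complex.re_ofReal_mul, Complex.im_ofReal_mul]
  simp
  ring

theorem signedCurvature_eq (γ : ℝ → ℂ) (t : ℝ) (h : deriv γ t ≠ 0) :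
    signedCurvature γ t = (deriv (deriv γ) t / deriv γ t).im / ‖deriv γ t‖ := by
  have h1 : ‖deriv γ t‖ ≠ 0 := norm_ne_zero_iff.2 h
  rw [signedCurvature, cross, Complex.div_im, Complex.normSq_eq_norm_sq]
  field_simp

namespace IsGreenField

variable {S O C : Set ℂ} {f : ℂ → ℝ} {c k : ℝ} {F ψ Q L : ℂ → ℂ} {p : ℂ} {ε q : ℝ}

theorem ne_of_mem (h : IsGreenField S O C f c k F ψ Q L p ε q) {z : ℂ} (hz : z ∈ O) : f z ≠ c := by
  rw [h.eq_log z hz]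
  have h1 := Real.log_neg (norm_pos_iff.2 (h.F_ne_zero hz)) (h.norm_F_lt_one hz)
  simpa using ⟨h.k_ne_zero, by simpa using h.F_ne_zero hz, (h.norm_F_lt_one hz).ne, by linarith [norm_nonneg (F z)]⟩

theorem levelSet_eq (h : IsGreenField S O C f c k F ψ Q L p ε q) : levelSet S f c = C := by
  ext z
  constructor
  · rintro ⟨hz, hfz⟩
    rw [← h.union_eq] at hz
    exact hz.resolve_left fun hzO => h.ne_of_mem hzO hfz
  · exact fun hz => ⟨h.subset_right hz, h.boundary z hz⟩

theorem levelSet_subset (h : IsGreenField S O C f c k F ψ Q L p ε q) {φ : ℝ} (hφ : φ ≠ c) :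
    levelSet S f φ ⊆ O := by
  rintro z ⟨hz, hfz⟩
  rw [← h.union_eq] at hz
  exact hz.resolve_right fun hzC => hφ (by rw [← hfz, h.boundary z hzC])

/-- The integral of an exact form along a level curve. -/
theorem integral_eq_zero (h : IsGreenField S O C f c k F ψ Q L p ε q) {φ : ℝ} {γ : ℝ → ℂ}
    (hγ : IsJordanParam γ (levelSet S f φ)) {H P : ℂ → ℂ} (hH : ContinuousOn H S)
    (hP : ∀ z ∈ O, HasDerivAt P (H z) z) : ∫ t in (0 : ℝ)..1, H (γ t) * deriv γ t = 0 := by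
  rcases eq_or_ne φ c with rfl | hφ
  · rw [h.levelSet_eq] at hγ
    obtain ⟨τ, hτ⟩ := h.collar γ hγ
    exact hγ.isJordanLoop.integral_mul_deriv_eq_zero_of_collar hτ h.union_eq hH hP
  · exact hγ.isJordanLoop.integral_mul_deriv_eq_zero (h.levelSet_subset hφ)
      (hH.mono h.subset_left) hP

/-- (A(b) − A(0))/b extends holomorphically to the whole disc, so it has a primitive there, which is
pulled back by F. The lack of simple connectivity of O is thereby bypassed. -/
theorem exists_primitive_comp (h : IsGreenField S O C f c k F ψ Q L p ε q) {A : ℂ → ℂ}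
    (hA : DifferentiableOn ℂ A (ball 0 1)) :
    ∃ P : ℂ → ℂ, ∀ z ∈ O, HasDerivAt P ((A (F z) - A 0) / F z * deriv F z) z := by
  have h1 : DifferentiableOn ℂ (dslope A 0) (ball 0 1) :=
    (Complex.differentiableOn_dslope (ball_mem_nhds _ one_pos)).2 hA
  obtain ⟨P, hP⟩ := h1.isExactOn_ball
  refine ⟨fun z => P (F z), fun z hz => ?_⟩
  have := (hP (F z) (h.mapsTo hz).1).comp z (h.hasDerivAt_F hz)
  rwa [dslope_of_ne _ (h.F_ne_zero hz), slope_def_field, sub_zero] at this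

theorem exists_primitive_wgrad (h : IsGreenField S O C f c k F ψ Q L p ε q) :
    ∃ P : ℂ → ℂ, ∀ z ∈ O, HasDerivAt P (wgrad S f z - k * ε / (z - p)) z := by
  refine ⟨fun z => k * L z, fun z hz => ?_⟩
  refine ((h.hasDerivAt_L z hz).const_mul (k : ℂ)).congr_deriv ?_
  rw [h.wgrad_of_mem hz]
  ring

/-- Writing g for the complex gradient, g'/g = −Q(F)F'/F and (q/k)g = qF'/F with q = Q(0). This
computes the total curvature of a level curve up to sign. -/
theorem exists_primitive_logDeriv (h : IsGreenField S O C f c k F ψ Q L p ε q) :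
    ∃ P : ℂ → ℂ, ∀ z ∈ O,
      HasDerivAt P (wgradDeriv S f z / wgrad S f z + q / k * wgrad S f z) z := by
  obtain ⟨P, hP⟩ := h.exists_primitive_comp h.differentiableOn_Q
  refine ⟨fun z => -P z, fun z hz => ?_⟩
  refine (hP z hz).neg.congr_deriv ?_
  rw [h.wgrad_of_mem hz, h.wgradDeriv_of_mem hz, h.Q_zero]
  have h1 : (k : ℂ) ≠ 0 := by exact_mod_cast h.k_ne_zero
  have h2 := h.F_ne_zero hz
  have h3 := h.deriv_ne_zero z hz
  field_simp
  ring

/-- g'²/g³ = k⁻¹Q(F)²F'/F for the complex gradient g, and its polar part is k⁻¹F'/F = g/k² because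
Q(0)² = 1. This is the conserved form. -/
theorem exists_primitive_sq (h : IsGreenField S O C f c k F ψ Q L p ε q) :
    ∃ P : ℂ → ℂ, ∀ z ∈ O,
      HasDerivAt P (wgradDeriv S f z ^ 2 / wgrad S f z ^ 3 - wgrad S f z / k ^ 2) z := by
  obtain ⟨P, hP⟩ := h.exists_primitive_comp (h.differentiableOn_Q.pow 2)
  refine ⟨fun z => (1 / k) * P z, fun z hz => ?_⟩
  refine ((hP z hz).const_mul (1 / k : ℂ)).congr_deriv ?_
  have hq : Q 0 ^ 2 = 1 := by rw [h.Q_zero]; exact_mod_cast h.q_sq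
  simp only [Pi.pow_apply]
  rw [h.wgrad_of_mem hz, h.wgradDeriv_of_mem hz, hq]
  have h1 : (k : ℂ) ≠ 0 := by exact_mod_cast h.k_ne_zero
  have h2 := h.F_ne_zero hz
  have h3 := h.deriv_ne_zero z hz
  field_simp

/-- log E is the real part of a local branch of log g, where g is the complex gradient. -/
theorem wgrad_log_intensity (h : IsGreenField S O C f c k F ψ Q L p ε q) {z : ℂ} (hz : z ∈ S) :
    HasFDerivWithinAt (fun z => Real.log (intensity S f z))
      (reMul (wgradDeriv S f z / wgrad S f z)) S z := by
  have h1 := HasFDerivAt.comp_hasFDerivWithinAt (g := fun w : ℂ => Real.log ‖w‖) z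
    (hasFDerivAt_log_norm (h.wgrad_ne_zero hz)) (h.hasFDerivWithinAt_wgrad hz)
  refine (h1.congr_fderiv ?_).congr (fun w _ => by simp [intensity_eq]) (by simp [intensity_eq])
  ext v
  have : wgradDeriv S f z / wgrad S f z * v = (wgrad S f z)⁻¹ * (wgradDeriv S f z * v) := by ring
  rw [reMul_apply, this]
  simp

theorem wgrad_one_div_intensity (h : IsGreenField S O C f c k F ψ Q L p ε q) {z : ℂ}
    (hz : z ∈ S) : HasFDerivWithinAt (fun z => 1 / intensity S f z)
      (reMul (-(1 / intensity S f z : ℝ) * (wgradDeriv S f z / wgrad S f z))) S z := by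
  have h1 := ((h.wgrad_log_intensity hz).neg).exp
  have hpos : ∀ w ∈ S, 0 < intensity S f w := fun w hw => by
    rw [intensity_eq]; exact norm_pos_iff.2 (h.wgrad_ne_zero hw)
  have heq : ∀ w ∈ S, 1 / intensity S f w = Real.exp (-Real.log (intensity S f w)) := fun w hw => by
    rw [Real.exp_neg, Real.exp_log (hpos w hw), one_div]
  refine (h1.congr_fderiv ?_).congr heq (heq z hz)
  have hz' := heq z hz
  ext v
  rw [reMul_apply, neg_mul, neg_mul, Complex.neg_re, mul_assoc, Complex.re_ofReal_mul, hz']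
  simp

/-- The integrals over a level curve, in terms of the logarithmic derivative `x + i y` of the
gradient along the curve and the flux density `w`. -/
theorem exists_level_integrals (h : IsGreenField S O C f c k F ψ Q L p ε q) {φ : ℝ} {γ : ℝ → ℂ}
    (hγ : IsJordanParam γ (levelSet S f φ)) :
    ∃ x y w : ℝ → ℝ, Continuous x ∧ Continuous y ∧ Continuous w ∧ (∀ t, 0 < w t) ∧
      (∀ t, intensity S f (γ t) * ‖deriv γ t‖ = w t) ∧
      (∀ t, signedCurvature γ t * ‖deriv γ t‖ = -y t) ∧
      (∀ t, tangentialDeriv S (fun z => Real.log (intensity S f z)) γ t * ‖deriv γ t‖ = x t) ∧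
      (∀ t, tangentialDeriv S (fun z => 1 / intensity S f z) γ t * w t = -x t) ∧
      (∫ t in (0 : ℝ)..1, w t) = 2 * Real.pi * |k| ∧
      (∫ t in (0 : ℝ)..1, y t) ^ 2 = 4 * Real.pi ^ 2 ∧
      (∫ t in (0 : ℝ)..1, y t ^ 2 / w t) - (∫ t in (0 : ℝ)..1, x t ^ 2 / w t) =
        2 * Real.pi / |k| := by
  have hl := hγ.isJordanLoop
  have hS : ∀ t, γ t ∈ S := fun t => (hl.mem t).1
  have hk := h.k_ne_zero
  have hkC : (k : ℂ) ≠ 0 := by exact_mod_cast hk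
  set g : ℝ → ℂ := fun t => wgrad S f (γ t) with hg
  set gd : ℝ → ℂ := fun t => wgradDeriv S f (γ t) with hgd
  set v : ℝ → ℂ := deriv γ with hv
  have hgc : Continuous g := h.continuousOn_wgrad.comp_continuous hl.continuous hS
  have hgdc : Continuous gd := h.continuousOn_wgradDeriv.comp_continuous hl.continuous hS
  have hvc : Continuous v := hl.continuous_deriv
  have hg0 : ∀ t, g t ≠ 0 := fun t => h.wgrad_ne_zero (hS t)
  have hv0 : ∀ t, v t ≠ 0 := hl.regular
  set a : ℝ → ℂ := fun t => gd t * v t / g t with ha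
  have hac : Continuous a := (hgdc.mul hvc).div hgc hg0
  set η : ℝ → ℝ := fun t => (g t * v t).im with hη
  have hηc : Continuous η := Complex.continuous_im.comp (hgc.mul hvc)
  -- Re(gγ') is the derivative of f along γ, and f is constant there.
  have hre : ∀ t, (g t * v t).re = 0 := fun t => by
    have h1 := (hasFDerivWithinAt_reMul_wgrad
      ((h.regular.differentiableOn (by norm_num)) (γ t) (hS t))).comp_hasDerivAt t
      (hl.hasDerivAt t) (Eventually.of_forall hS)
    have h2 : f ∘ γ = fun _ => φ := funext fun t => (hl.mem t).2
    rw [h2] at h1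
    exact h1.unique (hasDerivAt_const t φ)
  have hgv : ∀ t, g t * v t = Complex.I * η t := fun t => by
    apply Complex.ext
    · simp [hre t]
    · simp [hη]
  have hη0 : ∀ t, η t ≠ 0 := fun t h0 => mul_ne_zero (hg0 t) (hv0 t) (by rw [hgv, h0]; simp)
  have hw : ∀ t, ‖g t‖ * ‖v t‖ = |η t| := fun t => by
    rw [← norm_mul, hgv, norm_mul, Complex.norm_I, one_mul, Complex.norm_real, Real.norm_eq_abs]
  -- the curvature
  have hcurv : ∀ t, (deriv v t / v t).im = -(a t).im := fun t => by
    have h1 : HasDerivAt (fun t => g t * v t) (gd t * v t * v t + g t * deriv v t) t :=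
      ((h.hasFDerivWithinAt_wgrad (hS t)).comp_hasDerivAt t (hl.hasDerivAt t)
        (Eventually.of_forall hS)).mul (hl.hasDerivAt_deriv t)
    have h2 : (gd t * v t * v t + g t * deriv v t).re = 0 := by
      have h3 := (Complex.reCLM.hasFDerivAt.comp_hasDerivAt t h1)
      have h4 : (Complex.reCLM ∘ fun t => g t * v t) = fun _ => 0 := funext fun t => hre t
      rw [h4] at h3
      exact h3.unique (hasDerivAt_const t 0)
    have h5 : a t + deriv v t / v t = (gd t * v t * v t + g t * deriv v t) / (Complex.I * η t) := by
      rw [← hgv, ha]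
      have := hg0 t
      have := hv0 t
      field_simp
    have h6 : (a t + deriv v t / v t).im = 0 := by
      rw [h5, Complex.div_im, h2]
      simp
    rw [Complex.add_im] at h6
    linarith
  -- the sign
  obtain ⟨s, hs, hsη⟩ : ∃ s : ℝ, s * s = 1 ∧ ∀ t, |η t| = s * η t := by
    by_cases hpos : ∀ t, 0 < η t
    · exact ⟨1, by norm_num, fun t => by rw [abs_of_pos (hpos t), one_mul]⟩
    · push Not at hpos
      obtain ⟨t₁, ht₁⟩ := hpos
      refine ⟨-1, by norm_num, fun t => ?_⟩
      have : η t < 0 := by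
        by_contra hge
        obtain ⟨x, hx⟩ := mem_range_of_exists_le_of_exists_ge hηc ⟨t₁, ht₁⟩ ⟨t, not_lt.1 hge⟩
        exact hη0 x hx
      rw [abs_of_neg this]; ring
  have hintg : ∀ u : ℝ → ℂ, Continuous u → (∫ t in (0 : ℝ)..1, u t).im = ∫ t in (0 : ℝ)..1, (u t).im :=
    fun u hu => (Complex.imCLM.intervalIntegral_comp_comm (hu.intervalIntegrable 0 1)).symm
  set T : ℝ := ∫ t in (0 : ℝ)..1, η t with hT
  have hTg : ∫ t in (0 : ℝ)..1, g t * v t = Complex.I * T := by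
    simp only [hgv]
    rw [intervalIntegral.integral_const_mul, intervalIntegral.integral_ofReal]
  have hTs : ∫ t in (0 : ℝ)..1, |η t| = s * T := by
    simp only [hsη]
    rw [intervalIntegral.integral_const_mul]
  have hTpos : 0 < s * T := by
    rw [← hTs]
    exact intervalIntegral.intervalIntegral_pos_of_pos
      ((continuous_abs.comp hηc).intervalIntegrable 0 1) (fun t => abs_pos.2 (hη0 t)) one_pos
  have hpC : p ∉ levelSet S f φ := fun hp => h.notMem hp.1
  -- ∮ g dz equals kε times the winding integral about p, up to the integral of an exact form.
  have hTsq : T ^ 2 = 4 * Real.pi ^ 2 * k ^ 2 := by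
    obtain ⟨P, hP⟩ := h.exists_primitive_wgrad
    have hsub : ∀ z ∈ S, z - p ≠ 0 := fun z hz h0 => h.notMem (sub_eq_zero.1 h0 ▸ hz)
    have h1 := h.integral_eq_zero hγ (H := fun z => wgrad S f z - k * ε / (z - p))
      (h.continuousOn_wgrad.sub (continuousOn_const.div
        (continuousOn_id.sub continuousOn_const) hsub)) hP
    have h2 : ∫ t in (0 : ℝ)..1, (wgrad S f (γ t) - k * ε / (γ t - p)) * deriv γ t =
        (∫ t in (0 : ℝ)..1, g t * v t) - k * ε * windInt γ p := by
      rw [windInt, ← intervalIntegral.integral_const_mul, ← intervalIntegral.integral_sub]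
      · refine intervalIntegral.integral_congr fun t _ => ?_
        simp only [hg, hv]
        ring
      · exact (hgc.mul hvc).intervalIntegrable _ _
      · exact (continuous_const.mul (hvc.div (hl.continuous.sub continuous_const)
          fun t => hsub _ (hS t))).intervalIntegrable _ _
    rw [h2, hTg, sub_eq_zero] at h1
    obtain ⟨σ, hσ, hval, -⟩ := hl.exists_windInt_values
    have hT0 : T ≠ 0 := fun h0 => by rw [h0] at hTpos; simp at hTpos
    -- Winding number zero would give T = 0, but η has constant sign and no zeros.
    rcases hval p hpC with h3 | h3
    · rw [h3, mul_zero] at h1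
      simp [hT0] at h1
    · rw [h3] at h1
      have h4 : T = k * ε * (σ * (2 * Real.pi)) := by
        have := congrArg Complex.im h1
        have h5 : (k * ε * (σ * (2 * Real.pi * Complex.I)) : ℂ) =
            Complex.I * ((k * ε * (σ * (2 * Real.pi)) : ℝ) : ℂ) := by push_cast; ring
        rw [h5, Complex.I_mul_im, Complex.I_mul_im, Complex.ofReal_re, Complex.ofReal_re] at this
        exact this
      have hσ2 : σ ^ 2 = 1 := by rcases hσ with rfl | rfl <;> norm_num
      rw [h4]
      calc (k * ε * (σ * (2 * Real.pi))) ^ 2 = k ^ 2 * ε ^ 2 * σ ^ 2 * (4 * Real.pi ^ 2) := by ring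
        _ = _ := by rw [h.ε_sq, hσ2]; ring
  have hTabs : s * T = 2 * Real.pi * |k| := by
    have h1 : (s * T) ^ 2 = (2 * Real.pi * |k|) ^ 2 := by
      calc (s * T) ^ 2 = (s * s) * T ^ 2 := by ring
        _ = _ := by rw [hs, hTsq, mul_pow, sq_abs]; ring
    have h2 : 0 ≤ 2 * Real.pi * |k| := by positivity
    exact (sq_eq_sq₀ hTpos.le h2).1 h1
  have hwpos : ∀ t, 0 < |η t| := fun t => abs_pos.2 (hη0 t)
  have hac_re : Continuous fun t => (a t).re := Complex.continuous_re.comp hac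
  have hac_im : Continuous fun t => (a t).im := Complex.continuous_im.comp hac
  have habs : Continuous fun t => |η t| := continuous_abs.comp hηc
  refine ⟨fun t => (a t).re, fun t => (a t).im, fun t => |η t|, hac_re, hac_im, habs, hwpos,
    fun t => ?_, fun t => ?_, fun t => ?_, fun t => ?_, hTs.trans hTabs, ?_, ?_⟩
  · rw [intensity_eq]; exact hw t
  · have := norm_ne_zero_iff.2 (hv0 t)
    rw [signedCurvature_eq γ t (hv0 t), ← hcurv t, div_mul_cancel₀ _ this]
  · have := norm_ne_zero_iff.2 (hv0 t)
    rw [tangentialDeriv, gradientWithin_eq, cross_outwardNormal,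
      wgrad_eq (h.uniqueDiffOn _ (hS t)) (h.wgrad_log_intensity (hS t)), div_mul_cancel₀ _ this]
    congr 1
    simp only [ha]
    ring
  · have h1 := norm_ne_zero_iff.2 (hv0 t)
    have h2 := norm_ne_zero_iff.2 (hg0 t)
    simp only
    rw [tangentialDeriv, gradientWithin_eq, cross_outwardNormal,
      wgrad_eq (h.uniqueDiffOn _ (hS t)) (h.wgrad_one_div_intensity (hS t)), ← hw t, intensity_eq]
    have h3 : -((1 / ‖wgrad S f (γ t)‖ : ℝ) : ℂ) * (wgradDeriv S f (γ t) / wgrad S f (γ t)) *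
        deriv γ t = ((-(1 / ‖g t‖) : ℝ) : ℂ) * a t := by
      simp only [ha, hg, hgd, hv]
      push_cast
      ring
    rw [h3, Complex.re_ofReal_mul]
    change _ / ‖v t‖ * _ = _
    field_simp
  · obtain ⟨P, hP⟩ := h.exists_primitive_logDeriv
    have h1 := h.integral_eq_zero hγ
      (H := fun z => wgradDeriv S f z / wgrad S f z + q / k * wgrad S f z)
      ((h.continuousOn_wgradDeriv.div h.continuousOn_wgrad fun z hz => h.wgrad_ne_zero hz).add
        (continuousOn_const.mul h.continuousOn_wgrad)) hP
    have h2 : ∫ t in (0 : ℝ)..1,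
        (wgradDeriv S f (γ t) / wgrad S f (γ t) + q / k * wgrad S f (γ t)) * deriv γ t =
        (∫ t in (0 : ℝ)..1, a t) + q / k * ∫ t in (0 : ℝ)..1, g t * v t := by
      rw [← intervalIntegral.integral_const_mul, ← intervalIntegral.integral_add]
      · refine intervalIntegral.integral_congr fun t _ => ?_
        simp only [hg, hv, ha, hgd]
        ring
      · exact hac.intervalIntegrable _ _
      · exact (continuous_const.mul (hgc.mul hvc)).intervalIntegrable _ _
    rw [h2, hTg] at h1
    have h3 : ∫ t in (0 : ℝ)..1, (a t).im = -(q / k * T) := by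
      rw [← hintg a hac, eq_neg_of_add_eq_zero_left h1]
      have : (-((q : ℂ) / k * (Complex.I * T))) = Complex.I * ((-(q / k * T) : ℝ) : ℂ) := by
        push_cast; ring
      rw [this, Complex.I_mul_im, Complex.ofReal_re]
    rw [h3]
    calc (-(q / k * T)) ^ 2 = q ^ 2 / k ^ 2 * T ^ 2 := by ring
      _ = _ := by rw [h.q_sq, hTsq]; field_simp
  · obtain ⟨P, hP⟩ := h.exists_primitive_sq
    have h1 := h.integral_eq_zero hγ
      (H := fun z => wgradDeriv S f z ^ 2 / wgrad S f z ^ 3 - wgrad S f z / k ^ 2)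
      (((h.continuousOn_wgradDeriv.pow 2).div (h.continuousOn_wgrad.pow 3)
        fun z hz => pow_ne_zero 3 (h.wgrad_ne_zero hz)).sub
        (h.continuousOn_wgrad.div_const _)) hP
    have hbc : Continuous fun t => gd t ^ 2 / g t ^ 3 * v t :=
      ((hgdc.pow 2).div (hgc.pow 3) fun t => pow_ne_zero 3 (hg0 t)).mul hvc
    have h2 : ∫ t in (0 : ℝ)..1,
        (wgradDeriv S f (γ t) ^ 2 / wgrad S f (γ t) ^ 3 - wgrad S f (γ t) / k ^ 2) * deriv γ t =
        (∫ t in (0 : ℝ)..1, gd t ^ 2 / g t ^ 3 * v t) - 1 / k ^ 2 * ∫ t in (0 : ℝ)..1, g t * v t := by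
      rw [← intervalIntegral.integral_const_mul, ← intervalIntegral.integral_sub]
      · refine intervalIntegral.integral_congr fun t _ => ?_
        simp only [hg, hv, hgd]
        ring
      · exact hbc.intervalIntegrable _ _
      · exact (continuous_const.mul (hgc.mul hvc)).intervalIntegrable _ _
    rw [h2, hTg, sub_eq_zero] at h1
    have h3 : ∫ t in (0 : ℝ)..1, (gd t ^ 2 / g t ^ 3 * v t).im = 1 / k ^ 2 * T := by
      rw [← hintg _ hbc, h1]
      have : ((1 : ℂ) / k ^ 2 * (Complex.I * T)) = Complex.I * ((1 / k ^ 2 * T : ℝ) : ℂ) := by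
        push_cast; ring
      rw [this, Complex.I_mul_im, Complex.ofReal_re]
    -- Substituting gγ' = iη in a² gives a² = iη·(g'²/g³)γ'; the claim is its real part divided by
    -- |η| = sη.
    have h4 : ∀ t, (a t).im ^ 2 / |η t| - (a t).re ^ 2 / |η t| =
        s * (gd t ^ 2 / g t ^ 3 * v t).im := fun t => by
      have h5 : Complex.I * (gd t ^ 2 / g t ^ 3 * v t) * η t = a t ^ 2 := by
        have h6 : Complex.I * (gd t ^ 2 / g t ^ 3 * v t) * η t =
            gd t ^ 2 / g t ^ 3 * v t * (Complex.I * η t) := by ring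
        rw [h6, ← hgv, ha]
        have := hg0 t
        field_simp
      have h7 := congrArg Complex.re h5
      rw [Complex.re_mul_ofReal, Complex.I_mul_re, sq (a t), Complex.mul_re] at h7
      have h8 := hη0 t
      have h9 : s ≠ 0 := fun h0 => by rw [h0] at hs; norm_num at hs
      rw [hsη t]
      generalize (gd t ^ 2 / g t ^ 3 * v t).im = m at h7 ⊢
      field_simp
      linear_combination h7 - m * η t * hs
    rw [← intervalIntegral.integral_sub]
    · simp only [h4]
      rw [intervalIntegral.integral_const_mul, h3]
      have h5 : s * (1 / k ^ 2 * T) = 1 / k ^ 2 * (s * T) := by ring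
      rw [h5, hTabs, ← sq_abs k]
      have := abs_pos.2 hk
      field_simp
    · exact ((hac_im.pow 2).div habs fun t => (hwpos t).ne').intervalIntegrable _ _
    · exact ((hac_re.pow 2).div habs fun t => (hwpos t).ne').intervalIntegrable _ _

end IsGreenField

theorem injOn_circleMap_two_pi_mul {r : ℝ} (hr : 0 < r) :
    InjOn (fun t : ℝ => circleMap 0 r (2 * Real.pi * t)) (Ico 0 1) := by
  intro x hx y hy hxy
  have h2 := Real.two_pi_pos
  have h1 := injOn_circleMap_of_abs_sub_le' (c := 0) (a := 0) (b := 2 * Real.pi) hr.ne' (by simp)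
    (x₁ := 2 * Real.pi * x) (x₂ := 2 * Real.pi * y)
    ⟨by nlinarith [hx.1], by nlinarith [hx.2]⟩ ⟨by nlinarith [hy.1], by nlinarith [hy.2]⟩ hxy
  exact mul_left_cancel₀ h2.ne' h1

namespace IsGreenField

variable {S O C : Set ℂ} {f : ℂ → ℝ} {c k : ℝ} {F ψ Q L : ℂ → ℂ} {p : ℂ} {ε q : ℝ}

theorem image_eq (h : IsGreenField S O C f c k F ψ Q L p ε q) :
    f '' S = {φ | (φ - c) / k ≤ 0} := by
  have hk := h.k_ne_zero
  ext φ
  constructor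
  · rintro ⟨z, hz, rfl⟩
    rw [← h.union_eq] at hz
    rcases hz with hz | hz
    · rw [mem_ofPred_eq, h.eq_log z hz, add_sub_cancel_left, mul_div_cancel_left₀ _ hk]
      exact (Real.log_neg (norm_pos_iff.2 (h.F_ne_zero hz)) (h.norm_F_lt_one hz)).le
    · simp [h.boundary z hz]
  · intro hφ
    rw [mem_ofPred_eq] at hφ
    rcases eq_or_lt_of_le hφ with h0 | h0
    · obtain ⟨γ, hγ⟩ := h.exists_loop
      obtain ⟨z, hz⟩ := hγ.nonempty
      refine ⟨z, h.subset_right hz, ?_⟩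
      rw [h.boundary z hz]
      have := (div_eq_zero_iff.1 h0).resolve_right hk
      linarith
    · set b : ℂ := ((Real.exp ((φ - c) / k) : ℝ) : ℂ) with hb
      have hbn : ‖b‖ = Real.exp ((φ - c) / k) := by
        rw [hb, Complex.norm_real, Real.norm_of_nonneg (Real.exp_pos _).le]
      have hbm : b ∈ ball (0 : ℂ) 1 \ {0} := by
        refine ⟨?_, fun hb0 => ?_⟩
        · rw [mem_ball_zero_iff, hbn]; exact Real.exp_lt_one_iff.2 h0
        · rw [mem_singleton_iff] at hb0
          rw [hb0, norm_zero] at hbn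
          exact (Real.exp_pos _).ne hbn
      refine ⟨ψ b, h.subset_left (h.mapsTo_inv hbm), ?_⟩
      rw [h.eq_log _ (h.mapsTo_inv hbm), h.right_inv b hbm, hbn, Real.log_exp]
      field_simp
      ring

/-- The level φ corresponds to |F| = exp((φ − c)/k), a circle of radius less than 1, which ψ carries
back to O. -/
theorem isJordanLoop_levelSet (h : IsGreenField S O C f c k F ψ Q L p ε q) {φ : ℝ}
    (hφ : (φ - c) / k < 0) : IsJordanLoop
      (fun t : ℝ => ψ (circleMap 0 (Real.exp ((φ - c) / k)) (2 * Real.pi * t))) (levelSet S f φ) := by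
  set r := Real.exp ((φ - c) / k) with hr
  have hr0 : 0 < r := Real.exp_pos _
  have hr1 : r < 1 := Real.exp_lt_one_iff.2 hφ
  have hk := h.k_ne_zero
  set u : ℝ → ℂ := fun t => circleMap 0 r (2 * Real.pi * t) with hu
  have hnorm : ∀ t, ‖u t‖ = r := fun t => by simp [hu, abs_of_pos hr0]
  have hmem : ∀ t, u t ∈ ball (0 : ℂ) 1 \ {0} := fun t => by
    refine ⟨by rw [mem_ball_zero_iff, hnorm]; exact hr1, fun h0 => ?_⟩
    have := hnorm t
    rw [mem_singleton_iff.1 h0, norm_zero] at this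
    exact hr0.ne this
  have hopen : IsOpen (ball (0 : ℂ) 1 \ {0}) := isOpen_ball.sdiff isClosed_singleton
  have hus : ContDiff ℝ ∞ u := (contDiff_circleMap 0 r).comp (contDiff_const.mul contDiff_id)
  have hψs : ContDiffOn ℝ ∞ ψ (ball (0 : ℂ) 1 \ {0}) :=
    (h.differentiableOn_inv.contDiffOn hopen).restrict_scalars ℝ
  have hsm : ContDiff ℝ ∞ fun t => ψ (u t) := by
    rw [← contDiffOn_univ] at hus ⊢
    exact hψs.comp hus fun t _ => hmem t
  have hud : ∀ t, HasDerivAt u (circleMap 0 r (2 * Real.pi * t) * Complex.I * (2 * Real.pi : ℝ)) t :=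
    fun t => by
      have h1 := (hasDerivAt_circleMap 0 r (2 * Real.pi * t)).scomp t
        ((hasDerivAt_id t).const_mul (2 * Real.pi))
      refine h1.congr_deriv ?_
      rw [Complex.real_smul]
      push_cast
      ring
  refine ⟨hsm, fun t => ?_, fun x hx y hy hxy => ?_, fun t h0 => ?_, ?_⟩
  · rw [mul_add, mul_one, periodic_circleMap]
  · have h1 := congrArg F hxy
    rw [h.right_inv _ (hmem x), h.right_inv _ (hmem y)] at h1
    exact injOn_circleMap_two_pi_mul hr0 hx hy h1
  · have h1 : HasDerivAt (fun t => ψ (u t)) 0 t := by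
      have := (hsm.differentiable (by simp) t).hasDerivAt
      rwa [h0] at this
    have h2 := (h.hasDerivAt_F (h.mapsTo_inv (hmem t))).scomp t h1
    -- Applying F recovers the circle, whose velocity is nonzero, so the velocity of the level curve
    -- cannot vanish.
    have h3 : F ∘ (fun t => ψ (u t)) = u := funext fun t => h.right_inv _ (hmem t)
    rw [h3, zero_smul] at h2
    have h4 := (hud t).unique h2
    have h5 : circleMap 0 r (2 * Real.pi * t) ≠ 0 := (hmem t).2
    have h6 : ((2 * Real.pi : ℝ) : ℂ) ≠ 0 := by exact_mod_cast Real.two_pi_pos.ne'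
    exact mul_ne_zero (mul_ne_zero h5 Complex.I_ne_zero) h6 h4
  · ext z
    constructor
    · rintro ⟨t, rfl⟩
      have h1 := h.mapsTo_inv (hmem t)
      refine ⟨h.subset_left h1, ?_⟩
      change f (ψ (u t)) = φ
      rw [h.eq_log _ h1, h.right_inv _ (hmem t), hnorm, hr, Real.log_exp]
      field_simp
      ring
    · rintro ⟨hzS, hzf⟩
      have hφc : φ ≠ c := fun h0 => by simp [h0] at hφ
      have hzO := h.levelSet_subset hφc ⟨hzS, hzf⟩
      have hn : ‖F z‖ = r := by
        rw [h.eq_log z hzO] at hzf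
        rw [hr, ← hzf, add_sub_cancel_left, mul_div_cancel_left₀ _ hk,
          Real.exp_log (norm_pos_iff.2 (h.F_ne_zero hzO))]
      refine ⟨Complex.arg (F z) / (2 * Real.pi), ?_⟩
      simp only
      rw [mul_div_cancel₀ _ Real.two_pi_pos.ne', circleMap, zero_add, ← hn,
        Complex.norm_mul_exp_arg_mul_I, h.left_inv z hzO]

/-- In terms of x, y, w the densities are κ/E·w = −y and |∂_s(1/E)|²·w = x²/w. The variance is the
mean square minus the square of the mean, so both identities come from ∫(y² − x²)/w and (∫ y)². -/
theorem conservation (h : IsGreenField S O C f c k F ψ Q L p ε q) {Φ : ℝ} (hΦ : 0 < Φ)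
    (hk : |k| = Φ / (2 * Real.pi)) {φ : ℝ} {γ : ℝ → ℂ} (hγ : IsJordanParam γ (levelSet S f φ)) :
    conserved S f γ = 4 * Real.pi ^ 2 / Φ ∧ fluxMean S f Φ γ (fun _ => 1) = 1 ∧
      fluxVariance S f Φ γ (fun t => signedCurvature γ t / intensity S f (γ t)) =
        fluxMean S f Φ γ (fun t => |tangentialDeriv S (fun z => 1 / intensity S f z) γ t| ^ 2) := by
  have hpi := Real.pi_pos
  obtain ⟨x, y, w, hx, hy, hw, hwpos, hE, hκ, htd, htd', hIw, hIy, hId⟩ :=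
    h.exists_level_integrals hγ
  have hl := hγ.isJordanLoop
  have hv : ∀ t, ‖deriv γ t‖ ≠ 0 := fun t => norm_ne_zero_iff.2 (hl.regular t)
  have hE0 : ∀ t, intensity S f (γ t) ≠ 0 := fun t h0 => by
    have := hwpos t
    rw [← hE t, h0, zero_mul] at this
    exact lt_irrefl _ this
  have hκ' : ∀ t, signedCurvature γ t = -y t / ‖deriv γ t‖ := fun t => by
    rw [← hκ t, mul_div_cancel_right₀ _ (hv t)]
  have htdl : ∀ t, tangentialDeriv S (fun z => Real.log (intensity S f z)) γ t =
      x t / ‖deriv γ t‖ := fun t => by rw [← htd t, mul_div_cancel_right₀ _ (hv t)]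
  have htdi : ∀ t, tangentialDeriv S (fun z => 1 / intensity S f z) γ t = -x t / w t := fun t => by
    rw [← htd' t, mul_div_cancel_right₀ _ (hwpos t).ne']
  have hIw' : ∫ t in (0 : ℝ)..1, w t = Φ := by
    rw [hIw, hk]; field_simp
  have hId' : (∫ t in (0 : ℝ)..1, y t ^ 2 / w t) - (∫ t in (0 : ℝ)..1, x t ^ 2 / w t) =
      4 * Real.pi ^ 2 / Φ := by
    rw [hId, hk]; field_simp; ring
  have hmean : ∀ u : ℝ → ℝ, fluxMean S f Φ γ u = (1 / Φ) * ∫ t in (0 : ℝ)..1, u t * w t := fun u => by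
    rw [fluxMean, arcIntegral, ← intervalIntegral.integral_const_mul]
    refine intervalIntegral.integral_congr fun t _ => ?_
    simp only [← hE t]
    ring
  have hyw : IntervalIntegrable (fun t => y t ^ 2 / w t) volume 0 1 :=
    ((hy.pow 2).div hw fun t => (hwpos t).ne').intervalIntegrable _ _
  refine ⟨?_, ?_, ?_⟩
  · rw [← hId', conserved, arcIntegral, arcIntegral]
    congr 1 <;> refine intervalIntegral.integral_congr fun t _ => ?_
    · simp only [hκ', ← hE t]
      have := hv t
      have := hE0 t
      field_simp
    · simp only [htdl, sq_abs, ← hE t]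
      have := hv t
      have := hE0 t
      field_simp
  · rw [hmean]
    simp only [one_mul, hIw']
    field_simp
  · have hm : fluxMean S f Φ γ (fun t => signedCurvature γ t / intensity S f (γ t)) =
        -(1 / Φ) * ∫ t in (0 : ℝ)..1, y t := by
      rw [hmean, neg_mul, ← mul_neg, ← intervalIntegral.integral_neg]
      congr 1
      refine intervalIntegral.integral_congr fun t _ => ?_
      simp only [hκ', ← hE t]
      have := hv t
      have := hE0 t
      field_simp
    set m := -(1 / Φ) * ∫ t in (0 : ℝ)..1, y t with hmdef
    have hmy : ∫ t in (0 : ℝ)..1, y t = -(Φ * m) := by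
      rw [hmdef]; field_simp
    rw [fluxVariance, hm, hmean, hmean]
    have h1 : ∀ t, (signedCurvature γ t / intensity S f (γ t) - m) ^ 2 * w t =
        y t ^ 2 / w t + (2 * m * y t + m ^ 2 * w t) := fun t => by
      rw [hκ', ← hE t]
      have := hv t
      have := hE0 t
      field_simp
      ring
    have h2 : ∀ t, |tangentialDeriv S (fun z => 1 / intensity S f z) γ t| ^ 2 * w t =
        x t ^ 2 / w t := fun t => by
      rw [htdi, sq_abs]
      have := (hwpos t).ne'
      field_simp
    simp only [h1, h2]
    have hmyc : Continuous fun t => 2 * m * y t := continuous_const.mul hy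
    have hmwc : Continuous fun t => m ^ 2 * w t := continuous_const.mul hw
    have hmc : Continuous fun t => 2 * m * y t + m ^ 2 * w t := hmyc.add hmwc
    rw [intervalIntegral.integral_add hyw (hmc.intervalIntegrable _ _),
      intervalIntegral.integral_add (hmyc.intervalIntegrable _ _) (hmwc.intervalIntegrable _ _),
      intervalIntegral.integral_const_mul, intervalIntegral.integral_const_mul, hIw', hmy]
    -- The squared mean contributes exactly the conserved value, because (∫ y)² = 4π².
    have h3 : m ^ 2 * Φ = 4 * Real.pi ^ 2 / Φ := by
      rw [hmdef, mul_pow, hIy]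
      field_simp
    have h4 : (∫ t in (0 : ℝ)..1, y t ^ 2 / w t) + (2 * m * -(Φ * m) + m ^ 2 * Φ) =
        ∫ t in (0 : ℝ)..1, x t ^ 2 / w t := by
      linear_combination hId' - h3
    rw [h4]

/-- The conservation law for a Green field. -/
theorem conservationLaw (h : IsGreenField S O C f c k F ψ Q L p ε q) {Φ : ℝ} (hΦ : 0 < Φ)
    (hk : |k| = Φ / (2 * Real.pi)) {I : Set ℝ} (hI : I = {φ | (φ - c) / k ≤ 0}) :
    ConservationLaw S f Φ I := by
  refine ⟨fun z hz => ?_, h.image_eq.trans hI.symm, fun φ hφ => ?_, fun Γ hΓ φ hφ => ⟨?_, ?_⟩⟩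
  · rw [gradientWithin_eq]
    simpa using h.wgrad_ne_zero hz
  · rw [hI] at hφ
    rw [mem_ofPred_eq] at hφ
    rcases eq_or_lt_of_le hφ with h0 | h0
    · have : φ = c := by
        have := (div_eq_zero_iff.1 h0).resolve_right h.k_ne_zero
        linarith
      rw [this, h.levelSet_eq]
      obtain ⟨γ, hγ⟩ := h.exists_loop
      exact hγ.exists_isJordanParam
    · exact (h.isJordanLoop_levelSet h0).exists_isJordanParam
  · refine (hasDerivWithinAt_const φ I (4 * Real.pi ^ 2 / Φ)).congr (fun χ hχ => ?_) ?_
    · exact (h.conservation hΦ hk (hΓ χ hχ)).1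
    · exact (h.conservation hΦ hk (hΓ φ hφ)).1
  · exact h.conservation hΦ hk (hΓ φ hφ)

end IsGreenField

/-! ### From a harmonic function to its Green field -/

namespace IsDiscMap

variable {D : Set ℂ} {F : ℂ → ℂ}

theorem differentiableOn_div_deriv (h : IsDiscMap D F) :
    DifferentiableOn ℂ (fun z => F z / deriv F z) D :=
  h.differentiableOn.div (h.differentiableOn.deriv h.isOpen) fun _ hz => h.deriv_ne_zero hz

theorem hasDerivAt_div_deriv (h : IsDiscMap D F) {z : ℂ} (hz : z ∈ D) :
    HasDerivAt (fun z => F z / deriv F z) (deriv (fun z => F z / deriv F z) z) z :=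
  (h.differentiableOn_div_deriv.differentiableAt (h.isOpen.mem_nhds hz)).hasDerivAt

/-- The derivative is 1 − FF''/F'², and F vanishes at the origin. This value determines q. -/
theorem deriv_div_deriv_zero (h : IsDiscMap D F) : deriv (fun z => F z / deriv F z) 0 = 1 := by
  have h0 := h.analyticOnNhd 0 h.zero_mem
  have h1 := h0.differentiableAt.hasDerivAt.div h0.deriv.differentiableAt.hasDerivAt h.deriv_zero
  have h2 : deriv (fun z => F z / deriv F z) 0 = _ := h1.deriv
  rw [h2, h.map_zero, zero_mul, sub_zero, sq, div_self (mul_ne_zero h.deriv_zero h.deriv_zero)]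

end IsDiscMap

/-- The conformal map of a harmonic function with a logarithmic singularity and constant boundary
values. -/
theorem isDiscMap_mul_exp {f : ℂ → ℝ} {D : Set ℂ} {c k : ℝ} {L : ℂ → ℂ} (hD : IsOpen D)
    (hDc : IsPreconnected D) (hDb : Bornology.IsBounded D) (h0 : (0 : ℂ) ∈ D) (hk : k ≠ 0)
    (hL : DifferentiableOn ℂ L D) (hf : ∀ z ∈ D \ {0}, f z = k * Real.log ‖z‖ + (L z).re)
    (hlim : ∀ z ∈ frontier D, Tendsto f (𝓝[D \ {0}] z) (𝓝 c)) :
    IsDiscMap D (fun z => z * Complex.exp ((L z - c) / k)) ∧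
      (∀ z ∈ D \ {0}, f z = c + k * Real.log ‖z * Complex.exp ((L z - c) / k)‖) ∧
      ∀ z ∈ D, HasDerivAt (fun z => z * Complex.exp ((L z - c) / k))
        (Complex.exp ((L z - c) / k) * (1 + z * (deriv L z / k))) z := by
  have hder : ∀ z ∈ D, HasDerivAt (fun z => z * Complex.exp ((L z - c) / k))
        (Complex.exp ((L z - c) / k) * (1 + z * (deriv L z / k))) z := fun z hz => by
    have h1 : HasDerivAt (fun z => (L z - c) / k) (deriv L z / k) z :=
      (((hL.differentiableAt (hD.mem_nhds hz)).hasDerivAt).sub_const _).div_const _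
    refine ((hasDerivAt_id z).mul h1.cexp).congr_deriv ?_
    simp only [id]
    ring
  have hexp : ∀ z, ‖Complex.exp ((L z - c) / k)‖ = Real.exp (((L z).re - c) / k) := fun z => by
    rw [Complex.norm_exp]
    congr 1
    rw [Complex.div_ofReal_re]
    simp
  have hval : ∀ z ∈ D \ {0}, f z = c + k * Real.log ‖z * Complex.exp ((L z - c) / k)‖ :=
    fun z hz => by
      have hz0 : ‖z‖ ≠ 0 := norm_ne_zero_iff.2 hz.2
      rw [norm_mul, hexp, Real.log_mul hz0 (Real.exp_pos _).ne', Real.log_exp, hf z hz]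
      field_simp
      ring
  refine ⟨⟨hD, hDc, hDb, h0, fun z hz => (hder z hz).differentiableAt.differentiableWithinAt,
    by simp, ?_, fun z _ hz => ?_, fun z hz => ?_⟩, hval, hder⟩
  · rw [(hder 0 h0).deriv]
    simp [Complex.exp_ne_zero]
  · exact (mul_eq_zero.1 hz).resolve_right (Complex.exp_ne_zero _)
  · have hz0 : z ≠ 0 := fun hz0 => by
      rw [hD.frontier_eq, hz0] at hz
      exact hz.2 h0
    have h1 : 𝓝[D \ {0}] z = 𝓝[D] z := by
      rw [Set.sdiff_eq]
      exact nhdsWithin_inter_of_mem' (nhdsWithin_le_nhds (isOpen_compl_singleton.mem_nhds hz0))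
    -- |F| = exp((f − c)/k), and f tends to c at the frontier.
    have h2 : Tendsto (fun w => Real.exp ((f w - c) / k)) (𝓝[D] z) (𝓝 1) := by
      rw [← h1]
      have h3 := (((hlim z hz).sub_const c).div_const k).rexp
      simpa using h3
    refine h2.congr' ?_
    rw [← h1]
    filter_upwards [self_mem_nhdsWithin] with w hw
    have hw0 : w * Complex.exp ((L w - c) / k) ≠ 0 := mul_ne_zero hw.2 (Complex.exp_ne_zero _)
    rw [hval w hw, add_sub_cancel_left, mul_div_cancel_left₀ _ hk,
      Real.exp_log (norm_pos_iff.2 hw0)]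

/-- A collar thinner than the distance from p to the curve avoids p. Its displacement is s|γ'| ≤ sM,
whence the width δ/(M + 1). -/
theorem HasCollar.diff_singleton {γ : ℝ → ℂ} {C W : Set ℂ} {τ : ℝ} {p : ℂ} (hγ : IsJordanLoop γ C)
    (hW : HasCollar γ W τ) (hp : p ∉ C) : HasCollar γ (W \ {p}) τ := by
  obtain ⟨hτ, η, hη, hcol⟩ := hW
  obtain ⟨M, hM⟩ : ∃ M, ∀ t, ‖deriv γ t‖ ≤ M := by
    obtain ⟨M, hM⟩ := (isCompact_Icc (a := (0 : ℝ)) (b := 1)).exists_bound_of_continuousOn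
      hγ.continuous_deriv.continuousOn
    refine ⟨M, fun t => ?_⟩
    have h1 : deriv γ t ∈ deriv γ '' Icc 0 (0 + 1) := by
      rw [hγ.periodic_deriv.image_Icc one_pos]; exact mem_range_self t
    rw [zero_add] at h1
    obtain ⟨x, hx, hxt⟩ := h1
    rw [← hxt]
    exact hM x hx
  have hM0 : 0 ≤ M := (norm_nonneg _).trans (hM 0)
  obtain ⟨δ, hδ, hδC⟩ := Metric.isOpen_iff.1 hγ.isCompact.isClosed.isOpen_compl p hp
  have hτn : |τ| = 1 := by rcases hτ with rfl | rfl <;> norm_num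
  refine ⟨hτ, min η (δ / (M + 1)), lt_min hη (by positivity), fun t s hs0 hs1 =>
    ⟨hcol t s hs0 (hs1.trans_le (min_le_left _ _)), fun heq => ?_⟩⟩
  rw [mem_singleton_iff] at heq
  refine hδC (a := γ t) ?_ (hγ.mem t)
  have h1 : γ t - p = -((τ * s : ℝ) * Complex.I * deriv γ t) := by
    rw [← heq]; simp [tube]
  rw [mem_ball, dist_eq_norm, h1, norm_neg, norm_mul, norm_mul, Complex.norm_I, Complex.norm_real,
    Real.norm_eq_abs, abs_mul, hτn, abs_of_pos hs0, one_mul, mul_one]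
  have h2 : s < δ / (M + 1) := hs1.trans_le (min_le_right _ _)
  rw [lt_div_iff₀ (by positivity)] at h2
  nlinarith [hM t]

theorem IsJordanExterior.of_isJordanParam {Ω : Set ℂ} {γ₀ γ : ℝ → ℂ} (h : IsJordanExterior Ω γ₀)
    (hγ : IsJordanParam γ (frontier Ω)) : IsJordanExterior Ω γ :=
  ⟨h.isOpen, h.isConnected, h.unbounded, hγ⟩

/-! ### The interior problem -/

theorem wgrad_eq_cgrad {S : Set ℂ} {f : ℂ → ℝ} {z : ℂ} (hS : S ∈ 𝓝 z) :
    wgrad S f z = cgrad f z := by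
  rw [wgrad, cgrad, fderivWithin_of_mem_nhds hS]

/-- The flux through a small circle as a circle integral of the complex gradient. -/
theorem flux_circleMap {S : Set ℂ} {f : ℂ → ℝ} {r : ℝ} (hr : 0 < r)
    (hS : ∀ z ∈ sphere (0 : ℂ) r, S ∈ 𝓝 z) (hf : HarmonicOnNhd f (sphere 0 r)) :
    flux S f (fun t => circleMap 0 r (2 * Real.pi * t)) = -(∮ z in C(0, r), cgrad f z).im := by
  have hmem : ∀ θ, circleMap 0 r θ ∈ sphere (0 : ℂ) r := fun θ => circleMap_mem_sphere 0 hr.le θ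
  set u : ℝ → ℂ := fun θ => deriv (circleMap 0 r) θ • cgrad f (circleMap 0 r θ) with hu
  have hc : Continuous u := by
    have h1 : Continuous fun θ => cgrad f (circleMap 0 r θ) :=
      (analyticOnNhd_cgrad hf).continuousOn.comp_continuous (continuous_circleMap 0 r) hmem
    simp only [hu, deriv_circleMap]
    exact ((continuous_circleMap 0 r).mul continuous_const).smul h1
  have hd : ∀ t : ℝ, HasDerivAt (fun t : ℝ => circleMap 0 r (2 * Real.pi * t))
      ((2 * Real.pi : ℝ) * deriv (circleMap 0 r) (2 * Real.pi * t)) t := fun t => by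
    have h1 := (hasDerivAt_circleMap 0 r (2 * Real.pi * t)).scomp t
      ((hasDerivAt_id t).const_mul (2 * Real.pi))
    refine h1.congr_deriv ?_
    rw [Complex.real_smul, deriv_circleMap]
    push_cast
    ring
  rw [flux, arcIntegral]
  congr 1
  have h2 : (∮ z in C(0, r), cgrad f z).im = ∫ θ in (0 : ℝ)..(2 * Real.pi), (u θ).im :=
    (Complex.imCLM.intervalIntegral_comp_comm (hc.intervalIntegrable (μ := volume) 0 _)).symm
  have h3 := intervalIntegral.integral_comp_mul_left (a := 0) (b := 1) (fun θ => (u θ).im)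
    Real.two_pi_pos.ne'
  rw [mul_zero, mul_one] at h3
  have h4 : ∫ θ in (0 : ℝ)..(2 * Real.pi), (u θ).im =
      ∫ t in (0 : ℝ)..1, (2 * Real.pi) * (u (2 * Real.pi * t)).im := by
    rw [intervalIntegral.integral_const_mul, h3, smul_eq_mul, mul_inv_cancel_left₀ Real.two_pi_pos.ne']
  rw [h2, h4]
  refine intervalIntegral.integral_congr fun t _ => ?_
  set γ : ℝ → ℂ := fun t => circleMap 0 r (2 * Real.pi * t) with hγ
  have hγd : deriv γ t = (2 * Real.pi : ℝ) * deriv (circleMap 0 r) (2 * Real.pi * t) := (hd t).deriv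
  have hγ0 : ‖deriv γ t‖ ≠ 0 := by
    rw [hγd, deriv_circleMap]
    simp [hr.ne', Real.pi_ne_zero]
  rw [gradientWithin_eq, wgrad_eq_cgrad (hS _ (hmem _)), Complex.inner]
  have h5 : (starRingEnd ℂ) (cgrad f (circleMap 0 r (2 * Real.pi * t))) *
      (starRingEnd ℂ) (outwardNormal γ t) =
      ((‖deriv γ t‖⁻¹ : ℝ) : ℂ) * (Complex.I * (starRingEnd ℂ) (deriv γ t * cgrad f (γ t))) := by
    rw [outwardNormal]
    simp only [map_mul, map_neg, map_div₀, Complex.conj_I, Complex.conj_ofReal]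
    push_cast
    ring
  rw [h5, Complex.re_ofReal_mul, Complex.I_mul_re, Complex.conj_im, neg_neg, mul_comm,
    mul_inv_cancel_left₀ hγ0, hγd, mul_assoc, Complex.im_ofReal_mul, hu]
  simp [hγ]

/-- The enclosed region D is bounded, connected and has the connected complement closure Ω, so the
conformal map is available with the pole p = 0 as its centre. -/
theorem InteriorDirichlet.exists_isGreenField {Ω : Set ℂ} {γ₀ : ℝ → ℂ} {G : ℂ → ℝ} {Φ c : ℝ}
    (h : InteriorDirichlet Ω γ₀ G Φ c) : ∃ (F ψ Q L : ℂ → ℂ),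
      IsGreenField (Ω ∪ {0})ᶜ ((closure Ω)ᶜ \ {0}) (frontier Ω) G c (-(Φ / (2 * Real.pi)))
        F ψ Q L 0 1 1 := by
  set D : Set ℂ := (closure Ω)ᶜ with hDdef
  have hD : IsOpen D := IsJordanExterior.isOpen_enclosed
  have hDc : IsPreconnected D := h.domain.isPreconnected_enclosed
  have hDb : Bornology.IsBounded D :=
    h.domain.isBounded_compl.subset (compl_subset_compl.2 subset_closure)
  have hDc' : IsPreconnected Dᶜ := by
    rw [hDdef, compl_compl]
    exact h.domain.isConnected.isPreconnected.closure
  have h0 : (0 : ℂ) ∈ D := h.origin_enclosed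
  have hO : IsOpen (D \ {0}) := hD.sdiff isClosed_singleton
  have hharm : HarmonicOnNhd G (D \ {0}) := by
    have := h.harmonic
    rwa [compl_union, ← Set.sdiff_eq] at this
  have hunion : D \ {0} ∪ frontier Ω = (Ω ∪ {0})ᶜ := by
    rw [h.domain.isOpen.frontier_eq]
    ext z
    simp only [mem_union, Set.mem_sdiff, mem_compl_iff, mem_singleton_iff, hDdef, not_or]
    constructor
    · rintro (⟨h1, h2⟩ | ⟨h1, h2⟩)
      · exact ⟨fun h3 => h1 (subset_closure h3), h2⟩
      · exact ⟨h2, fun h3 => h.origin_enclosed (h3 ▸ h1)⟩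
    · rintro ⟨h1, h2⟩
      by_cases h3 : z ∈ closure Ω
      · exact Or.inr ⟨h3, h1⟩
      · exact Or.inl ⟨h3, h2⟩
  have hOS : D \ {0} ⊆ (Ω ∪ {0})ᶜ := hunion ▸ subset_union_left
  have hlim : ∀ z ∈ frontier D, Tendsto G (𝓝[D \ {0}] z) (𝓝 c) := fun z hz => by
    have hz' : z ∈ frontier Ω := by
      rw [hDdef, frontier_compl] at hz
      exact frontier_closure_subset hz
    have hzS : z ∈ (Ω ∪ {0})ᶜ := hunion ▸ Or.inr hz'
    have h1 := (h.regular.continuousOn z hzS).mono hOS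
    rw [ContinuousWithinAt, h.dirichlet z hz'] at h1
    exact h1
  obtain ⟨k, L, hL, hg, hf⟩ := exists_eq_log_add_re hD hDc hDb hDc' h0 hharm h.log_pole
  -- The flux through every small circle is −Im(2πik) = −2πk.
  have hkΦ : k = -(Φ / (2 * Real.pi)) := by
    obtain ⟨r, hr, hrD⟩ := Metric.isOpen_iff.1 hD 0 h0
    have hev : ∀ᶠ ε : ℝ in 𝓝[>] 0, flux ((Ω ∪ {0})ᶜ) G
        (fun t => circleMap 0 ε (2 * Real.pi * t)) = -(2 * Real.pi * k) := by
      filter_upwards [self_mem_nhdsWithin, nhdsWithin_le_nhds (gt_mem_nhds hr)] with ε hε0 hε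
      have hε0 : 0 < ε := hε0
      have hcb : closedBall (0 : ℂ) ε ⊆ D := (closedBall_subset_ball hε).trans hrD
      have hsp : ∀ z ∈ sphere (0 : ℂ) ε, z ∈ D \ {0} := fun z hz =>
        ⟨hcb (sphere_subset_closedBall hz), fun hz0 => by
          rw [mem_singleton_iff] at hz0
          simp [hz0] at hz
          linarith⟩
      rw [flux_circleMap hε0 (fun z hz => mem_of_superset (hO.mem_nhds (hsp z hz)) hOS)
        (fun z hz => hharm z (hsp z hz)), circleIntegral_cgrad hε0 hcb (hL.deriv hD) hg]
      simp
    have h1 := tendsto_nhds_unique h.flux_tendsto (tendsto_const_nhds.congr' (hev.mono fun _ h => h.symm))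
    rw [h1]
    field_simp
  have hk : k ≠ 0 := by
    rw [hkΦ]
    exact neg_ne_zero.2 (div_ne_zero h.flux_ne_zero Real.two_pi_pos.ne')
  have hkC : (k : ℂ) ≠ 0 := by exact_mod_cast hk
  obtain ⟨hF, hval, hder⟩ := isDiscMap_mul_exp hD hDc hDb h0 hk hL hf hlim
  set F : ℂ → ℂ := fun z => z * Complex.exp ((L z - c) / k) with hFd
  obtain ⟨ψ, hψd, hψm, hψr, hψl⟩ := hF.exists_inverse
  have hψ0 : ∀ b ∈ ball (0 : ℂ) 1, b ≠ 0 → ψ b ≠ 0 := fun b hb hb0 h1 => hb0 (by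
    rw [← hψr b hb, h1, hF.map_zero])
  set V : ℂ → ℂ := fun z => F z / deriv F z with hV
  refine ⟨F, ψ, fun b => deriv V (ψ b), fun z => L z / k, ?_⟩
  rw [← hkΦ]
  refine ⟨hO, hunion, ⟨γ₀, h.domain.loop⟩, fun γ hγ => ?_, h.regular, h.dirichlet, hk,
    hF.differentiableOn.mono sdiff_subset, fun z hz => ⟨?_, fun hz0 => hz.2 (hF.eq_zero z hz.1 hz0)⟩,
    fun z hz => hF.deriv_ne_zero hz.1, hval, hψd.mono sdiff_subset,
    fun b hb => ⟨hψm hb.1, hψ0 b hb.1 hb.2⟩, fun b hb => hψr b hb.1, fun z hz => hψl z hz.1, ?_,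
    fun z hz => ?_, ?_, by norm_num, fun z hz => ?_, by norm_num, by simp⟩
  · obtain ⟨τ, hτ, -⟩ := (h.domain.of_isJordanParam hγ).exists_collars
    exact ⟨τ, hτ.diff_singleton hγ.isJordanLoop fun h1 =>
      h.origin_enclosed (frontier_subset_closure h1)⟩
  · simpa using hF.norm_lt_one hz.1
  · exact (hF.differentiableOn_div_deriv.deriv hD).comp hψd hψm
  · rw [hψl z hz.1]
    exact hF.hasDerivAt_div_deriv hz.1
  · have : ψ 0 = 0 := by
      have := hψl 0 h0
      rwa [hF.map_zero] at this
    rw [this, hF.deriv_div_deriv_zero]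
    simp
  · refine ((hL.differentiableAt (hD.mem_nhds hz.1)).hasDerivAt.div_const (k : ℂ)).congr_deriv ?_
    rw [(hder z hz.1).deriv, hFd]
    have h1 : z ≠ 0 := hz.2
    have h2 := Complex.exp_ne_zero ((L z - c) / k)
    simp only [sub_zero, Complex.ofReal_one]
    field_simp
    ring

/-! ### The exterior problem -/

/-- The image of `Ω` under the inversion `z ↦ (z - p)⁻¹`. -/
def inversion (p : ℂ) (Ω : Set ℂ) : Set ℂ := {w | p + w⁻¹ ∈ Ω}

theorem inversion_eq_image (p : ℂ) (A : Set ℂ) : inversion p A = (fun z => (z - p)⁻¹) '' A := by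
  ext w
  constructor
  · exact fun hw => ⟨p + w⁻¹, hw, by simp⟩
  · rintro ⟨z, hz, rfl⟩
    simpa [inversion] using hz

theorem isPreconnected_inversion {p : ℂ} {A : Set ℂ} (hA : IsPreconnected A) (hp : p ∉ A) :
    IsPreconnected (inversion p A) := by
  rw [inversion_eq_image]
  refine hA.image _ fun z hz => (ContinuousAt.inv₀ (by fun_prop) ?_).continuousWithinAt
  exact sub_ne_zero.2 fun h0 => hp (h0 ▸ hz)

theorem continuousAt_add_inv (p : ℂ) {w : ℂ} (hw : w ≠ 0) : ContinuousAt (fun w => p + w⁻¹) w :=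
  continuousAt_const.add (continuousAt_inv₀ hw)

/-- With the convention 0⁻¹ = 0, the origin belongs to `inversion p A` exactly when p belongs to A.
-/
theorem ne_zero_of_mem_inversion {p w : ℂ} {A : Set ℂ} (hp : p ∉ A) (hw : w ∈ inversion p A) :
    w ≠ 0 := by
  rintro rfl
  exact hp (by simpa [inversion] using hw)

theorem isOpen_inversion {p : ℂ} {A : Set ℂ} (hA : IsOpen A) (hp : p ∉ A) :
    IsOpen (inversion p A) := by
  rw [isOpen_iff_mem_nhds]
  intro w hw
  exact (continuousAt_add_inv p (ne_zero_of_mem_inversion hp hw)).preimage_mem_nhds (hA.mem_nhds hw)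

theorem tendsto_add_inv_cobounded (p : ℂ) :
    Tendsto (fun w : ℂ => p + w⁻¹) (𝓝[≠] 0) (Bornology.cobounded ℂ) :=
  (tendsto_const_add_cobounded p).comp tendsto_inv₀_nhdsNE_zero

theorem eventually_mem_inversion {p : ℂ} {A : Set ℂ} (hA : Bornology.IsBounded Aᶜ) :
    ∀ᶠ w in 𝓝[≠] 0, w ∈ inversion p A := by
  have h1 : A ∈ Bornology.cobounded ℂ := by
    have := Bornology.isBounded_def.1 hA
    rwa [compl_compl] at this
  exact (tendsto_add_inv_cobounded p).eventually h1

theorem isBounded_inversion {p : ℂ} {A : Set ℂ} (hp : p ∉ closure A) :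
    Bornology.IsBounded (inversion p A) := by
  obtain ⟨r, hr, hball⟩ := Metric.isOpen_iff.1 isClosed_closure.isOpen_compl p hp
  refine isBounded_iff_forall_norm_le.2 ⟨r⁻¹, fun w hw => ?_⟩
  by_contra hlt
  rw [not_le] at hlt
  refine hball (a := p + w⁻¹) ?_ (subset_closure hw)
  rw [mem_ball, dist_eq_norm, add_sub_cancel_left, norm_inv]
  exact inv_lt_of_inv_lt₀ hr hlt

/-- A harmonic function composed with the inversion is harmonic. -/
theorem harmonicAt_comp_add_inv {f : ℂ → ℝ} {p w : ℂ} (hw : w ≠ 0) (hf : HarmonicAt f (p + w⁻¹)) :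
    HarmonicAt (fun w => f (p + w⁻¹)) w := by
  obtain ⟨r, hr, hball⟩ := Metric.isOpen_iff.1 (isOpen_setOfPred_harmonicAt f) _ hf
  obtain ⟨u, hu, hre⟩ := HarmonicOnNhd.exists_analyticOnNhd_ball_re_eq (f := f) (z := p + w⁻¹)
    (R := r) fun z hz => hball hz
  have han : AnalyticAt ℂ (fun w => u (p + w⁻¹)) w :=
    AnalyticAt.comp (hu _ (mem_ball_self hr)) (analyticAt_const.add (analyticAt_id.inv hw))
  refine (harmonicAt_congr_nhds ?_).2 han.harmonicAt_re
  filter_upwards [(continuousAt_add_inv p hw).preimage_mem_nhds (ball_mem_nhds _ hr)] with x hx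
  exact (hre hx).symm

theorem tendsto_log_norm_nhdsNE : Tendsto (fun w : ℂ => Real.log ‖w‖) (𝓝[≠] 0) atBot :=
  Real.tendsto_log_nhdsGT_zero.comp tendsto_norm_nhdsNE_zero

theorem IsJordanLoop.length_pos {γ : ℝ → ℂ} {C : Set ℂ} (h : IsJordanLoop γ C) :
    0 < arcIntegral γ fun _ => 1 := by
  rw [arcIntegral]
  simp only [one_mul]
  exact intervalIntegral.intervalIntegral_pos_of_pos
    (h.continuous_deriv.norm.intervalIntegrable 0 1) (fun t => norm_pos_iff.2 (h.regular t)) one_pos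

/-- log|p + w⁻¹| = −log|w| + log|pw + 1|; the last term and the constant log(2π/ℓ) are bounded,
hence negligible against log|w|. -/
theorem ExteriorDirichlet.tendsto_div_log {Ω : Set ℂ} {γ₀ : ℝ → ℂ} {U : ℂ → ℝ} {Φ c : ℝ}
    (h : ExteriorDirichlet Ω γ₀ U Φ c) (p : ℂ) :
    Tendsto (fun w : ℂ => U (p + w⁻¹) / Real.log ‖w‖) (𝓝[≠] 0) (𝓝 (Φ / (2 * Real.pi))) := by
  set ℓ := arcIntegral γ₀ fun _ => 1 with hℓ
  have hℓ0 : 0 < ℓ := h.domain.loop.length_pos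
  have hpi := Real.pi_pos
  set a : ℂ → ℝ := fun z => -(Φ / (2 * Real.pi)) * Real.log (2 * Real.pi * ‖z‖ / ℓ) with ha
  have hlog0 : ∀ᶠ w : ℂ in 𝓝[≠] 0, Real.log ‖w‖ < 0 := tendsto_log_norm_nhdsNE.eventually_lt_atBot 0
  have h1 : Tendsto (fun w : ℂ => a (p + w⁻¹) / Real.log ‖w‖) (𝓝[≠] 0) (𝓝 (Φ / (2 * Real.pi))) := by
    have h2 : Tendsto (fun w : ℂ => (Real.log (2 * Real.pi / ℓ) + Real.log ‖p * w + 1‖) / Real.log ‖w‖)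
        (𝓝[≠] 0) (𝓝 0) := by
      have h3 : ContinuousAt (fun w : ℂ => Real.log (2 * Real.pi / ℓ) + Real.log ‖p * w + 1‖) 0 := by
        refine continuousAt_const.add (ContinuousAt.log (by fun_prop) (by simp))
      exact (h3.tendsto.mono_left nhdsWithin_le_nhds).div_atBot tendsto_log_norm_nhdsNE
    have h4 := (h2.sub_const 1).const_mul (-(Φ / (2 * Real.pi)))
    rw [zero_sub, mul_neg, mul_one, neg_neg] at h4
    refine h4.congr' ?_
    have h5 : ∀ᶠ w : ℂ in 𝓝[≠] 0, p * w + 1 ≠ 0 := by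
      refine nhdsWithin_le_nhds (ContinuousAt.eventually_ne (by fun_prop) (by simp))
    filter_upwards [hlog0, self_mem_nhdsWithin, h5] with w hw hw0 hw1
    have hw0 : w ≠ 0 := hw0
    have h6 : p + w⁻¹ = (p * w + 1) / w := by field_simp
    have h7 : Real.log (2 * Real.pi * ‖p + w⁻¹‖ / ℓ) =
        Real.log (2 * Real.pi / ℓ) + Real.log ‖p * w + 1‖ - Real.log ‖w‖ := by
      rw [h6, norm_div, show 2 * Real.pi * (‖p * w + 1‖ / ‖w‖) / ℓ =
        (2 * Real.pi / ℓ) * ‖p * w + 1‖ / ‖w‖ by ring,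
        Real.log_div (mul_ne_zero (by positivity) (norm_ne_zero_iff.2 hw1)) (norm_ne_zero_iff.2 hw0),
        Real.log_mul (by positivity) (norm_ne_zero_iff.2 hw1)]
    simp only [ha]
    rw [h7]
    have := hw.ne
    field_simp
  have h2 : Asymptotics.IsEquivalent (𝓝[≠] 0) (fun w : ℂ => U (p + w⁻¹)) (fun w => a (p + w⁻¹)) :=
    h.at_infinity.comp_tendsto (tendsto_add_inv_cobounded p)
  have h3 : Asymptotics.IsEquivalent (𝓝[≠] 0) (fun w : ℂ => U (p + w⁻¹) / Real.log ‖w‖)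
      (fun w => a (p + w⁻¹) / Real.log ‖w‖) :=
    h2.div Asymptotics.IsEquivalent.refl
  exact h3.symm.tendsto_nhds h1

/-- Inversion about a point p of the enclosed region turns Ω with the point at infinity into a
bounded domain D with connected complement, and infinity becomes the logarithmic pole at 0. -/
theorem ExteriorDirichlet.exists_isGreenField {Ω : Set ℂ} {γ₀ : ℝ → ℂ} {U : ℂ → ℝ} {Φ c : ℝ}
    (h : ExteriorDirichlet Ω γ₀ U Φ c) : ∃ (F ψ Q L : ℂ → ℂ) (p : ℂ),
      IsGreenField (closure Ω) Ω (frontier Ω) U c (Φ / (2 * Real.pi)) F ψ Q L p (-1) (-1) := by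
  obtain ⟨p, hp⟩ := h.domain.nonempty_enclosed
  have hpΩ : p ∉ Ω := fun h1 => hp (subset_closure h1)
  set A : Set ℂ := inversion p Ω with hA
  have hAo : IsOpen A := isOpen_inversion h.domain.isOpen hpΩ
  have hA0 : ∀ w ∈ A, w ≠ 0 := fun w hw => ne_zero_of_mem_inversion hpΩ hw
  have hAev : ∀ᶠ w in 𝓝[≠] 0, w ∈ A := eventually_mem_inversion h.domain.isBounded_compl
  set D : Set ℂ := insert 0 A with hDdef
  have h0 : (0 : ℂ) ∈ D := mem_insert _ _
  have hAD : A ⊆ D := subset_insert _ _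
  have hDA : D \ {0} = A := by
    rw [hDdef, insert_sdiff_of_mem _ (mem_singleton _), sdiff_singleton_eq_self]
    exact fun h1 => hA0 0 h1 rfl
  have hcl : D ⊆ closure A := by
    refine insert_subset (mem_closure_iff_frequently.2 ?_) subset_closure
    exact (hAev.frequently).filter_mono nhdsWithin_le_nhds
  have hD : IsOpen D := by
    rw [isOpen_iff_mem_nhds]
    rintro w (rfl | hw)
    · rw [eventually_nhdsWithin_iff] at hAev
      filter_upwards [hAev] with x hx
      by_cases hx0 : x = 0
      · exact Or.inl hx0
      · exact Or.inr (hx hx0)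
    · exact mem_of_superset (hAo.mem_nhds hw) hAD
  have hDc : IsPreconnected D :=
    (isPreconnected_inversion h.domain.isConnected.isPreconnected hpΩ).subset_closure hAD hcl
  have hDb : Bornology.IsBounded D := (isBounded_inversion hp).insert 0
  have hDc' : IsPreconnected Dᶜ := by
    -- Removing p removes w = 0, since 0⁻¹ = 0. The set Ωᶜ \ {p} is connected as it lies between the
    -- punctured enclosed region and its closure.
    have h1 : Dᶜ = inversion p (Ωᶜ \ {p}) := by
      ext w
      simp only [hDdef, hA, inversion, mem_compl_iff, mem_insert_iff, mem_ofPred_eq, Set.mem_sdiff,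
        mem_singleton_iff, not_or, add_eq_left, inv_eq_zero]
      tauto
    rw [h1]
    refine isPreconnected_inversion ?_ (by simp)
    have h2 := isPreconnected_diff_singleton IsJordanExterior.isOpen_enclosed
      h.domain.isPreconnected_enclosed hp
    refine h2.subset_closure (sdiff_subset_sdiff_left (compl_subset_compl.2 subset_closure)) ?_
    rw [← h.domain.closure_enclosed]
    intro z hz
    refine closure_sdiff ⟨hz.1, ?_⟩
    rw [closure_singleton]
    exact hz.2
  set f : ℂ → ℝ := fun w => U (p + w⁻¹) with hfd
  have hharm : HarmonicOnNhd f (D \ {0}) := fun w hw => by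
    rw [hDA] at hw
    exact harmonicAt_comp_add_inv (hA0 w hw) (h.harmonic _ hw)
  have htend := h.tendsto_div_log p
  have hlog0 : ∀ᶠ w : ℂ in 𝓝[≠] 0, Real.log ‖w‖ < 0 := tendsto_log_norm_nhdsNE.eventually_lt_atBot 0
  have hlog : f =O[𝓝[≠] 0] fun z => Real.log ‖z‖ := by
    refine Asymptotics.isBigO_of_div_tendsto_nhds ?_ _ htend
    filter_upwards [hlog0] with w hw h1 using absurd h1 hw.ne
  have hlim : ∀ w ∈ frontier D, Tendsto f (𝓝[D \ {0}] w) (𝓝 c) := fun w hw => by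
    have hw' := hw
    rw [hD.frontier_eq] at hw
    have hw0 : w ≠ 0 := fun h1 => hw.2 (h1 ▸ h0)
    have hwA : w ∈ closure A := by
      have := closure_mono hcl hw.1
      rwa [closure_closure] at this
    have hct := continuousAt_add_inv p hw0
    have h1 : Tendsto (fun w => p + w⁻¹) (𝓝[A] w) (𝓝[Ω] (p + w⁻¹)) :=
      tendsto_nhdsWithin_iff.2 ⟨hct.tendsto.mono_left nhdsWithin_le_nhds,
        eventually_nhdsWithin_of_forall fun x hx => hx⟩
    have hne : (𝓝[A] w).NeBot := mem_closure_iff_nhdsWithin_neBot.1 hwA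
    have hz : p + w⁻¹ ∈ frontier Ω := by
      rw [h.domain.isOpen.frontier_eq]
      refine ⟨mem_closure_iff_nhdsWithin_neBot.2 (hne.map _ |>.mono h1), fun h2 => hw.2 (hAD h2)⟩
    have h2 := (h.regular.continuousOn _ (frontier_subset_closure hz)).mono subset_closure
    rw [ContinuousWithinAt, h.dirichlet _ hz] at h2
    rw [hDA]
    exact h2.comp h1
  obtain ⟨k, L, hL, hg, hf⟩ := exists_eq_log_add_re hD hDc hDb hDc' h0 hharm hlog
  -- The coefficient is read off from the growth at infinity: Re L is bounded near 0, so f/log|w| →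
  -- k.
  have hkΦ : k = Φ / (2 * Real.pi) := by
    have h1 : Tendsto (fun w : ℂ => k + (L w).re / Real.log ‖w‖) (𝓝[≠] 0) (𝓝 (k + 0)) := by
      have h2 : ContinuousAt (fun w => (L w).re) 0 :=
        Complex.continuous_re.continuousAt.comp (hL.differentiableAt (hD.mem_nhds h0)).continuousAt
      exact tendsto_const_nhds.add
        ((h2.tendsto.mono_left nhdsWithin_le_nhds).div_atBot tendsto_log_norm_nhdsNE)
    rw [add_zero] at h1
    refine tendsto_nhds_unique h1 (htend.congr' ?_)
    filter_upwards [hlog0, hAev] with w hw hwA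
    have := hf w (hDA ▸ hwA)
    simp only [hfd] at this
    rw [this]
    have := hw.ne
    field_simp
  have hk : k ≠ 0 := by
    rw [hkΦ]
    exact div_ne_zero h.flux_pos.ne' Real.two_pi_pos.ne'
  have hkC : (k : ℂ) ≠ 0 := by exact_mod_cast hk
  obtain ⟨hF, hval, hder⟩ := isDiscMap_mul_exp hD hDc hDb h0 hk hL hf hlim
  set F : ℂ → ℂ := fun z => z * Complex.exp ((L z - c) / k) with hFd
  obtain ⟨ψ, hψd, hψm, hψr, hψl⟩ := hF.exists_inverse
  have hψ0 : ∀ b ∈ ball (0 : ℂ) 1, b ≠ 0 → ψ b ∈ A := fun b hb hb0 => by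
    rw [← hDA]
    exact ⟨hψm hb, fun h1 => hb0 (by rw [← hψr b hb, mem_singleton_iff.1 h1, hF.map_zero])⟩
  set V : ℂ → ℂ := fun z => F z / deriv F z with hV
  have hV0 : V 0 = 0 := by simp [hV, hF.map_zero]
  have hinv : ∀ z ∈ Ω, (z - p)⁻¹ ∈ A := fun z hz => by
    rw [hA, inversion_eq_image]; exact mem_image_of_mem _ hz
  have hsub : ∀ z ∈ Ω, z - p ≠ 0 := fun z hz h1 => hpΩ (sub_eq_zero.1 h1 ▸ hz)
  have hιd : ∀ z ∈ Ω, HasDerivAt (fun z => (z - p)⁻¹) (-((z - p)⁻¹) ^ 2) z := fun z hz => by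
    have := ((hasDerivAt_id z).sub_const p).inv (hsub z hz)
    refine this.congr_deriv ?_
    simp only [id]
    rw [neg_div, one_div, inv_pow]
  have hFdz : ∀ z ∈ Ω, HasDerivAt (fun z => F (z - p)⁻¹)
      (deriv F (z - p)⁻¹ * -((z - p)⁻¹) ^ 2) z := fun z hz =>
    HasDerivAt.comp (h₂ := F) z (hF.analyticOnNhd _ (hAD (hinv z hz))).differentiableAt.hasDerivAt (hιd z hz)
  -- With w = (z − p)⁻¹ and V = F/F' in the variable w, the quotient in the variable z is −(z −
  -- p)²V(w), whose derivative is V'(w) − 2V(w)/w. At w = 0 this is 1 − 2 = −1 = q, and ε = −1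
  -- because w has logarithmic derivative −1/(z − p).
  refine ⟨fun z => F (z - p)⁻¹, fun b => p + (ψ b)⁻¹,
    fun b => deriv V (ψ b) - 2 * dslope V 0 (ψ b), fun z => L (z - p)⁻¹ / k, p, ?_⟩
  rw [← hkΦ]
  have hdsl : DifferentiableOn ℂ (dslope V 0) D :=
    (Complex.differentiableOn_dslope (hD.mem_nhds h0)).2 hF.differentiableOn_div_deriv
  refine ⟨h.domain.isOpen, ?_, ⟨γ₀, h.domain.loop⟩, fun γ hγ => ?_, h.regular, h.dirichlet, hk,
    fun z hz => (hFdz z hz).differentiableAt.differentiableWithinAt, fun z hz => ⟨?_, fun hz0 => ?_⟩,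
    fun z hz => ?_, fun z hz => ?_, fun b hb => ?_, fun b hb => hψ0 b hb.1 hb.2, fun b hb => ?_,
    fun z hz => ?_, ?_, fun z hz => ?_, ?_, by norm_num, fun z hz => ?_, by norm_num, hp⟩
  · rw [h.domain.isOpen.frontier_eq, union_sdiff_cancel subset_closure]
  · obtain ⟨τ, -, hτ⟩ := (h.domain.of_isJordanParam hγ).exists_collars
    exact ⟨-τ, hτ⟩
  · simpa using hF.norm_lt_one (hAD (hinv z hz))
  · exact hA0 _ (hinv z hz) (hF.eq_zero _ (hAD (hinv z hz)) hz0)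
  · rw [(hFdz z hz).deriv]
    exact mul_ne_zero (hF.deriv_ne_zero (hAD (hinv z hz)))
      (neg_ne_zero.2 (pow_ne_zero 2 (hA0 _ (hinv z hz))))
  · have := hval _ (hDA ▸ hinv z hz)
    simp only [hfd, inv_inv, add_sub_cancel] at this
    exact this
  · exact (((hψd.differentiableAt (isOpen_ball.mem_nhds hb.1)).inv
      (hA0 _ (hψ0 b hb.1 hb.2))).const_add p).differentiableWithinAt
  · simp only [add_sub_cancel_left, inv_inv]
    exact hψr b hb.1
  · rw [hψl _ (hAD (hinv z hz))]
    simp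
  · exact ((hF.differentiableOn_div_deriv.deriv hD).comp hψd hψm).sub
      ((differentiableOn_const _).mul (hdsl.comp hψd hψm))
  · have hw := hinv z hz
    have hw0 := hA0 _ hw
    rw [hψl _ (hAD hw), dslope_of_ne _ hw0, slope_def_field, hV0, sub_zero, sub_zero]
    have h1 := HasDerivAt.comp z (hF.hasDerivAt_div_deriv (hAD hw)) (hιd z hz)
    have h2 := (h1.mul (((hasDerivAt_id z).sub_const p).pow 2)).neg
    refine (h2.congr_deriv ?_).congr_of_eventuallyEq ?_
    · have := hsub z hz
      simp only [Function.comp, id, Pi.pow_apply]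
      change -(deriv V (z - p)⁻¹ * _ * _ + V (z - p)⁻¹ * _) = _
      field_simp
      ring
    · filter_upwards [h.domain.isOpen.mem_nhds hz] with x hx
      rw [(hFdz x hx).deriv]
      have h3 := hsub x hx
      have h4 := hF.deriv_ne_zero (hAD (hinv x hx))
      simp only [Function.comp, id, Pi.neg_apply, Pi.mul_apply, Pi.pow_apply]
      field_simp
  · have : ψ 0 = 0 := by
      have := hψl 0 h0
      rwa [hF.map_zero] at this
    rw [this, dslope_same, hF.deriv_div_deriv_zero]
    norm_num
  · have hw := hinv z hz
    have hLd := HasDerivAt.comp z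
      (hL.differentiableAt (hD.mem_nhds (hAD hw))).hasDerivAt (hιd z hz)
    refine (hLd.div_const (k : ℂ)).congr_deriv ?_
    rw [(hFdz z hz).deriv, (hder _ (hAD hw)).deriv, hFd]
    have h1 := hsub z hz
    have h2 := Complex.exp_ne_zero ((L (z - p)⁻¹ - c) / k)
    push_cast
    field_simp
    ring

end PlanarField

theorem mainTheorem3 :
    (∀ (Ω : Set ℂ) (γ₀ : ℝ → ℂ) (U : ℂ → ℝ) (Φ c : ℝ),
      PlanarField.ExteriorDirichlet Ω γ₀ U Φ c →
        PlanarField.ConservationLaw (closure Ω) U Φ (Set.Iic c)) ∧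
    (∀ (Ω : Set ℂ) (γ₀ : ℝ → ℂ) (G : ℂ → ℝ) (Φ c : ℝ),
      PlanarField.InteriorDirichlet Ω γ₀ G Φ c →
        (0 < Φ → PlanarField.ConservationLaw ((Ω ∪ {0})ᶜ) G Φ (Set.Ici c)) ∧
        (Φ < 0 → PlanarField.ConservationLaw ((Ω ∪ {0})ᶜ) G |Φ| (Set.Iic c))) := by
  have hpi := Real.two_pi_pos
  refine ⟨fun Ω γ₀ U Φ c h => ?_, fun Ω γ₀ G Φ c h => ?_⟩
  · obtain ⟨F, ψ, Q, L, p, hF⟩ := h.exists_isGreenField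
    have hk : 0 < Φ / (2 * Real.pi) := div_pos h.flux_pos hpi
    refine hF.conservationLaw h.flux_pos (abs_of_pos hk) ?_
    ext φ
    rw [Set.mem_Iic, Set.mem_ofPred_eq, div_le_iff₀ hk, zero_mul, sub_nonpos]
  · obtain ⟨F, ψ, Q, L, hF⟩ := h.exists_isGreenField
    -- Here k = −Φ/2π and log|F| < 0, so the levels run upwards from c when Φ > 0 and downwards when
    -- Φ < 0.
    refine ⟨fun hΦ => ?_, fun hΦ => ?_⟩
    · have hk : -(Φ / (2 * Real.pi)) < 0 := neg_neg_of_pos (div_pos hΦ hpi)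
      refine hF.conservationLaw hΦ (by rw [abs_of_neg hk, neg_neg]) ?_
      ext φ
      rw [Set.mem_Ici, Set.mem_ofPred_eq, div_le_iff_of_neg hk, zero_mul, sub_nonneg]
    · have hk : 0 < -(Φ / (2 * Real.pi)) := neg_pos.2 (div_neg_of_neg_of_pos hΦ hpi)
      refine hF.conservationLaw (abs_pos.2 hΦ.ne) ?_ ?_
      · rw [abs_of_pos hk, abs_of_neg hΦ, neg_div]
      · ext φ
        rw [Set.mem_Iic, Set.mem_ofPred_eq, div_le_iff₀ hk, zero_mul, sub_nonpos]
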